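/- Let $k$ be a field of characteristic $0$, $\bar k$ an algebraic closure of $k$ and $\Gamma=\mathrm{Gal}(\bar k/k)$. Let $X$ be a quasi-compact and quasi-separated $k$-scheme, put $\bar X=X\times_k\bar k$, and let $G$ be a linear algebraic $k$-group, i.e. an affine $k$-group scheme of finite type; put $G_X=G\times_k X$ and $G_{\bar X}=G\times_k\bar X$. For $Y=X$ or $Y=\bar X$, a $G_Y$-torsor is a $Y$-scheme with a right action of $G_Y$ which becomes isomorphic to $G_Y$, acting on itself by right translations, over some étale covering of $Y$. Let $\bar P\to\bar X$ be a $G_{\bar X}$-torsor with field of moduli $k$, i.e. for every $\sigma\in\Gamma$ the conjugate torsor ${}^\sigma\bar P$ (the pullback of $\bar P$ along the automorphism of $\bar X$ induced by $\sigma$) is isomorphic to $\bar P$ as a $G_{\bar X}$-torsor. Suppose that $X$ has a $k$-rational point $x$, let $\bar x:\mathrm{Spec}\,\bar k\to\bar X$ be the point induced by $x$, and let $G'=\mathrm{ad}(\bar P)$ be the sheaf of automorphisms of the $G_{\bar X}$-torsor $\bar P$, whose sections over $Z\to\bar X$ are the automorphisms of the torsor $\bar P\times_{\bar X}Z$. Suppose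 that condition $(\star_{\bar P})$ holds: the restriction map $$H^0(\bar X,G')\longrightarrow H^0(\bar k,G'_{\bar x})$$ along $\bar x$ is bijective, where $H^0(\bar k,G'_{\bar x})$ is the group of automorphisms of the $G_{\bar k}$-torsor $\bar P_{\bar x}$ over $\bar k$. Then $\bar P$ is defined over $k$: there is a $G_X$-torsor $Q\to X$ such that $Q\times_X\bar X$ and $\bar P$ are isomorphic $G_{\bar X}$-torsors. -/

import Mathlib

open CategoryTheory Limits MonoidalCategory CartesianMonoidalCategory MonObj Opposite
open AlgebraicGeometry

universe v u w

noncomputable section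

/-! ### Objects over `Y` with a right action of the base change `G_Y` of a group object `G` -/

section General

variable {C : Type w} [Category.{v} C] [CartesianMonoidalCategory C]

/-- An object `P` over `Y` with a right action, over `Y`, of the group `G_Y = G × Y`. Since
`P ×_Y G_Y = P × G`, such an action is the same as a right action `P × G ⟶ P` of `G` which respects
the projection `P ⟶ Y`; it is recorded in this form, with the axioms of an action
(`p · 1 = p` and `(p · g) · h = p · (g h)`) stated on `T`-valued points for all `T`.
With `C` the category of `k`-schemes, this is a `Y`-scheme with a right action of the `Y`-group
scheme `G ×_k Y`. -/
structure ActedOver (G : C) [GrpObj G] (Y : C) where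
  obj : C
  proj : obj ⟶ Y
  act : obj ⊗ G ⟶ obj
  act_proj : act ≫ proj = fst obj G ≫ proj
  act_one : ∀ {T : C} (p : T ⟶ obj), lift p (1 : T ⟶ G) ≫ act = p
  act_mul : ∀ {T : C} (p : T ⟶ obj) (g h : T ⟶ G),
    lift (lift p g ≫ act) h ≫ act = lift p (g * h) ≫ act

namespace ActedOver

variable {G : C} [GrpObj G] {Y : C}

/-- A morphism: a `G`-equivariant morphism over `Y`. -/
@[ext]
structure Hom (P Q : ActedOver G Y) where
  hom : P.obj ⟶ Q.obj
  comm : hom ≫ Q.proj = P.proj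
  equivariant : P.act ≫ hom = (hom ▷ G) ≫ Q.act

instance : Category (ActedOver G Y) where
  Hom := Hom
  id P := ⟨𝟙 _, by simp, by simp⟩
  comp f g := ⟨f.hom ≫ g.hom, by rw [Category.assoc, g.comm, f.comm],
    by rw [reassoc_of% f.equivariant, g.equivariant, comp_whiskerRight, Category.assoc]⟩
  id_comp f := Hom.ext (Category.id_comp _)
  comp_id f := Hom.ext (Category.comp_id _)
  assoc f g h := Hom.ext (Category.assoc _ _ _)

@[ext]
theorem hom_ext {P Q : ActedOver G Y} {f g : P ⟶ Q} (h : f.hom = g.hom) : f = g := Hom.ext h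

@[simp] theorem id_hom (P : ActedOver G Y) : Hom.hom (𝟙 P) = 𝟙 P.obj := rfl

@[simp] theorem comp_hom {P Q R : ActedOver G Y} (f : P ⟶ Q) (g : Q ⟶ R) :
    (f ≫ g).hom = f.hom ≫ g.hom := rfl

/-- The trivial torsor: `G_Y` acting on itself by right translations. -/
def trivial (G : C) [GrpObj G] (Y : C) : ActedOver G Y where
  obj := Y ⊗ G
  proj := fst Y G
  act := lift (fst (Y ⊗ G) G ≫ fst Y G) ((fst (Y ⊗ G) G ≫ snd Y G) * snd (Y ⊗ G) G)
  act_proj := by simp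
  act_one p := by
    rw [comp_lift, MonObj.comp_mul, lift_fst_assoc, lift_fst_assoc, lift_snd, _root_.mul_one]
    ext <;> simp
  act_mul p g h := by ext <;> simp [MonObj.comp_mul, _root_.mul_assoc]

variable [HasPullbacks C]

/-- The action `(p, z) · g = (p · g, z)` on `P ×_Y Z`. -/
def baseChangeAct {Z : C} (P : ActedOver G Y) (f : Z ⟶ Y) :
    pullback P.proj f ⊗ G ⟶ pullback P.proj f :=
  pullback.lift ((pullback.fst P.proj f ▷ G) ≫ P.act)
    (fst (pullback P.proj f) G ≫ pullback.snd P.proj f)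
    (by rw [Category.assoc, P.act_proj, whiskerRight_fst_assoc, Category.assoc,
      pullback.condition])

theorem baseChangeAct_fst {Z : C} (P : ActedOver G Y) (f : Z ⟶ Y) :
    P.baseChangeAct f ≫ pullback.fst P.proj f = (pullback.fst P.proj f ▷ G) ≫ P.act :=
  pullback.lift_fst _ _ _

theorem baseChangeAct_snd {Z : C} (P : ActedOver G Y) (f : Z ⟶ Y) :
    P.baseChangeAct f ≫ pullback.snd P.proj f =
      fst (pullback P.proj f) G ≫ pullback.snd P.proj f :=
  pullback.lift_snd _ _ _

/-- The base change `P ×_Y Z` along `f : Z ⟶ Y`, with the induced action of `G_Z`. -/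
def baseChange {Z : C} (P : ActedOver G Y) (f : Z ⟶ Y) : ActedOver G Z where
  obj := pullback P.proj f
  proj := pullback.snd P.proj f
  act := P.baseChangeAct f
  act_proj := P.baseChangeAct_snd f
  act_one p := by
    apply pullback.hom_ext
    · rw [Category.assoc, baseChangeAct_fst, lift_whiskerRight_assoc, P.act_one]
    · rw [Category.assoc, baseChangeAct_snd, lift_fst_assoc]
  act_mul p g h := by
    apply pullback.hom_ext
    · rw [Category.assoc, Category.assoc, baseChangeAct_fst, lift_whiskerRight_assoc,
        lift_whiskerRight_assoc, Category.assoc, baseChangeAct_fst, lift_whiskerRight_assoc,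
        P.act_mul]
    · rw [Category.assoc, Category.assoc, baseChangeAct_snd, lift_fst_assoc, lift_fst_assoc,
        Category.assoc, baseChangeAct_snd, lift_fst_assoc]

variable {Z Z' Z'' : C} {P Q R : ActedOver G Y}

/-- The projection `P ×_Y Z ⟶ P`. -/
def fstBC (P : ActedOver G Y) (f : Z ⟶ Y) : (P.baseChange f).obj ⟶ P.obj :=
  pullback.fst P.proj f

/-- The point `(p, z)` of `P ×_Y Z`. -/
def liftBC {T : C} {f : Z ⟶ Y} (p : T ⟶ P.obj) (z : T ⟶ Z) (w : p ≫ P.proj = z ≫ f) :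
    T ⟶ (P.baseChange f).obj :=
  pullback.lift p z w

theorem fstBC_proj (P : ActedOver G Y) (f : Z ⟶ Y) :
    P.fstBC f ≫ P.proj = (P.baseChange f).proj ≫ f := pullback.condition

@[simp]
theorem liftBC_fst {T : C} {f : Z ⟶ Y} (p : T ⟶ P.obj) (z : T ⟶ Z) (w : p ≫ P.proj = z ≫ f) :
    liftBC p z w ≫ P.fstBC f = p := pullback.lift_fst _ _ _

@[simp]
theorem liftBC_proj {T : C} {f : Z ⟶ Y} (p : T ⟶ P.obj) (z : T ⟶ Z) (w : p ≫ P.proj = z ≫ f) :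
    liftBC p z w ≫ (P.baseChange f).proj = z := pullback.lift_snd _ _ _

theorem hom_extBC {T : C} {f : Z ⟶ Y} {a b : T ⟶ (P.baseChange f).obj}
    (h₁ : a ≫ P.fstBC f = b ≫ P.fstBC f)
    (h₂ : a ≫ (P.baseChange f).proj = b ≫ (P.baseChange f).proj) : a = b :=
  pullback.hom_ext h₁ h₂

theorem act_fstBC (P : ActedOver G Y) (f : Z ⟶ Y) :
    (P.baseChange f).act ≫ P.fstBC f = (P.fstBC f ▷ G) ≫ P.act := pullback.lift_fst _ _ _

/-- The morphism `P ×_Y Z' ⟶ P ×_Y Z`, `(p, z') ↦ (p, h z')`. -/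
def mapBC (P : ActedOver G Y) {f : Z ⟶ Y} {f' : Z' ⟶ Y} (h : Z' ⟶ Z) (w : h ≫ f = f') :
    (P.baseChange f').obj ⟶ (P.baseChange f).obj :=
  liftBC (P.fstBC f') ((P.baseChange f').proj ≫ h)
    ((P.fstBC_proj f').trans (by rw [Category.assoc, w]))

@[simp]
theorem mapBC_fst {f : Z ⟶ Y} {f' : Z' ⟶ Y} (h : Z' ⟶ Z) (w : h ≫ f = f') :
    P.mapBC h w ≫ P.fstBC f = P.fstBC f' := liftBC_fst _ _ _

@[simp]
theorem mapBC_proj {f : Z ⟶ Y} {f' : Z' ⟶ Y} (h : Z' ⟶ Z) (w : h ≫ f = f') :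
    P.mapBC h w ≫ (P.baseChange f).proj = (P.baseChange f').proj ≫ h := liftBC_proj _ _ _

theorem act_mapBC {f : Z ⟶ Y} {f' : Z' ⟶ Y} (h : Z' ⟶ Z) (w : h ≫ f = f') :
    (P.baseChange f').act ≫ P.mapBC h w = (P.mapBC h w ▷ G) ≫ (P.baseChange f).act := by
  apply hom_extBC
  · rw [Category.assoc, Category.assoc, mapBC_fst, act_fstBC, act_fstBC,
      ← comp_whiskerRight_assoc, mapBC_fst]
  · rw [Category.assoc, Category.assoc, mapBC_proj, act_proj, reassoc_of% @act_proj,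
      whiskerRight_fst_assoc, mapBC_proj]

theorem restrictHom_aux {f : Z ⟶ Y} {f' : Z' ⟶ Y} (h : Z' ⟶ Z) (w : h ≫ f = f')
    (φ : P.baseChange f ⟶ Q.baseChange f) :
    (P.mapBC h w ≫ φ.hom ≫ Q.fstBC f) ≫ Q.proj = (P.baseChange f').proj ≫ f' := by
  rw [Category.assoc, Category.assoc, fstBC_proj, reassoc_of% φ.comm, reassoc_of% @mapBC_proj, w]

/-- The restriction along `h : Z' ⟶ Z` of an equivariant morphism `φ : P ×_Y Z ⟶ Q ×_Y Z` over `Z`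
to an equivariant morphism `P ×_Y Z' ⟶ Q ×_Y Z'` over `Z'`. It sends `(p, z')` to `(q, z')`, where
`φ (p, h z') = (q, h z')`. -/
def restrictHom {f : Z ⟶ Y} {f' : Z' ⟶ Y} (h : Z' ⟶ Z) (w : h ≫ f = f')
    (φ : P.baseChange f ⟶ Q.baseChange f) : P.baseChange f' ⟶ Q.baseChange f' where
  hom := liftBC (P.mapBC h w ≫ φ.hom ≫ Q.fstBC f) (P.baseChange f').proj
    (restrictHom_aux h w φ)
  comm := liftBC_proj _ _ _
  equivariant := by
    apply hom_extBC
    · rw [Category.assoc, Category.assoc, liftBC_fst, act_fstBC, ← comp_whiskerRight_assoc,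
        liftBC_fst, reassoc_of% @act_mapBC, reassoc_of% φ.equivariant, act_fstBC]
      simp only [comp_whiskerRight, Category.assoc]
    · rw [Category.assoc, Category.assoc, liftBC_proj, act_proj, act_proj,
        whiskerRight_fst_assoc, liftBC_proj]

theorem restrictHom_fst {f : Z ⟶ Y} {f' : Z' ⟶ Y} (h : Z' ⟶ Z) (w : h ≫ f = f')
    (φ : P.baseChange f ⟶ Q.baseChange f) :
    (restrictHom h w φ).hom ≫ Q.fstBC f' = P.mapBC h w ≫ φ.hom ≫ Q.fstBC f :=
  liftBC_fst _ _ _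

theorem restrictHom_mapBC {f : Z ⟶ Y} {f' : Z' ⟶ Y} (h : Z' ⟶ Z) (w : h ≫ f = f')
    (φ : P.baseChange f ⟶ Q.baseChange f) :
    (restrictHom h w φ).hom ≫ Q.mapBC h w = P.mapBC h w ≫ φ.hom := by
  apply hom_extBC
  · rw [Category.assoc, mapBC_fst, restrictHom_fst, Category.assoc]
  · rw [Category.assoc, mapBC_proj, reassoc_of% (restrictHom h w φ).comm, Category.assoc, φ.comm,
      mapBC_proj]

/-- An equivariant morphism over `Z'` is determined by its first component. -/
theorem hom_ext_fst {f : Z ⟶ Y} {φ ψ : P.baseChange f ⟶ Q.baseChange f}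
    (h : φ.hom ≫ Q.fstBC f = ψ.hom ≫ Q.fstBC f) : φ = ψ :=
  hom_ext (hom_extBC h (φ.comm.trans ψ.comm.symm))

theorem restrictHom_id {f : Z ⟶ Y} {f' : Z' ⟶ Y} (h : Z' ⟶ Z) (w : h ≫ f = f') :
    restrictHom h w (𝟙 (P.baseChange f)) = 𝟙 (P.baseChange f') :=
  hom_ext_fst (by rw [restrictHom_fst, id_hom, id_hom, Category.id_comp, Category.id_comp,
    mapBC_fst])

theorem restrictHom_comp {f : Z ⟶ Y} {f' : Z' ⟶ Y} (h : Z' ⟶ Z) (w : h ≫ f = f')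
    (φ : P.baseChange f ⟶ Q.baseChange f) (ψ : Q.baseChange f ⟶ R.baseChange f) :
    restrictHom h w (φ ≫ ψ) = restrictHom h w φ ≫ restrictHom h w ψ :=
  hom_ext_fst (by rw [restrictHom_fst, comp_hom, comp_hom, Category.assoc, Category.assoc,
    restrictHom_fst, reassoc_of% @restrictHom_mapBC])

theorem restrictHom_self {f : Z ⟶ Y} (h : Z ⟶ Z) (hh : h = 𝟙 Z) (w : h ≫ f = f)
    (φ : P.baseChange f ⟶ Q.baseChange f) : restrictHom h w φ = φ := by
  have e : P.mapBC h w = 𝟙 _ := by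
    subst hh
    apply hom_extBC
    · rw [mapBC_fst, Category.id_comp]
    · rw [mapBC_proj, Category.id_comp, Category.comp_id]
  exact hom_ext_fst (by rw [restrictHom_fst, e, Category.id_comp])

theorem restrictHom_trans {f : Z ⟶ Y} {f' : Z' ⟶ Y} {f'' : Z'' ⟶ Y} (h : Z' ⟶ Z) (h' : Z'' ⟶ Z')
    (h'' : Z'' ⟶ Z) (hh : h'' = h' ≫ h) (w : h ≫ f = f') (w' : h' ≫ f' = f'') (w'' : h'' ≫ f = f'')
    (φ : P.baseChange f ⟶ Q.baseChange f) :
    restrictHom h'' w'' φ = restrictHom h' w' (restrictHom h w φ) := by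
  have e : P.mapBC h'' w'' = P.mapBC h' w' ≫ P.mapBC h w := by
    subst hh
    apply hom_extBC
    · rw [Category.assoc, mapBC_fst, mapBC_fst, mapBC_fst]
    · rw [Category.assoc, mapBC_proj, mapBC_proj, reassoc_of% @mapBC_proj]
  exact hom_ext_fst (by rw [restrictHom_fst, restrictHom_fst, restrictHom_fst, e, Category.assoc])

/-- Restriction of equivariant automorphisms along `h : Z' ⟶ Z`, as a group homomorphism. -/
def restrictAut (P : ActedOver G Y) {f : Z ⟶ Y} {f' : Z' ⟶ Y} (h : Z' ⟶ Z) (w : h ≫ f = f') :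
    Aut (P.baseChange f) →* Aut (P.baseChange f') where
  toFun φ :=
    { hom := restrictHom h w φ.hom
      inv := restrictHom h w φ.inv
      hom_inv_id := by rw [← restrictHom_comp, φ.hom_inv_id, restrictHom_id]
      inv_hom_id := by rw [← restrictHom_comp, φ.inv_hom_id, restrictHom_id] }
  map_one' := Iso.ext (restrictHom_id h w)
  map_mul' φ ψ := Iso.ext (restrictHom_comp h w ψ.hom φ.hom)

/-- The sheaf of automorphisms `ad(P)` of an object `P` with an action of `G_Y`: the functor which
sends `Z ⟶ Y` to the group of equivariant automorphisms of `P ×_Y Z` over `Z`. -/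
def ad (P : ActedOver G Y) : (Over Y)ᵒᵖ ⥤ GrpCat.{v} where
  obj Z := GrpCat.of (Aut (P.baseChange Z.unop.hom))
  map h := GrpCat.ofHom (P.restrictAut h.unop.left (Over.w h.unop))
  map_id _ := GrpCat.hom_ext <| MonoidHom.ext fun φ =>
    Iso.ext (restrictHom_self _ rfl _ (Iso.hom φ))
  map_comp h h' := GrpCat.hom_ext <| MonoidHom.ext fun φ =>
    Iso.ext (restrictHom_trans h.unop.left h'.unop.left _ rfl _ _ _ (Iso.hom φ))

end ActedOver
end General

/-! ### Torsors over `k`-schemes -/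

namespace ActedOver

variable {k : Type u} [Field k] {G : Over (Spec (.of k))} [GrpObj G]

/-- `P` is a `G_Y`-torsor on `Y`: on a suitable étale covering `U` of `Y` it becomes isomorphic to
the trivial `G_U`-torsor. (A covering family is replaced by the disjoint union of its members.) -/
def IsTorsor {Y : Over (Spec (.of k))} (P : ActedOver G Y) : Prop :=
  ∃ (U : Over (Spec (.of k))) (f : U ⟶ Y), Etale f.left ∧ Surjective f.left ∧
    Nonempty (P.baseChange f ≅ trivial G U)

end ActedOver

namespace TorsorDescent

variable (k : Type u) [Field k] (kbar : Type u) [Field kbar] [Algebra k kbar]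

/-- `Spec k̄` as a `k`-scheme. -/
def specBar : Over (Spec (.of k)) :=
  Over.mk (Spec.map (CommRingCat.ofHom (algebraMap k kbar)))

variable {k kbar}

/-- The automorphism of the `k`-scheme `Spec k̄` induced by `σ`. -/
def specGal (σ : Gal(kbar/k)) : specBar k kbar ⟶ specBar k kbar :=
  Over.homMk (Spec.map (CommRingCat.ofHom (σ : kbar ≃+* kbar).toRingHom)) (by
    dsimp [specBar]
    rw [← Spec.map_comp, ← CommRingCat.ofHom_comp]
    congr 2
    ext a
    exact σ.commutes a)

variable (kbar)

/-- `X̄ = X ×_k Spec k̄`. -/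
abbrev bar (X : Over (Spec (.of k))) : Over (Spec (.of k)) := X ⊗ specBar k kbar

/-- The geometric point `x̄ : Spec k̄ ⟶ X̄` induced by the rational point `x : Spec k ⟶ X`. -/
def geomPoint {X : Over (Spec (.of k))} (x : 𝟙_ (Over (Spec (.of k))) ⟶ X) :
    specBar k kbar ⟶ bar kbar X :=
  lift (toUnit _ ≫ x) (𝟙 _)

variable {kbar}
variable {G : Over (Spec (.of k))} [GrpObj G] {X : Over (Spec (.of k))}

/-- The conjugate `^σP̄`: the pullback of `P̄` along the automorphism of `X̄` induced by `σ`. -/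
def conj (σ : Gal(kbar/k)) (P : ActedOver G (bar kbar X)) : ActedOver G (bar kbar X) :=
  P.baseChange (X ◁ specGal σ)

/-- `P̄` has field of moduli `k`: it is isomorphic to all its Galois conjugates. -/
def HasFieldOfModuli (P : ActedOver G (bar kbar X)) : Prop :=
  ∀ σ : Gal(kbar/k), Nonempty (conj σ P ≅ P)

/-- `P̄` is defined over `k`: there is a `G_X`-torsor `Q` on `X` whose pullback to `X̄` is
isomorphic to `P̄` as a `G_X̄`-torsor. -/
def IsDefinedOver (P : ActedOver G (bar kbar X)) : Prop :=
  ∃ Q : ActedOver G X, Q.IsTorsor ∧ Nonempty (Q.baseChange (fst X (specBar k kbar)) ≅ P)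

/-- The evaluation map `H⁰(X̄, G') → H⁰(k̄, G'_x̄)` for `G' = ad(P̄)`: the restriction of the global
sections of `G'` along `x̄ : Spec k̄ ⟶ X̄`. -/
def evalAt (x : 𝟙_ (Over (Spec (.of k))) ⟶ X) (P : ActedOver G (bar kbar X)) :
    P.ad.obj (op (Over.mk (𝟙 (bar kbar X)))) →* P.ad.obj (op (Over.mk (geomPoint kbar x))) :=
  (P.ad.map (Over.homMk (geomPoint kbar x) : Over.mk (geomPoint kbar x) ⟶ Over.mk (𝟙 _)).op).hom

/-- Condition `(⋆_P̄)`: the evaluation map `H⁰(X̄, G') → H⁰(k̄, G'_x̄)` is bijective. -/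
def ConditionStar (x : 𝟙_ (Over (Spec (.of k))) ⟶ X) (P : ActedOver G (bar kbar X)) : Prop :=
  Function.Bijective (evalAt x P)

end TorsorDescent

end

/-! Fix a point `p` of `P̄` over `x̄`; one exists because a trivializing étale covering of `X̄` has
points over every geometric point. An isomorphism between `^σP̄` and `P̄` amounts to an equivariant
automorphism of the scheme `P̄` lying over the action of `σ` on `X̄`, and it is unique up to
automorphisms of the torsor. By `(⋆)` these automorphisms are the automorphisms of the fibre at
`x̄`, which act simply transitively on the points of that fibre. Hence exactly one semilinear lift
`a σ` satisfies `a σ ∘ p = p ∘ σ`, and uniqueness forces `a (σ τ)` to be the composite of `a σ` and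
`a τ` (`exists_semilinear`). So the field of moduli condition yields an actual Galois action.

For an infinite Galois group, descent also needs continuity: each function on `P̄` over an affine
piece of `X` must be fixed by all `σ` near `1`. Uniqueness gives this too. Over an affine flat cover
`T` of `X`, the restriction of `P̄` is affine and finitely presented over `T × k̄`, so some family
of lifts `ψ σ` of the Galois action fixes each function for `σ` near `1` (`exists_eventually_lift`).
A priori `ψ` is neither an action nor equivariant. But equivariance, compatibility with `p` and
descent from `T` to `X` are equalities of morphisms into schemes of finite type, so each is tested
on finitely many functions and holds for `σ` near `1`. For such `σ`, uniqueness identifies `ψ σ`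
with the restriction of `a σ` (`eventuallyFixes_of_cover`).

Since `G` is affine, `P̄` is affine over `X̄`. The spectra of the invariants over the affine opens
of `X` then glue to a scheme `Q` over `X` whose base change to `X̄` is `P̄`, because an algebra with
a continuous semilinear action is the base change of its invariants (`isPushout_fixedSubring`). The
action of `G` descends as a Galois-invariant morphism (`exists_descend`).

It remains to see that `Q` is trivial over an étale covering of `X`. A trivialization of `P̄` over
an étale covering of `X̄` gives a section of `Q` there. In characteristic `0` an étale algebra over
`R ⊗ k̄` is a union of étale `R`-subalgebras (`exists_etale_subalgebra`), and `Q` is of finite type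
over `X`, so the section is already defined over an étale covering of `X`
(`isTorsor_of_isTorsor_bar`). -/

noncomputable section

/-! ### Trivializations of torsors by sections -/

namespace ActedOver

section Trivializations

variable {C : Type w} [Category.{v} C] [CartesianMonoidalCategory C]
variable {G : C} [GrpObj G] {Y : C}

/-- The orbit map `(u, g) ↦ s(u) · g` of a generalized point `s` of `P`. -/
def orb (P : ActedOver G Y) {U : C} (s : U ⟶ P.obj) : U ⊗ G ⟶ P.obj := (s ▷ G) ≫ P.act

theorem lift_orb (P : ActedOver G Y) {U T : C} (s : U ⟶ P.obj) (t : T ⟶ U) (g : T ⟶ G) :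
    lift t g ≫ P.orb s = lift (t ≫ s) g ≫ P.act := by
  simp [orb]

theorem whiskerRight_orb (P : ActedOver G Y) {U T : C} (s : U ⟶ P.obj) (t : T ⟶ U) :
    (t ▷ G) ≫ P.orb s = P.orb (t ≫ s) := by
  simp [orb]

theorem orb_proj (P : ActedOver G Y) {U : C} (s : U ⟶ P.obj) :
    P.orb s ≫ P.proj = fst U G ≫ s ≫ P.proj := by
  simp [orb, P.act_proj]

theorem lift_one_orb (P : ActedOver G Y) {U : C} (s : U ⟶ P.obj) :
    lift (𝟙 U) 1 ≫ P.orb s = s := by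
  rw [lift_orb, Category.id_comp, P.act_one]

/-- The orbit map of a generalized point is equivariant. -/
theorem lift_orb_act (P : ActedOver G Y) {U T : C} (s : U ⟶ P.obj) (t : T ⟶ U) (g h : T ⟶ G) :
    lift (lift t g ≫ P.orb s) h ≫ P.act = lift t (g * h) ≫ P.orb s := by
  rw [lift_orb, lift_orb, P.act_mul]

/-- `s` is a section of `P` over `f : U ⟶ Y` which identifies `P ×_Y U` with `U × G`. -/
def IsTriv (P : ActedOver G Y) {U : C} (f : U ⟶ Y) (s : U ⟶ P.obj) : Prop :=
  IsPullback (P.orb s) (fst U G) P.proj f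

variable {P : ActedOver G Y} {U : C} {f : U ⟶ Y} {s : U ⟶ P.obj}

theorem IsTriv.comp_proj (h : P.IsTriv f s) : s ≫ P.proj = f := by
  have := congr(lift (𝟙 U) 1 ≫ $(h.w))
  rwa [← Category.assoc, lift_one_orb, lift_fst_assoc, Category.id_comp] at this

/-- The two sections differ by some `a : U ⟶ G`, namely `s' = s · a`, and the shear `(u, g) ↦ (u,
a(u) g)` of `U × G` carries the orbit map of `s` to that of `s'`. -/
theorem IsTriv.of_section (h : P.IsTriv f s) {s' : U ⟶ P.obj} (hs' : s' ≫ P.proj = f) :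
    P.IsTriv f s' := by
  let a : U ⟶ G := h.lift s' (𝟙 U) (by simp [hs']) ≫ snd U G
  have ha : lift s a ≫ P.act = s' := by
    have e : h.lift s' (𝟙 U) (by simp [hs']) = lift (𝟙 U) a := by
      ext
      · simpa using h.lift_snd s' (𝟙 U) (by simp [hs'])
      · simp [a]
    have := h.lift_fst s' (𝟙 U) (by simp [hs'])
    rwa [e, lift_orb, Category.id_comp] at this
  let e : U ⊗ G ≅ U ⊗ G :=
    { hom := lift (fst U G) ((fst U G ≫ a) * snd U G)
      inv := lift (fst U G) ((fst U G ≫ a)⁻¹ * snd U G)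
      hom_inv_id := by
        ext
        · simp
        · simp [MonObj.comp_mul, GrpObj.comp_inv]
      inv_hom_id := by ext <;> simp [MonObj.comp_mul] }
  refine IsPullback.of_iso h e.symm (Iso.refl _) (Iso.refl _) (Iso.refl _) ?_ (by simp [e])
    (by simp) (by simp)
  rw [Iso.symm_hom, Iso.refl_hom, Category.comp_id, Iso.eq_inv_comp]
  have : P.orb s' = lift (fst U G) (snd U G) ≫ P.orb s' := by simp
  rw [lift_orb] at this
  have h2 : fst U G ≫ s' = lift (fst U G) (fst U G ≫ a) ≫ P.orb s := by
    rw [lift_orb, ← ha, ← comp_lift_assoc]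
  simp only [e]
  rw [this, h2, lift_orb_act]

theorem isPullback_whiskerRight_fst {U V : C} (g : V ⟶ U) (G : C) :
    IsPullback (g ▷ G) (fst V G) (fst U G) g :=
  ⟨⟨by simp⟩, ⟨PullbackCone.IsLimit.mk _ (fun c => lift c.snd (c.fst ≫ snd U G))
    (fun c => by ext <;> simp [c.condition]) (fun c => by simp)
    (fun c m h₁ h₂ => by ext <;> simp [← h₁, ← h₂])⟩⟩

theorem IsTriv.comp (h : P.IsTriv f s) {V : C} (g : V ⟶ U) : P.IsTriv (g ≫ f) (g ≫ s) := by
  have := (isPullback_whiskerRight_fst g G).paste_horiz h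
  rwa [whiskerRight_orb] at this

/-- An equivariant morphism of torsors becomes the identity over a common trivialization. -/
theorem IsTriv.isPullback_hom {Q : ActedOver G Y} (hP : P.IsTriv f s) {t : U ⟶ Q.obj}
    (hQ : Q.IsTriv f t) (u : P ⟶ Q) :
    IsPullback (P.orb s) (𝟙 (U ⊗ G)) u.hom (Q.orb (s ≫ u.hom)) := by
  have hQ' : Q.IsTriv f (s ≫ u.hom) := hQ.of_section (by
    rw [Category.assoc, u.comm, hP.comp_proj])
  refine IsPullback.of_bot (h₁₁ := P.orb s) (v₂₁ := fst U G) ?_ ?_ hQ'.flip.flip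
  · rw [Category.id_comp, u.comm]; exact hP
  · simp [orb, u.equivariant]

/-- The trivial torsor has the obvious trivialization. -/
theorem isTriv_trivial : (trivial G U).IsTriv (𝟙 U) (lift (𝟙 U) 1) := by
  have : (trivial G U).orb (lift (𝟙 U) 1) = 𝟙 (U ⊗ G) := by
    dsimp [orb, trivial]
    ext <;> simp [MonObj.comp_mul]
  unfold IsTriv
  rw [this]
  exact IsPullback.of_id_fst

/-- Change of the base of an equivariant isomorphism onto the base change. -/
theorem IsTriv.of_isPullback {Z : C} {Q : ActedOver G Z} {g : Y ⟶ Z} {r : P.obj ⟶ Q.obj}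
    (h : P.IsTriv f s) (hr : IsPullback r P.proj Q.proj g)
    (he : P.act ≫ r = (r ▷ G) ≫ Q.act) : Q.IsTriv (f ≫ g) (s ≫ r) := by
  have := IsPullback.paste_vert h.flip hr.flip
  have e : P.orb s ≫ r = Q.orb (s ≫ r) := by simp [orb, he]
  rw [e] at this
  exact this.flip

theorem IsTriv.of_iso {Q : ActedOver G Y} (h : P.IsTriv f s) (e : P ≅ Q) :
    Q.IsTriv f (s ≫ e.hom.hom) := by
  have : IsIso e.hom.hom := ⟨e.inv.hom, by rw [← comp_hom, e.hom_inv_id]; rfl,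
    by rw [← comp_hom, e.inv_hom_id]; rfl⟩
  have := h.of_isPullback (g := 𝟙 Y) (IsPullback.of_horiz_isIso ⟨by simp [e.hom.comm]⟩)
    e.hom.equivariant
  rwa [Category.comp_id] at this

/-- An equivariant isomorphism over `Y` from an equivariant morphism with invertible underlying
morphism. -/
def isoOfHom {P Q : ActedOver G Y} (u : P ⟶ Q) (_ : IsIso u.hom) : P ≅ Q where
  hom := u
  inv := ⟨inv u.hom, by simp [← u.comm], by
    rw [← cancel_mono u.hom, Category.assoc, Category.assoc, IsIso.inv_hom_id, u.equivariant,
      ← comp_whiskerRight_assoc]; simp⟩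
  hom_inv_id := hom_ext (by simp)
  inv_hom_id := hom_ext (by simp)

theorem orb_equivariant (P : ActedOver G Y) (s : U ⟶ P.obj) :
    lift (fst (U ⊗ G) G ≫ fst U G) ((fst (U ⊗ G) G ≫ snd U G) * snd (U ⊗ G) G) ≫ P.orb s =
      (P.orb s ▷ G) ≫ P.act := by
  rw [← lift_orb_act]
  congr 1
  ext
  · simp
  · simp

variable [HasPullbacks C]

theorem isPullback_baseChange (P : ActedOver G Y) {Z : C} (f : Z ⟶ Y) :
    IsPullback (P.fstBC f) (P.baseChange f).proj P.proj f :=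
  IsPullback.of_hasPullback _ _

/-- The section of `P ×_Y U` defined by a section of `P` over `U ⟶ Y`. -/
def IsTriv.section (h : P.IsTriv f s) : U ⟶ (P.baseChange f).obj :=
  liftBC s (𝟙 U) (by rw [h.comp_proj, Category.id_comp])

theorem IsTriv.section_fstBC (h : P.IsTriv f s) : h.section ≫ P.fstBC f = s := liftBC_fst _ _ _

theorem IsTriv.section_proj (h : P.IsTriv f s) : h.section ≫ (P.baseChange f).proj = 𝟙 U :=
  liftBC_proj _ _ _

theorem IsTriv.orb_section_fstBC (h : P.IsTriv f s) :
    (P.baseChange f).orb h.section ≫ P.fstBC f = P.orb s := by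
  rw [orb, Category.assoc, act_fstBC, ← comp_whiskerRight_assoc, h.section_fstBC, orb]

theorem IsTriv.orb_section_proj (h : P.IsTriv f s) :
    (P.baseChange f).orb h.section ≫ (P.baseChange f).proj = fst U G := by
  rw [orb_proj, h.section_proj, Category.comp_id]

theorem IsTriv.isIso_orb_section (h : P.IsTriv f s) : IsIso ((P.baseChange f).orb h.section) := by
  have : (P.baseChange f).orb h.section = (h.isoIsPullback _ _ (P.isPullback_baseChange f)).hom :=
    hom_extBC (h.orb_section_fstBC.trans (h.isoIsPullback_hom_fst _ _ _).symm)
      (h.orb_section_proj.trans (h.isoIsPullback_hom_snd _ _ _).symm)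
  rw [this]
  infer_instance

/-- The trivialization given by a section. -/
def IsTriv.iso (h : P.IsTriv f s) : trivial G U ≅ P.baseChange f :=
  isoOfHom
    { hom := (P.baseChange f).orb h.section
      comm := h.orb_section_proj
      equivariant := orb_equivariant _ _ } h.isIso_orb_section

theorem IsTriv.exists_of_iso (e : P.baseChange f ≅ trivial G U) : ∃ s, P.IsTriv f s := by
  have h := ((isTriv_trivial (G := G) (U := U)).of_iso e.symm).of_isPullback
    (P.isPullback_baseChange f) (P.act_fstBC f)
  rw [Category.id_comp] at h
  exact ⟨_, h⟩

/-- The comparison map `m` from `U × G` to `P ×_Y U` has to be invertible. Its base change along `q`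
is an identity, and `q` is itself a base change of `g`, so the descent property of `W` applies. -/
theorem IsTriv.descend {V : C} {g : V ⟶ U} {W : MorphismProperty C}
    [(MorphismProperty.isomorphisms C).DescendsAlong W] [W.IsStableUnderBaseChange]
    (hg : W g) (hs : s ≫ P.proj = f) (h : P.IsTriv (g ≫ f) (g ≫ s)) : P.IsTriv f s := by
  have hw : P.orb s ≫ P.proj = fst U G ≫ f := by rw [orb_proj, hs]
  let m : U ⊗ G ⟶ pullback P.proj f := pullback.lift (P.orb s) (fst U G) hw
  have hm₁ : m ≫ pullback.fst _ _ = P.orb s := pullback.lift_fst _ _ _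
  have hm₂ : m ≫ pullback.snd _ _ = fst U G := pullback.lift_snd _ _ _
  let q : V ⊗ G ⟶ pullback P.proj f := (g ▷ G) ≫ m
  have h1 : IsPullback q (fst V G) (pullback.snd P.proj f) g := by
    refine IsPullback.of_right (h₁₂ := pullback.fst P.proj f) (h₂₂ := f) (v₁₃ := P.proj) ?_
      (by simp [q, hm₂]) (IsPullback.of_hasPullback _ _)
    simp only [q, Category.assoc, hm₁, whiskerRight_orb]
    exact h
  have h2 : IsPullback (g ▷ G) (𝟙 _) m q := by
    refine IsPullback.of_bot (v₂₁ := fst V G) (v₂₂ := pullback.snd P.proj f) (h₃₁ := g) ?_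
      (by simp [q]) h1
    rw [Category.id_comp, hm₂]
    exact isPullback_whiskerRight_fst g G
  have hq : W q := W.of_isPullback h1.flip hg
  have hi : IsIso m := MorphismProperty.of_isPullback_of_descendsAlong
    (P := MorphismProperty.isomorphisms C) h2.flip hq
      (inferInstanceAs (IsIso (𝟙 (V ⊗ G))))
  exact IsPullback.of_iso_pullback ⟨hw⟩ (asIso m) hm₁ hm₂

omit [HasPullbacks C] in
/-- Equivariant morphisms between torsors are isomorphisms. -/
theorem IsTriv.isIso_hom {Q : ActedOver G Y} (hP : P.IsTriv f s) {t : U ⟶ Q.obj}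
    (hQ : Q.IsTriv f t) {W : MorphismProperty C}
    [(MorphismProperty.isomorphisms C).DescendsAlong W] [W.IsStableUnderBaseChange]
    (hf : W f) (u : P ⟶ Q) : IsIso u.hom := by
  have h := hP.isPullback_hom hQ u
  have hQ' : Q.IsTriv f (s ≫ u.hom) := hQ.of_section (by
    rw [Category.assoc, u.comm, hP.comp_proj])
  have hW : W (Q.orb (s ≫ u.hom)) := W.of_isPullback hQ'.flip hf
  exact MorphismProperty.of_isPullback_of_descendsAlong
    (P := MorphismProperty.isomorphisms C) h.flip hW (inferInstanceAs (IsIso (𝟙 (U ⊗ G))))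

/-- Equivariant endomorphisms of a trivial torsor are determined by the image of a section. -/
theorem IsTriv.hom_ext (h : P.IsTriv f s) {φ ψ : P.baseChange f ⟶ P.baseChange f}
    (hs : h.section ≫ φ.hom = h.section ≫ ψ.hom) : φ = ψ := by
  have := h.isIso_orb_section
  ext
  rw [← cancel_epi ((P.baseChange f).orb h.section), orb, Category.assoc, Category.assoc,
    φ.equivariant, ψ.equivariant, ← comp_whiskerRight_assoc, ← comp_whiskerRight_assoc, hs]

/-- The automorphisms of a trivial torsor act transitively on sections. -/
theorem IsTriv.exists_aut (h : P.IsTriv f s) {s' : U ⟶ P.obj} (h' : P.IsTriv f s') :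
    ∃ φ : P.baseChange f ≅ P.baseChange f, h.section ≫ φ.hom.hom = h'.section := by
  refine ⟨h.iso.symm ≪≫ h'.iso, ?_⟩
  have e : (P.baseChange f).orb h.section ≫ (h.iso.symm ≪≫ h'.iso).hom.hom =
      (P.baseChange f).orb h'.section := congr(Hom.hom $(h.iso.hom_inv_id_assoc h'.iso.hom))
  rw [← lift_one_orb _ h'.section, ← e, ← Category.assoc, lift_one_orb]

end Trivializations

end ActedOver

/-! ### Descent of isomorphisms along flat coverings, over a base -/

/-- Flat surjective morphisms of `S`-schemes, locally of finite presentation. -/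
def fppfOver (S : Scheme.{u}) : MorphismProperty (Over S) :=
  (@Surjective ⊓ @Flat ⊓ @LocallyOfFinitePresentation : MorphismProperty Scheme.{u}).inverseImage
    (Over.forget S)

/-- Flat surjective quasi-compact morphisms of `S`-schemes. -/
def fpqcOver (S : Scheme.{u}) : MorphismProperty (Over S) :=
  (@Surjective ⊓ @Flat ⊓ @QuasiCompact : MorphismProperty Scheme.{u}).inverseImage
    (Over.forget S)

theorem CategoryTheory.IsPullback.left {S : Scheme.{u}} {A B C D : Over S} {a : A ⟶ B} {b : A ⟶ C}
    {c : B ⟶ D} {d : C ⟶ D} (h : IsPullback a b c d) :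
    IsPullback a.left b.left c.left d.left :=
  h.map (Over.forget S)

theorem CategoryTheory.IsPullback.of_left {S : Scheme.{u}} {A B C D : Over S} {a : A ⟶ B}
    {b : A ⟶ C} {c : B ⟶ D} {d : C ⟶ D} (h : IsPullback a.left b.left c.left d.left) :
    IsPullback a b c d :=
  IsPullback.of_map (Over.forget S) (by ext; exact h.w) h

instance (S : Scheme.{u}) : (fppfOver S).IsStableUnderBaseChange where
  of_isPullback h hg :=
    ⟨⟨MorphismProperty.of_isPullback (P := @Surjective) h.left hg.1.1,
      MorphismProperty.of_isPullback (P := @Flat) h.left hg.1.2⟩,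
      MorphismProperty.of_isPullback (P := @LocallyOfFinitePresentation) h.left hg.2⟩

instance (S : Scheme.{u}) : (fpqcOver S).IsStableUnderBaseChange where
  of_isPullback h hg :=
    ⟨⟨MorphismProperty.of_isPullback (P := @Surjective) h.left hg.1.1,
      MorphismProperty.of_isPullback (P := @Flat) h.left hg.1.2⟩,
      MorphismProperty.of_isPullback (P := @QuasiCompact) h.left hg.2⟩

theorem isIso_of_isIso_left {S : Scheme.{u}} {A B : Over S} (f : A ⟶ B) (h : IsIso f.left) :
    IsIso f :=
  have : IsIso ((Over.forget S).map f) := h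
  isIso_of_reflects_iso f (Over.forget S)

instance (S : Scheme.{u}) : (MorphismProperty.isomorphisms (Over S)).DescendsAlong (fppfOver S) where
  of_isPullback h hf (_ : IsIso _) := isIso_of_isIso_left _
    (MorphismProperty.of_isPullback_of_descendsAlong (P := MorphismProperty.isomorphisms Scheme)
      h.left hf (inferInstanceAs (IsIso ((Over.forget S).map _))))

instance (S : Scheme.{u}) : (MorphismProperty.isomorphisms (Over S)).DescendsAlong (fpqcOver S) where
  of_isPullback h hf (_ : IsIso _) := isIso_of_isIso_left _
    (MorphismProperty.of_isPullback_of_descendsAlong (P := MorphismProperty.isomorphisms Scheme)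
      h.left hf (inferInstanceAs (IsIso ((Over.forget S).map _))))

theorem fppfOver_of_etale {S : Scheme.{u}} {A B : Over S} (f : A ⟶ B) [Etale f.left]
    [Surjective f.left] : fppfOver S f :=
  ⟨⟨inferInstanceAs (Surjective f.left), inferInstanceAs (Flat f.left)⟩,
    inferInstanceAs (LocallyOfFinitePresentation f.left)⟩

namespace ActedOver

variable {k : Type u} [Field k] {G : Over (Spec (.of k))} [GrpObj G] {Y : Over (Spec (.of k))}

theorem IsTorsor.exists_isTriv {P : ActedOver G Y} (h : P.IsTorsor) :
    ∃ (U : Over (Spec (.of k))) (f : U ⟶ Y) (s : U ⟶ P.obj), Etale f.left ∧ Surjective f.left ∧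
      P.IsTriv f s := by
  obtain ⟨U, f, h₁, h₂, ⟨e⟩⟩ := h
  obtain ⟨s, hs⟩ := IsTriv.exists_of_iso e
  exact ⟨U, f, s, h₁, h₂, hs⟩

/-- Equivariant morphisms of torsors are isomorphisms. -/
theorem IsTorsor.isIso_hom {P Q : ActedOver G Y} (hP : P.IsTorsor) (hQ : Q.IsTorsor) (u : P ⟶ Q) :
    IsIso u.hom := by
  obtain ⟨U, f, s, _, _, hs⟩ := hP.exists_isTriv
  obtain ⟨V, g, t, _, _, ht⟩ := hQ.exists_isTriv
  have h₁ := hs.comp (pullback.fst f g)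
  have h₂ := ht.comp (pullback.snd f g)
  rw [← pullback.condition] at h₂
  have : Surjective (pullback.fst f g).left :=
    MorphismProperty.of_isPullback (P := @Surjective) (IsPullback.of_hasPullback f g).left.flip ‹_›
  have : Etale (pullback.fst f g).left :=
    MorphismProperty.of_isPullback (P := @Etale) (IsPullback.of_hasPullback f g).left.flip ‹_›
  have : Surjective (pullback.fst f g ≫ f).left :=
    inferInstanceAs (Surjective ((pullback.fst f g).left ≫ f.left))
  have : Etale (pullback.fst f g ≫ f).left :=
    inferInstanceAs (Etale ((pullback.fst f g).left ≫ f.left))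
  exact h₁.isIso_hom h₂ (fppfOver_of_etale _) u

end ActedOver

/-! ### Automorphisms of a torsor and the semilinear Galois action -/

namespace TorsorDescent

open ActedOver

variable {k : Type u} [Field k] {kbar : Type u} [Field kbar] [Algebra k kbar]
variable {G : Over (Spec (.of k))} [GrpObj G] {X : Over (Spec (.of k))}

/-- A torsor under `G` has points over every geometric point of the base. -/
theorem exists_isTriv_of_isSepClosed [IsSepClosed kbar] {Y : Over (Spec (.of k))}
    {P : ActedOver G Y} (hP : P.IsTorsor) (y : specBar k kbar ⟶ Y) :
    ∃ p : specBar k kbar ⟶ P.obj, P.IsTriv y p := by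
  obtain ⟨U, f, s, _, hf, hs⟩ := hP.exists_isTriv
  let y' : Spec (.of kbar) ⟶ Y.left := y.left
  obtain ⟨z, hz⟩ := hf.surj (y' default)
  obtain ⟨l, hl, -⟩ := Scheme.exists_fac_of_etale_of_isSepClosed f.left y' z hz
  let l' : specBar k kbar ⟶ U := Over.homMk l (by
    have := congr($hl ≫ Y.hom)
    rw [Category.assoc, Over.w] at this
    exact this.trans (Over.w y))
  have : l' ≫ f = y := by ext; exact hl
  exact ⟨l' ≫ s, this ▸ hs.comp l'⟩

section Automorphisms

variable {Y Z : Over (Spec (.of k))} {P : ActedOver G Y} {y : Z ⟶ Y} {p : Z ⟶ P.obj}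

/-- Automorphisms of `P` are the same as automorphisms of its pullback along the identity. -/
theorem exists_hom_of_baseChange_id (φ : P.baseChange (𝟙 Y) ⟶ P.baseChange (𝟙 Y)) :
    ∃ u : P ⟶ P, P.fstBC (𝟙 Y) ≫ u.hom = φ.hom ≫ P.fstBC (𝟙 Y) := by
  let i : P.obj ⟶ (P.baseChange (𝟙 Y)).obj := liftBC (𝟙 _) P.proj (by simp)
  have hi : P.fstBC (𝟙 Y) ≫ i = 𝟙 _ := hom_extBC (by simp [i]) (by
    simp [i, fstBC_proj])
  have hi' : i ≫ P.fstBC (𝟙 Y) = 𝟙 _ := by simp [i]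
  have hact : P.act ≫ i = (i ▷ G) ≫ (P.baseChange (𝟙 Y)).act := by
    apply hom_extBC
    · rw [Category.assoc, hi', Category.assoc, act_fstBC, ← comp_whiskerRight_assoc, hi']
      simp
    · simp [i, act_proj]
  refine ⟨⟨i ≫ φ.hom ≫ P.fstBC (𝟙 Y), ?_, ?_⟩, by rw [reassoc_of% hi]⟩
  · rw [Category.assoc, Category.assoc, fstBC_proj, reassoc_of% φ.comm]
    simp [i]
  · rw [reassoc_of% hact, reassoc_of% φ.equivariant, act_fstBC]
    simp

/-- Equivariant endomorphisms of a torsor are determined by a point, if the restriction of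
automorphisms to that point is injective. -/
theorem endo_eq_id (hP : P.IsTorsor) (hp : P.IsTriv y p)
    (hinj : Function.Injective (P.restrictAut (f := 𝟙 Y) (f' := y) y (by simp)))
    (u : P ⟶ P) (hu : p ≫ u.hom = p) : u.hom = 𝟙 _ := by
  have hi := hP.isIso_hom hP u
  let v : P.baseChange (𝟙 Y) ⟶ P.baseChange (𝟙 Y) :=
    { hom := liftBC (P.fstBC (𝟙 Y) ≫ u.hom) (P.baseChange (𝟙 Y)).proj (by
        rw [Category.assoc, u.comm, fstBC_proj])
      comm := liftBC_proj _ _ _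
      equivariant := by
        apply hom_extBC
        · rw [Category.assoc, liftBC_fst, reassoc_of% @act_fstBC, u.equivariant,
            Category.assoc, act_fstBC, ← comp_whiskerRight_assoc, ← comp_whiskerRight_assoc,
            liftBC_fst]
        · rw [Category.assoc, liftBC_proj, Category.assoc, act_proj,
            whiskerRight_fst_assoc, liftBC_proj] }
  have hv : v.hom ≫ P.fstBC (𝟙 Y) = P.fstBC (𝟙 Y) ≫ u.hom := liftBC_fst _ _ _
  have hf : IsIso (P.fstBC (𝟙 Y)) := (P.isPullback_baseChange (𝟙 Y)).isIso_fst_of_isIso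
  have hvi : IsIso v.hom := by
    have : IsIso (v.hom ≫ P.fstBC (𝟙 Y)) := by rw [hv]; infer_instance
    exact IsIso.of_isIso_comp_right _ (P.fstBC (𝟙 Y))
  -- Over `y` the automorphism fixes the trivializing section, hence is the identity there;
  -- injectivity of restriction carries this back to `Y`.
  have h1 : (isoOfHom v hvi : Aut (P.baseChange (𝟙 Y))) = (1 : Aut _) := by
    apply hinj
    refine Eq.trans ?_ (map_one _).symm
    apply Iso.ext
    change restrictHom _ _ v = 𝟙 _
    apply hp.hom_ext
    apply hom_extBC
    · rw [Category.assoc, restrictHom_fst, hv, id_hom, Category.assoc, Category.id_comp,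
        reassoc_of% @mapBC_fst, ← Category.assoc, hp.section_fstBC, hu]
    · rw [Category.assoc, Hom.comm, id_hom, Category.comp_id]
  have h2 : v = 𝟙 _ := congr(Iso.hom $h1)
  rw [← cancel_epi (P.fstBC (𝟙 Y)), ← hv, h2]
  simp

/-- Automorphisms of a torsor act transitively on the points of a fibre, if the restriction of
automorphisms to that fibre is surjective. -/
theorem exists_endo (hp : P.IsTriv y p) {p' : Z ⟶ P.obj} (hp' : P.IsTriv y p')
    (hsurj : Function.Surjective (P.restrictAut (f := 𝟙 Y) (f' := y) y (by simp))) :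
    ∃ u : P ⟶ P, p ≫ u.hom = p' := by
  obtain ⟨φ, hφ⟩ := hp.exists_aut hp'
  obtain ⟨ψ, rfl⟩ := hsurj φ
  obtain ⟨u, hu⟩ := exists_hom_of_baseChange_id ψ.hom
  refine ⟨u, ?_⟩
  have := congr($hφ ≫ P.fstBC y)
  rw [hp'.section_fstBC, Category.assoc] at this
  change _ ≫ (restrictHom _ _ ψ.hom).hom ≫ _ = _ at this
  rw [restrictHom_fst, ← hu, reassoc_of% @mapBC_fst, ← Category.assoc, hp.section_fstBC] at this
  exact this

end Automorphisms

section GaloisAction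

/-- `a` is an equivariant endomorphism of `P` over the endomorphism `τ` of the base. -/
structure IsSemi {Y : Over (Spec (.of k))} (P : ActedOver G Y) (τ : Y ⟶ Y)
    (a : P.obj ⟶ P.obj) : Prop where
  proj : a ≫ P.proj = P.proj ≫ τ
  act : P.act ≫ a = (a ▷ G) ≫ P.act

theorem IsSemi.comp {Y : Over (Spec (.of k))} {P : ActedOver G Y} {τ τ' : Y ⟶ Y}
    {a a' : P.obj ⟶ P.obj} (h : IsSemi P τ a) (h' : IsSemi P τ' a') :
    IsSemi P (τ ≫ τ') (a ≫ a') where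
  proj := by rw [Category.assoc, h'.proj, reassoc_of% h.proj]
  act := by rw [reassoc_of% h.act, h'.act, comp_whiskerRight, Category.assoc]

theorem specGal_one : specGal (1 : Gal(kbar/k)) = 𝟙 _ := by
  ext
  exact Spec.map_id _

theorem specGal_mul (σ τ : Gal(kbar/k)) : specGal (σ * τ) = specGal σ ≫ specGal τ := by
  ext
  exact Spec.map_comp (CommRingCat.ofHom (τ : kbar ≃+* kbar).toRingHom)
    (CommRingCat.ofHom (σ : kbar ≃+* kbar).toRingHom)

instance (σ : Gal(kbar/k)) : IsIso (specGal σ) :=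
  ⟨specGal σ⁻¹, by rw [← specGal_mul, mul_inv_cancel, specGal_one],
    by rw [← specGal_mul, inv_mul_cancel, specGal_one]⟩

theorem geomPoint_whiskerLeft (x : 𝟙_ (Over (Spec (.of k))) ⟶ X) (σ : Gal(kbar/k)) :
    geomPoint kbar x ≫ X ◁ specGal σ = specGal σ ≫ geomPoint kbar x := by
  ext1 <;> simp [geomPoint]

/-- Under the condition `(⋆)`, a torsor with field of moduli `k` carries a unique semilinear action
of the Galois group which is compatible with a chosen point over `x̄`. -/
theorem exists_semilinear [IsSepClosed kbar] {P : ActedOver G (bar kbar X)} (hP : P.IsTorsor)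
    (hmod : HasFieldOfModuli P) (x : 𝟙_ (Over (Spec (.of k))) ⟶ X) (hstar : ConditionStar x P) :
    ∃ (p : specBar k kbar ⟶ P.obj) (a : Gal(kbar/k) → (P.obj ⟶ P.obj)),
      p ≫ P.proj = geomPoint kbar x ∧ ∀ σ, IsSemi P (X ◁ specGal σ) (a σ) ∧
        p ≫ a σ = specGal σ ≫ p ∧
        ∀ b, IsSemi P (X ◁ specGal σ) b → p ≫ b = specGal σ ≫ p → b = a σ := by
  obtain ⟨p, hp⟩ := exists_isTriv_of_isSepClosed hP (geomPoint kbar x)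
  have hst : Function.Bijective
    (P.restrictAut (f := 𝟙 _) (f' := geomPoint kbar x) (geomPoint kbar x) (by simp)) := hstar
  suffices H : ∀ σ : Gal(kbar/k), ∃ a, IsSemi P (X ◁ specGal σ) a ∧
        p ≫ a = specGal σ ≫ p ∧
        ∀ b, IsSemi P (X ◁ specGal σ) b → p ≫ b = specGal σ ≫ p → b = a by
    choose a ha using H
    exact ⟨p, a, hp.comp_proj, ha⟩
  intro σ
  obtain ⟨(e : P.baseChange (X ◁ specGal σ) ≅ P)⟩ := hmod σ
  -- The projection from the conjugate torsor to `P` is semilinear, so composing it with an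
  -- isomorphism onto the conjugate gives a first semilinear lift `c` of `σ`. It need not respect
  -- `p`.
  have hc : IsSemi P (X ◁ specGal σ) (e.inv.hom ≫ P.fstBC (X ◁ specGal σ)) :=
    ⟨by rw [Category.assoc, fstBC_proj]; exact congr($(e.inv.comm) ≫ X ◁ specGal σ),
      by rw [reassoc_of% e.inv.equivariant]
         refine (congr(_ ≫ $(P.act_fstBC _))).trans ?_
         rw [comp_whiskerRight, Category.assoc]⟩
  have hci : IsIso (e.inv.hom ≫ P.fstBC (X ◁ specGal σ)) := by
    have : IsIso (P.fstBC (X ◁ specGal σ)) :=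
      (P.isPullback_baseChange (X ◁ specGal σ)).isIso_fst_of_isIso
    have : IsIso e.inv.hom :=
      ⟨e.hom.hom, congr(Hom.hom $(e.inv_hom_id)), congr(Hom.hom $(e.hom_inv_id))⟩
    infer_instance
  generalize e.inv.hom ≫ P.fstBC (X ◁ specGal σ) = c at hc hci
  -- `p ≫ c` lies over the conjugate of `x̄`; precomposing with the inverse of `σ` brings it back to
  -- the fibre at `x̄`, where an automorphism `u` of the torsor can move it to `p`.
  have hp' : P.IsTriv (geomPoint kbar x) (inv (specGal σ) ≫ p ≫ c) := hp.of_section (by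
    rw [Category.assoc, Category.assoc, hc.proj, reassoc_of% hp.comp_proj, geomPoint_whiskerLeft,
      IsIso.inv_hom_id_assoc])
  obtain ⟨u, hu⟩ := exists_endo hp' hp hst.2
  have hui := hP.isIso_hom hP u
  have ha : IsSemi P (X ◁ specGal σ) (c ≫ u.hom) := by
    have hu' : IsSemi P (𝟙 _) u.hom := ⟨by rw [u.comm, Category.comp_id], u.equivariant⟩
    simpa using hc.comp hu'
  have hpa : p ≫ c ≫ u.hom = specGal σ ≫ p := by
    have := congr(specGal σ ≫ $hu)
    rwa [Category.assoc, Category.assoc, IsIso.hom_inv_id_assoc] at this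
  have hai : IsIso (c ≫ u.hom) := inferInstance
  generalize c ≫ u.hom = a at ha hpa hai
  refine ⟨a, ha, hpa, fun b hb hpb => ?_⟩
  -- Two semilinear lifts of the same `σ` differ by a morphism over the identity of the base. This
  -- one fixes `p`, hence is trivial.
  let v : P ⟶ P :=
    { hom := b ≫ inv a
      comm := by
        rw [← cancel_mono (X ◁ specGal σ), Category.assoc, Category.assoc, ← ha.proj,
          IsIso.inv_hom_id_assoc, hb.proj, ha.proj]
      equivariant := by
        rw [← cancel_mono a, Category.assoc, Category.assoc, IsIso.inv_hom_id, Category.assoc,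
          ha.act, ← comp_whiskerRight_assoc, Category.assoc, IsIso.inv_hom_id, Category.comp_id]
        exact hb.act }
  have hv : v.hom = 𝟙 _ := endo_eq_id hP hp hst.1 v (by
    change p ≫ b ≫ inv a = p
    rw [reassoc_of% hpb, ← reassoc_of% hpa, IsIso.hom_inv_id, Category.comp_id])
  have : b ≫ inv a = 𝟙 _ := hv
  rw [← Category.id_comp a, ← this, Category.assoc, IsIso.inv_hom_id, Category.comp_id]

end GaloisAction

end TorsorDescent

/-! ### Flat base change and descent of affineness -/

namespace AlgebraicGeometry

theorem Scheme.Hom.appLE_top_eq_appTop {X Y : Scheme.{u}} (f : X ⟶ Y) (e : ⊤ ≤ f ⁻¹ᵁ ⊤) :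
    f.appLE ⊤ ⊤ e = f.appTop :=
  f.appLE_eq_app

/-- Flat base change for global sections of quasi-compact quasi-separated schemes. -/
theorem isPushout_appTop_of_flat {X Y S T : Scheme.{u}} {f : T ⟶ S} {g : Y ⟶ X} {iX : X ⟶ S}
    {iY : Y ⟶ T} (H : IsPullback g iY iX f) [IsAffine S] [IsAffine T] [Flat f] [CompactSpace X]
    [QuasiSeparatedSpace X] : IsPushout iX.appTop f.appTop g.appTop iY.appTop := by
  have h := (isIso_pushoutSection_iff H (US := ⊤) (UT := ⊤) (UX := ⊤) (UY := ⊤) le_top le_top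
    (by simp)).mp (isIso_pushoutSection_of_isQuasiSeparated_of_flat_right H _ _ _
      (isAffineOpen_top S) (isAffineOpen_top T) isCompact_univ isQuasiSeparated_univ)
  convert h using 1 <;> exact (Scheme.Hom.appLE_top_eq_appTop _ _).symm

theorem isPushout_appTop_of_isAffine {X Y S T : Scheme.{u}} {f : T ⟶ S} {g : Y ⟶ X} {iX : X ⟶ S}
    {iY : Y ⟶ T} (H : IsPullback g iY iX f) [IsAffine S] [IsAffine T] [IsAffine X] :
    IsPushout iX.appTop f.appTop g.appTop iY.appTop := by
  have h := (isIso_pushoutSection_iff H (US := ⊤) (UT := ⊤) (UX := ⊤) (UY := ⊤) le_top le_top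
    (by simp)).mp (isIso_pushoutSection_of_isAffineOpen H _ _ _
      (isAffineOpen_top S) (isAffineOpen_top T) (isAffineOpen_top X))
  convert h using 1 <;> exact (Scheme.Hom.appLE_top_eq_appTop _ _).symm

/-- `X` inherits compactness and quasi-separatedness from `Y`, which surjects onto it by an affine
morphism. Flat base change of global sections then exhibits the canonical map from `Y` to the
spectrum of its functions as the base change of that of `X` along a faithfully flat morphism. The
former is an isomorphism, hence so is the latter. -/
theorem isAffine_of_isPullback {X Y S T : Scheme.{u}} {f : T ⟶ S} {g : Y ⟶ X} {iX : X ⟶ S}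
    {iY : Y ⟶ T} (H : IsPullback g iY iX f) [IsAffine S] [IsAffine T] [Flat f] [Surjective f]
    [IsAffine Y] : IsAffine X := by
  have hg : Surjective g := MorphismProperty.of_isPullback (P := @Surjective) H.flip ‹_›
  have hga : IsAffineHom g := MorphismProperty.of_isPullback (P := @IsAffineHom) H.flip inferInstance
  have : CompactSpace X := ⟨by
    rw [← Set.range_eq_univ.mpr g.surjective]
    exact isCompact_range g.continuous⟩
  have : QuasiSeparatedSpace X := by
    rw [quasiSeparatedSpace_iff_forall_affineOpens]
    intro U V
    have : (U ∩ V : Set X) = g '' (g ⁻¹' (U ∩ V)) := (Set.image_preimage_eq _ g.surjective).symm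
    rw [this]
    refine IsCompact.image ?_ g.continuous
    have hU : IsAffineOpen (g ⁻¹ᵁ U) := hga.isAffine_preimage U U.2
    have hV : IsAffineOpen (g ⁻¹ᵁ V) := hga.isAffine_preimage V V.2
    exact QuasiSeparatedSpace.inter_isCompact (g ⁻¹ᵁ U).1 (g ⁻¹ᵁ V).1 (g ⁻¹ᵁ U).2 hU.isCompact
      (g ⁻¹ᵁ V).2 hV.isCompact
  have hpush := isPushout_appTop_of_flat H
  have h1 := hpush.op.map Scheme.Spec
  have h2 : IsPullback (Spec.map g.appTop) (Spec.map iY.appTop ≫ T.isoSpec.inv)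
      (Spec.map iX.appTop ≫ S.isoSpec.inv) f :=
    h1.flip.of_iso (Iso.refl _) (Iso.refl _) T.isoSpec.symm S.isoSpec.symm (by simp) (by simp)
      (by simp) (by simp [Scheme.isoSpec_inv_naturality])
  have h3 : IsPullback g Y.toSpecΓ X.toSpecΓ (Spec.map g.appTop) := by
    refine IsPullback.of_bot (h₃₁ := f) (v₂₁ := Spec.map iY.appTop ≫ T.isoSpec.inv)
      (v₂₂ := Spec.map iX.appTop ≫ S.isoSpec.inv) ?_ ?_ h2
    · convert H using 1
      · rw [← Scheme.toSpecΓ_naturality_assoc]; simp [← Scheme.isoSpec_hom]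
      · rw [← Scheme.toSpecΓ_naturality_assoc]; simp [← Scheme.isoSpec_hom]
    · rw [Scheme.toSpecΓ_naturality]
  have : IsIso X.toSpecΓ := MorphismProperty.of_isPullback_of_descendsAlong
    (P := MorphismProperty.isomorphisms Scheme) (Q := @Surjective ⊓ @Flat ⊓ @QuasiCompact) h3.flip
    ⟨⟨MorphismProperty.of_isPullback (P := @Surjective) h2.flip ‹_›,
      MorphismProperty.of_isPullback (P := @Flat) h2.flip ‹_›⟩, inferInstance⟩
    (inferInstanceAs (IsIso Y.toSpecΓ))
  exact ⟨this⟩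

instance : (@Surjective ⊓ @Flat ⊓ @LocallyOfFinitePresentation :
    MorphismProperty Scheme.{u}).IsStableUnderBaseChange where
  of_isPullback h hg :=
    ⟨⟨MorphismProperty.of_isPullback (P := @Surjective) h hg.1.1,
      MorphismProperty.of_isPullback (P := @Flat) h hg.1.2⟩,
      MorphismProperty.of_isPullback (P := @LocallyOfFinitePresentation) h hg.2⟩

instance : IsZariskiLocalAtSource (@Flat : MorphismProperty Scheme.{u}) :=
  @HasRingHomProperty.instIsZariskiLocalAtSource (@Flat)
    (fun {R S} [CommRing R] [CommRing S] => @RingHom.Flat R S _ _)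
    Flat.instHasRingHomPropertyFlat

instance : MorphismProperty.ContainsIdentities (@Flat : MorphismProperty Scheme.{u}) :=
  ⟨fun X => inferInstanceAs (Flat (𝟙 X))⟩

instance : IsZariskiLocalAtSource (@Etale : MorphismProperty Scheme.{u}) :=
  @HasRingHomProperty.instIsZariskiLocalAtSource (@Etale)
    (fun {R S} [CommRing R] [CommRing S] => @RingHom.Etale R S _ _)
    Etale.instHasRingHomPropertyEtale

instance : MorphismProperty.ContainsIdentities (@Etale : MorphismProperty Scheme.{u}) :=
  ⟨fun X => inferInstanceAs (Etale (𝟙 X))⟩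

/-- If `f : U ⟶ Y` is flat, surjective and locally of finite presentation, and `Y` is affine, then
there is an étale morphism from an affine scheme to `U` whose composite with `f` is surjective. -/
theorem exists_affine_etale_surjective {U Y : Scheme.{u}} (f : U ⟶ Y) [IsAffine Y] [Flat f]
    [Surjective f] [LocallyOfFinitePresentation f] :
    ∃ (V : Scheme.{u}) (g : V ⟶ U), IsAffine V ∧ Etale g ∧ Surjective (g ≫ f) := by
  -- `f` is open and `Y` is compact, so a compact open `V` of `U` already maps onto `Y`, and `V` has
  -- an affine étale cover.
  obtain ⟨V, hV, e⟩ := f.isOpenMap.exists_opens_image_eq_of_prespectralSpace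
    f.continuous (U := Set.univ) (by simp [Set.range_eq_univ.mpr f.surjective]) isOpen_univ
    isCompact_univ
  have : CompactSpace V := isCompact_iff_compactSpace.mp hV
  obtain ⟨W, p, hp₁, hp₂, hW⟩ :=
    (V : Scheme.{u}).exists_hom_isAffine_of_isZariskiLocalAtSource @Etale
  refine ⟨W, p ≫ Scheme.Opens.ι V, hW, inferInstance, ⟨fun y => ?_⟩⟩
  obtain ⟨v, hv, rfl⟩ := e.ge (Set.mem_univ y)
  obtain ⟨w, hw⟩ := p.surjective ⟨v, hv⟩
  exact ⟨w, by simp [hw]⟩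

instance : IsZariskiLocalAtTarget (@IsAffineHom : MorphismProperty Scheme.{u}) :=
  @HasAffineProperty.instIsZariskiLocalAtTarget _ _ instHasAffinePropertyIsAffineHomIsAffine

/-- The property of being affine descends along flat surjective morphisms locally of finite
presentation. -/
instance descendsAlong_isAffineHom : MorphismProperty.DescendsAlong @IsAffineHom
    (@Surjective ⊓ @Flat ⊓ @LocallyOfFinitePresentation : MorphismProperty Scheme.{u}) := by
  refine IsZariskiLocalAtTarget.descendsAlong _ _ fun {R X Y} f g hf h => ?_
  have := hf.1.1
  have := hf.1.2
  have := hf.2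
  -- Replacing the cover by an affine one reduces the claim to the faithfully flat affine case,
  -- `isAffine_of_isPullback`.
  obtain ⟨V, v, hV, _, _⟩ := exists_affine_etale_surjective f
  have : Flat (v ≫ f) := inferInstance
  have h1 := (IsPullback.of_hasPullback v (pullback.fst f g)).paste_vert
    (IsPullback.of_hasPullback f g)
  have : IsAffine (pullback v (pullback.fst f g)) :=
    isAffine_of_isAffineHom (pullback.fst v (pullback.fst f g))
  have : IsAffine Y := isAffine_of_isPullback h1.flip
  infer_instance

theorem isPullback_tensor_left {S : Scheme.{u}} (A B : Over S) :
    IsPullback (fst A B).left (snd A B).left A.hom B.hom :=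
  IsPullback.of_hasPullback A.hom B.hom

instance : MorphismProperty.DescendsAlong (@LocallyOfFinitePresentation : MorphismProperty Scheme.{u})
    (@Surjective ⊓ @Flat ⊓ @LocallyOfFinitePresentation : MorphismProperty Scheme.{u}) :=
  @instDescendsAlongSchemeMinMorphismPropertySurjectiveFlatLocallyOfFinitePresentationOfQuasiCompactOfIsZariskiLocalAtTarget
    (@LocallyOfFinitePresentation)
    instDescendsAlongSchemeLocallyOfFinitePresentationMinMorphismPropertySurjectiveFlatQuasiCompact
    (@HasRingHomProperty.instIsZariskiLocalAtTarget (@LocallyOfFinitePresentation)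
      (fun {R S} [CommRing R] [CommRing S] => @RingHom.FinitePresentation R S _ _)
      instHasRingHomPropertyLocallyOfFinitePresentationFinitePresentation)

end AlgebraicGeometry

namespace ActedOver

variable {k : Type u} [Field k] {G : Over (Spec (.of k))} [GrpObj G] {Y : Over (Spec (.of k))}

/-- Over a trivializing étale covering the projection becomes `U × G ⟶ U`, a base change of the
affine morphism from `G` to `Spec k`. -/
theorem IsTorsor.isAffineHom {P : ActedOver G Y} (h : P.IsTorsor) [IsAffineHom G.hom] :
    IsAffineHom P.proj.left := by
  obtain ⟨U, f, s, _, _, hs⟩ := h.exists_isTriv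
  have : IsAffineHom (fst U G).left := MorphismProperty.of_isPullback (P := @IsAffineHom)
    (isPullback_tensor_left U G).flip ‹_›
  exact MorphismProperty.of_isPullback_of_descendsAlong (P := @IsAffineHom)
    (CategoryTheory.IsPullback.left (IsPullback.flip hs)) (fppfOver_of_etale f) this

/-- Same descent argument as for affineness; finite type suffices for `G` because `k` is noetherian.
-/
theorem IsTorsor.locallyOfFinitePresentation {P : ActedOver G Y} (h : P.IsTorsor)
    [LocallyOfFiniteType G.hom] : LocallyOfFinitePresentation P.proj.left := by
  obtain ⟨U, f, s, _, _, hs⟩ := h.exists_isTriv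
  have : IsNoetherianRing (CommRingCat.of k) := inferInstanceAs (IsNoetherianRing k)
  have : IsLocallyNoetherian (Spec (.of k)) := inferInstance
  have : LocallyOfFinitePresentation G.hom :=
    LocallyOfFinitePresentation.iff_locallyOfFiniteType.mpr inferInstance
  have : LocallyOfFinitePresentation (fst U G).left :=
    MorphismProperty.of_isPullback (P := @LocallyOfFinitePresentation)
    (isPullback_tensor_left U G).flip ‹_›
  exact MorphismProperty.of_isPullback_of_descendsAlong (P := @LocallyOfFinitePresentation)
    (CategoryTheory.IsPullback.left (IsPullback.flip hs)) (fppfOver_of_etale f) this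

end ActedOver

/-! ### Families of endomorphisms which eventually fix each function -/

/-- A family of endomorphisms of a ring which eventually fixes each element lifts to a finitely
presented algebra. -/
theorem exists_eventually_lift {I R B : Type*} [CommRing R] [CommRing B] [Algebra R B]
    [Algebra.FinitePresentation R B] {l : Filter I} (τ : I → R →+* R)
    (hτ : ∀ r, ∀ᶠ i in l, τ i r = r) :
    ∃ ψ : I → B →+* B, (∀ᶠ i in l, (ψ i).comp (algebraMap R B) = (algebraMap R B).comp (τ i)) ∧
      ∀ b, ∀ᶠ i in l, ψ i b = b := by
  classical
  obtain ⟨n, f, hf, s, hs⟩ := ‹Algebra.FinitePresentation R B›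
  -- `E i` applies `τ i` to the coefficients and sends the variables to the generators of `B`. It
  -- agrees with `f` on any given polynomial for `i` large, since only finitely many coefficients
  -- occur; it thus eventually kills the finitely many relations.
  let E (i : I) : MvPolynomial (Fin n) R →+* B :=
    MvPolynomial.eval₂Hom ((algebraMap R B).comp (τ i)) fun j => f (.X j)
  have hE (m) : ∀ᶠ i in l, E i m = f m := by
    induction m using MvPolynomial.induction_on with
    | C r => filter_upwards [hτ r] with i hi; simp [E, hi, ← MvPolynomial.algebraMap_eq]
    | add p q hp hq => filter_upwards [hp, hq] with i h₁ h₂; rw [map_add, map_add, h₁, h₂]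
    | mul_X p j hp =>
      filter_upwards [hp] with i h₁; rw [map_mul, map_mul, h₁]; simp [E]
  have hker : ∀ᶠ i in l, RingHom.ker f.toRingHom ≤ RingHom.ker (E i) := by
    have : ∀ᶠ i in l, ∀ m ∈ s, E i m = f m := (Filter.eventually_all_finset s).mpr fun m _ => hE m
    filter_upwards [this] with i hi
    change RingHom.ker f ≤ _
    refine hs.symm.trans_le (Ideal.span_le.mpr fun m hm => ?_)
    have hm' : m ∈ RingHom.ker f := hs ▸ Ideal.subset_span hm
    exact (hi m hm).trans hm'
  -- The identity is only a default for those `i` at which `E i` does not respect the relations.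
  let ψ (i : I) : B →+* B := if h : RingHom.ker f.toRingHom ≤ RingHom.ker (E i) then
    RingHom.liftOfSurjective f.toRingHom hf ⟨E i, h⟩ else RingHom.id B
  have hψ : ∀ᶠ i in l, ∀ m, ψ i (f m) = E i m := by
    filter_upwards [hker] with i hi m
    simp only [ψ, dif_pos hi]
    exact RingHom.liftOfRightInverse_comp_apply f.toRingHom _ _ ⟨E i, hi⟩ m
  refine ⟨ψ, ?_, fun b => ?_⟩
  · filter_upwards [hψ] with i hi
    ext r
    have := hi (.C r)
    simpa [E, ← MvPolynomial.algebraMap_eq] using this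
  · obtain ⟨m, rfl⟩ := hf b
    filter_upwards [hψ, hE m] with i h₁ h₂
    rw [h₁, h₂]

namespace AlgebraicGeometry

theorem exists_appTop_eq {D M : Scheme.{u}} [IsAffine M] (φ : Γ(M, ⊤) ⟶ Γ(D, ⊤)) :
    ∃ f : D ⟶ M, f.appTop = φ := by
  refine ⟨D.toSpecΓ ≫ Spec.map φ ≫ M.isoSpec.inv, ?_⟩
  have h : M.isoSpec.inv.appTop ≫ (Scheme.ΓSpecIso Γ(M, ⊤)).hom = 𝟙 _ := by
    rw [← Scheme.toSpecΓ_appTop, ← Scheme.isoSpec_hom, ← Scheme.Hom.comp_appTop,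
      Iso.hom_inv_id, Scheme.Hom.id_appTop]
  rw [Scheme.Hom.comp_appTop, Scheme.Hom.comp_appTop,
    Scheme.toSpecΓ_appTop, Category.assoc, Scheme.ΓSpecIso_naturality, reassoc_of% h]

variable {I : Type*} {l : Filter I}

/-- Each global function is fixed by the members of the family `ψ` from some point on. -/
def EventuallyFixes {M : Scheme.{u}} (l : Filter I) (ψ : I → (M ⟶ M)) : Prop :=
  ∀ b : Γ(M, ⊤), ∀ᶠ i in l, (ψ i).appTop b = b

/-- The eventually fixed functions form a subring `F` containing the pullbacks of the functions on
`A` and `B`. The functions on the fibre product are a pushout of these rings, so the identity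
factors through the inclusion of `F`. -/
theorem EventuallyFixes.of_isPullback {A B C D : Scheme.{u}} {f : D ⟶ A} {g : D ⟶ B} {h : A ⟶ C}
    {j : B ⟶ C} (H : IsPullback f g h j) [IsAffine A] [IsAffine B] [IsAffine C]
    {ψA : I → (A ⟶ A)} {ψB : I → (B ⟶ B)} {ψD : I → (D ⟶ D)} (hA : EventuallyFixes l ψA)
    (hB : EventuallyFixes l ψB) (h₁ : ∀ᶠ i in l, ψD i ≫ f = f ≫ ψA i)
    (h₂ : ∀ᶠ i in l, ψD i ≫ g = g ≫ ψB i) : EventuallyFixes l ψD := by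
  let F : Subring Γ(D, ⊤) :=
    { carrier := {d | ∀ᶠ i in l, (ψD i).appTop d = d}
      mul_mem' := fun h h' => by
        filter_upwards [h, h'] with i hi hi'; rw [map_mul, hi, hi']
      one_mem' := .of_forall fun i => map_one _
      add_mem' := fun h h' => by
        filter_upwards [h, h'] with i hi hi'; rw [map_add, hi, hi']
      zero_mem' := .of_forall fun i => map_zero _
      neg_mem' := fun h => by filter_upwards [h] with i hi; rw [map_neg, hi] }
  have key {Z : Scheme.{u}} (f : D ⟶ Z) (ψ : I → (Z ⟶ Z)) (hψ : EventuallyFixes l ψ)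
      (h : ∀ᶠ i in l, ψD i ≫ f = f ≫ ψ i) (z : Γ(Z, ⊤)) : f.appTop z ∈ F := by
    change ∀ᶠ i in l, _
    filter_upwards [h, hψ z] with i hi hz
    have := congr(($hi).appTop z)
    simp only [Scheme.Hom.comp_appTop, CommRingCat.comp_apply] at this
    rw [this, hz]
  have hp := isPushout_appTop_of_isAffine H.flip
  let u : Γ(D, ⊤) ⟶ .of F := hp.desc
    (CommRingCat.ofHom (g.appTop.hom.codRestrict F (key g ψB hB h₂)))
    (CommRingCat.ofHom (f.appTop.hom.codRestrict F (key f ψA hA h₁))) (by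
      ext c
      exact congr($(hp.w) c))
  have hu : u ≫ CommRingCat.ofHom F.subtype = 𝟙 _ := by
    apply hp.hom_ext
    · rw [hp.inl_desc_assoc, Category.comp_id]; rfl
    · rw [hp.inr_desc_assoc, Category.comp_id]; rfl
  intro d
  have : F.subtype (u d) = d := congr($hu d)
  rw [← this]
  exact (u d).2

/-- Two morphisms into `M` over `Y` coincide once they agree on a finite set of algebra generators.
Finitely many eventual equalities hold simultaneously, so pointwise eventual agreement becomes
eventual equality of morphisms. -/
theorem eventually_eq_of_locallyOfFiniteType {D M Y : Scheme.{u}} (q : M ⟶ Y) [IsAffine M]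
    [IsAffine Y] [LocallyOfFiniteType q] (f g : I → (D ⟶ M))
    (h : ∀ᶠ i in l, f i ≫ q = g i ≫ q)
    (h' : ∀ b, ∀ᶠ i in l, (f i).appTop b = (g i).appTop b) : ∀ᶠ i in l, f i = g i := by
  have hq : q.appTop.hom.FiniteType := by
    have := q.finiteType_appLE (isAffineOpen_top Y) (isAffineOpen_top M) (by simp)
    exact Scheme.Hom.appLE_top_eq_appTop q le_top ▸ this
  algebraize [q.appTop.hom]
  obtain ⟨s, hs⟩ := Algebra.FiniteType.out (R := Γ(Y, ⊤)) (A := Γ(M, ⊤))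
  filter_upwards [h, (Filter.eventually_all_finset s).mpr fun m _ => h' m] with i hi his
  apply ext_of_isAffine
  let _ : Algebra Γ(Y, ⊤) Γ(D, ⊤) := (f i ≫ q).appTop.hom.toAlgebra
  let F : Γ(M, ⊤) →ₐ[Γ(Y, ⊤)] Γ(D, ⊤) :=
    { (f i).appTop.hom with commutes' := fun r => rfl }
  let F' : Γ(M, ⊤) →ₐ[Γ(Y, ⊤)] Γ(D, ⊤) :=
    { (g i).appTop.hom with commutes' := fun r => congr(($hi).appTop r).symm }
  have : F = F' := AlgHom.ext_of_adjoin_eq_top hs his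
  ext b
  exact congr($this b)

theorem exists_eventuallyFixes {M Y : Scheme.{u}} (q : M ⟶ Y) [IsAffine M] [IsAffine Y]
    [LocallyOfFinitePresentation q] (τ : I → (Y ⟶ Y)) (hτ : EventuallyFixes l τ) :
    ∃ ψ : I → (M ⟶ M), (∀ᶠ i in l, ψ i ≫ q = q ≫ τ i) ∧ EventuallyFixes l ψ := by
  have hq : q.appTop.hom.FinitePresentation := by
    have := q.finitePresentation_appLE (isAffineOpen_top Y) (isAffineOpen_top M) (by simp)
    exact Scheme.Hom.appLE_top_eq_appTop q le_top ▸ this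
  algebraize [q.appTop.hom]
  obtain ⟨ψ, h₁, h₂⟩ := exists_eventually_lift (B := Γ(M, ⊤)) (fun i => (τ i).appTop.hom) hτ
  choose φ hφ using fun i => exists_appTop_eq (CommRingCat.ofHom (ψ i))
  refine ⟨φ, ?_, ?_⟩
  · filter_upwards [h₁] with i hi
    apply ext_of_isAffine
    ext b
    have := congr($hi b)
    rw [Scheme.Hom.comp_appTop, Scheme.Hom.comp_appTop, hφ]
    exact this
  · intro b
    filter_upwards [h₂ b] with i hi
    rw [hφ]
    exact hi

theorem appTop_injective {X Y : Scheme.{u}} (f : X ⟶ Y) [Flat f] [Surjective f] [IsAffine X]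
    [IsAffine Y] : Function.Injective f.appTop :=
  ((Flat.flat_and_surjective_iff_faithfullyFlat_of_isAffine f).mp ⟨‹_›, ‹_›⟩).injective

end AlgebraicGeometry

/-! ### Flat descent of morphisms and eventual equality, over a base -/

section Over

variable {S : Scheme.{u}}

theorem epi_of_flat_left {A B : Over S} (e : A ⟶ B) [Flat e.left] [Surjective e.left] : Epi e :=
  have : Epi e.left := Flat.epi_of_flat_of_surjective e.left
  Over.epi_of_epi_left e

/-- Descent of morphisms along flat surjective quasi-compact morphisms, where the agreement needs
to be checked only on a cover of the fibre product. -/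
theorem exists_comp_eq_of_flat {A B C D : Over S} (e : A ⟶ B) [Flat e.left] [Surjective e.left]
    [QuasiCompact e.left] (d : D ⟶ pullback e e) [Flat d.left] [Surjective d.left] (f : A ⟶ C)
    (h : d ≫ pullback.fst e e ≫ f = d ≫ pullback.snd e e ≫ f) : ∃ g : B ⟶ C, e ≫ g = f := by
  have := epi_of_flat_left d
  have := epi_of_flat_left e
  rw [cancel_epi] at h
  have hp := (IsPullback.of_hasPullback e e).left
  -- A flat surjective quasi-compact morphism of schemes is an effective epimorphism; agreement on
  -- the fibre product is known because `d` is an epimorphism.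
  have hl : e.left ≫ EffectiveEpi.desc e.left f.left (fun {Z} g₁ g₂ hg => by
      obtain ⟨m, h1, h2⟩ : ∃ m, m ≫ (pullback.fst e e).left = g₁ ∧
        m ≫ (pullback.snd e e).left = g₂ := ⟨hp.lift g₁ g₂ hg, by simp, by simp⟩
      have h3 : (pullback.fst e e).left ≫ f.left = (pullback.snd e e).left ≫ f.left :=
        congr(CommaMorphism.left $h)
      rw [← h1, ← h2, Category.assoc, Category.assoc, h3]) = f.left := EffectiveEpi.fac _ _ _
  generalize EffectiveEpi.desc e.left f.left _ = g at hl
  have : Epi e.left := Flat.epi_of_flat_of_surjective e.left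
  exact ⟨Over.homMk g (by
    rw [← cancel_epi e.left, ← Category.assoc, hl, Over.w, Over.w]), by ext; exact hl⟩

theorem exists_affine_flat_cover (T : Over S) [CompactSpace T.left] :
    ∃ (W : Over S) (w : W ⟶ T), IsAffine W.left ∧ Flat w.left ∧ Surjective w.left := by
  obtain ⟨W, p, h₁, h₂, h₃⟩ := T.left.exists_hom_isAffine_of_isZariskiLocalAtSource @Flat
  exact ⟨Over.mk (p ≫ T.hom), Over.homMk p, h₃, h₂, h₁⟩

/-- Quasi-separatedness of `X` enters the argument here: it makes every morphism from a compact `T`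
to `X` quasi-compact. -/
theorem compactSpace_pullback_left {X T T' : Over S} [IsAffine S] [QuasiSeparated X.hom]
    (t : T ⟶ X) (t' : T' ⟶ X) [CompactSpace T.left] [CompactSpace T'.left] :
    CompactSpace (pullback t t').left := by
  have : QuasiSeparatedSpace X.left := quasiSeparatedSpace_of_quasiSeparated X.hom
  have : QuasiCompact t.left := inferInstance
  have : QuasiCompact (pullback.snd t t').left := MorphismProperty.of_isPullback
    (P := @QuasiCompact) (IsPullback.of_hasPullback t t').left ‹_›
  exact QuasiCompact.compactSpace_of_compactSpace (pullback.snd t t').left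

theorem isAffine_tensor_left [IsAffine S] (A B : Over S) [IsAffine A.left] [IsAffine B.left] :
    IsAffine (A ⊗ B).left :=
  inferInstanceAs (IsAffine (pullback A.hom B.hom))

variable {I : Type*} {l : Filter I}

theorem eventually_eq_over {D M Y : Over S} (q : M ⟶ Y) [IsAffine M.left]
    [IsAffine Y.left] [LocallyOfFiniteType q.left] (f g : I → (D ⟶ M))
    (h : ∀ i, f i ≫ q = g i ≫ q)
    (h' : ∀ b, ∀ᶠ i in l, (f i).left.appTop b = (g i).left.appTop b) : ∀ᶠ i in l, f i = g i := by
  filter_upwards [eventually_eq_of_locallyOfFiniteType q.left (fun i => (f i).left)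
    (fun i => (g i).left) (.of_forall fun i => congr(CommaMorphism.left $(h i))) h'] with i hi
  ext; exact hi

/-- The given lifts `a` serve as default values at those indices where the constructed lift fails to
lie over `τ`. Thus compatibility with `τ` holds for every index, and only the fixing of functions is
eventual. -/
theorem exists_eventuallyFixes_over {M Y : Over S} (q : M ⟶ Y) [IsAffine M.left] [IsAffine Y.left]
    [LocallyOfFinitePresentation q.left] (τ : I → (Y ⟶ Y))
    (hτ : EventuallyFixes l (fun i => (τ i).left)) (a : I → (M ⟶ M))
    (ha : ∀ i, a i ≫ q = q ≫ τ i) :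
    ∃ ψ : I → (M ⟶ M), (∀ i, ψ i ≫ q = q ≫ τ i) ∧ EventuallyFixes l (fun i => (ψ i).left) := by
  obtain ⟨ψ, h₁, h₂⟩ := exists_eventuallyFixes q.left _ hτ
  have H (i : I) : ∃ ψ' : M ⟶ M, ψ' ≫ q = q ≫ τ i ∧
      (ψ i ≫ q.left = q.left ≫ (τ i).left → ψ'.left = ψ i) := by
    by_cases h : ψ i ≫ q.left = q.left ≫ (τ i).left
    · refine ⟨Over.homMk (ψ i) ?_, ?_, fun _ => rfl⟩
      · rw [← Over.w q, reassoc_of% h, Over.w (τ i)]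
      · ext; exact h
    · exact ⟨a i, ha i, fun h' => (h h').elim⟩
  choose ψ' h₃ h₄ using H
  refine ⟨ψ', h₃, fun b => ?_⟩
  filter_upwards [h₁, h₂ b] with i hi hi'
  rw [h₄ i hi, hi']

end Over

/-! ### Continuity of the Galois action on `T × k̄` -/

namespace TorsorDescent

variable {k : Type u} [Field k] {kbar : Type u} [Field kbar] [Algebra k kbar]
variable {G : Over (Spec (.of k))} [GrpObj G] {X : Over (Spec (.of k))}

open scoped Topology

instance : IsAffine (specBar k kbar).left := inferInstanceAs (IsAffine (Spec (.of kbar)))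

theorem eventually_apply_eq [Algebra.IsAlgebraic k kbar] (a : kbar) :
    ∀ᶠ σ : Gal(kbar/k) in 𝓝 1, σ a = a := by
  have := Algebra.IsIntegral.isIntegral (R := k) a
  have : FiniteDimensional k (IntermediateField.adjoin k {a}) :=
    IntermediateField.adjoin.finiteDimensional this
  filter_upwards [(IntermediateField.fixingSubgroup_isOpen
    (IntermediateField.adjoin k {a})).mem_nhds (one_mem _)] with σ hσ
  exact (IntermediateField.mem_fixingSubgroup_iff _ σ).mp hσ a
    (IntermediateField.mem_adjoin_simple_self k a)

theorem eventuallyFixes_specGal [Algebra.IsAlgebraic k kbar] :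
    EventuallyFixes (𝓝 1) fun σ : Gal(kbar/k) => (specGal σ).left := by
  intro b
  obtain ⟨a, rfl⟩ : ∃ a : kbar, (Scheme.ΓSpecIso (.of kbar)).inv a = b :=
    ⟨(Scheme.ΓSpecIso (.of kbar)).hom b,
      congr($((Scheme.ΓSpecIso (.of kbar)).hom_inv_id) b)⟩
  filter_upwards [eventually_apply_eq (k := k) a] with σ hσ
  have := congr($(Scheme.ΓSpecIso_inv_naturality
    (CommRingCat.ofHom (σ : kbar ≃+* kbar).toRingHom)) a)
  refine this.symm.trans ?_
  exact congr((Scheme.ΓSpecIso (.of kbar)).inv $hσ)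

/-- Functions on `T × k̄` are generated by those on `T`, which are fixed, and by scalars of `k̄`,
each of which has an open stabilizer. -/
theorem eventuallyFixes_whiskerLeft [Algebra.IsAlgebraic k kbar] (T : Over (Spec (.of k)))
    [IsAffine T.left] :
    EventuallyFixes (𝓝 1) fun σ : Gal(kbar/k) => (T ◁ specGal σ).left := by
  refine .of_isPullback (isPullback_tensor_left T (specBar k kbar)) (ψA := fun _ => 𝟙 _)
    (fun b => .of_forall fun _ => by simp) eventuallyFixes_specGal (.of_forall fun σ => ?_)
    (.of_forall fun σ => ?_)
  · exact congr(CommaMorphism.left $(whiskerLeft_fst T (specGal σ))).trans (Category.comp_id _).symm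
  · exact congr(CommaMorphism.left $(whiskerLeft_snd T (specGal σ)))

end TorsorDescent

/-! ### Restriction of objects over `X × B` along morphisms to `X` -/

namespace BaseRestriction

variable {C : Type w} [Category.{v} C] [CartesianMonoidalCategory C] [HasPullbacks C]
variable {X B M : C} (proj : M ⟶ X ⊗ B)

/-- The restriction of `M`, an object over `X × B`, along `t : T ⟶ X`. -/
abbrev restr {T : C} (t : T ⟶ X) : C := pullback (proj ≫ fst X B) t

/-- The projection to `T × B` of the restriction along `t : T ⟶ X` of an object over `X × B`. -/
def toProd {T : C} (t : T ⟶ X) : restr proj t ⟶ T ⊗ B :=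
  lift (pullback.snd _ _) (pullback.fst _ _ ≫ proj ≫ snd X B)

/-- The morphism between restrictions given by a morphism over `X`. -/
def restrMap {T T' : C} {t : T ⟶ X} {t' : T' ⟶ X} (r : T' ⟶ T) (h : r ≫ t = t') :
    restr proj t' ⟶ restr proj t :=
  pullback.lift (pullback.fst _ _) (pullback.snd _ _ ≫ r)
    (by rw [Category.assoc, h, pullback.condition])

variable {T T' : C} {t : T ⟶ X} {t' : T' ⟶ X} (r : T' ⟶ T) (h : r ≫ t = t')

@[simp]
theorem toProd_fst : toProd proj t ≫ fst T B = pullback.snd _ _ := lift_fst _ _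

@[simp]
theorem toProd_fst_assoc {Z : C} (u : T ⟶ Z) :
    toProd proj t ≫ fst T B ≫ u =
      pullback.snd (proj ≫ fst X B) t ≫ u := by
  rw [reassoc_of% toProd_fst]

@[simp]
theorem toProd_snd : toProd proj t ≫ snd T B = pullback.fst _ _ ≫ proj ≫ snd X B := lift_snd _ _

@[simp]
theorem toProd_snd_assoc {Z : C} (u : B ⟶ Z) :
    toProd proj t ≫ snd T B ≫ u =
      pullback.fst (proj ≫ fst X B) t ≫ proj ≫ snd X B ≫ u := by
  rw [reassoc_of% toProd_snd]

@[simp]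
theorem restrMap_fst : restrMap proj r h ≫ pullback.fst _ _ = pullback.fst _ _ :=
  pullback.lift_fst _ _ _

@[simp]
theorem restrMap_fst_assoc {Z : C} (u : M ⟶ Z) :
    restrMap proj r h ≫ pullback.fst _ _ ≫ u =
      pullback.fst _ _ ≫ u := by
  rw [reassoc_of% restrMap_fst]

@[simp]
theorem restrMap_snd : restrMap proj r h ≫ pullback.snd _ _ = pullback.snd _ _ ≫ r :=
  pullback.lift_snd _ _ _

@[simp]
theorem restrMap_snd_assoc {Z : C} (u : T ⟶ Z) :
    restrMap proj r h ≫ pullback.snd _ _ ≫ u =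
      pullback.snd _ _ ≫ r ≫ u := by
  rw [reassoc_of% restrMap_snd]

theorem toProd_whiskerRight :
    toProd proj t ≫ t ▷ B = pullback.fst (proj ≫ fst X B) t ≫ proj := by
  ext1 <;> simp [pullback.condition]

/-- Restricting along `t` is the same as base change along `T × B ⟶ X × B`, so `toProd` inherits
affineness and finite presentation from `proj`. -/
theorem isPullback_toProd :
    IsPullback (pullback.fst (proj ≫ fst X B) t) (toProd proj t) proj (t ▷ B) := by
  have h (s : PullbackCone proj (t ▷ B)) :
      s.fst ≫ proj ≫ fst X B = (s.snd ≫ fst T B) ≫ t := by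
    rw [reassoc_of% s.condition, whiskerRight_fst, Category.assoc]
  refine ⟨⟨(toProd_whiskerRight proj).symm⟩, ⟨PullbackCone.IsLimit.mk _
    (fun s => pullback.lift s.fst (s.snd ≫ fst T B) (h s)) (fun s => pullback.lift_fst _ _ _)
    (fun s => ?_) (fun s m h₁ h₂ => ?_)⟩⟩
  · ext1
    · rw [Category.assoc, toProd_fst, pullback.lift_snd]
    · rw [Category.assoc, toProd_snd, pullback.lift_fst_assoc, reassoc_of% s.condition,
        whiskerRight_snd]
  · apply pullback.hom_ext
    · rw [h₁, pullback.lift_fst]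
    · rw [pullback.lift_snd, ← h₂, Category.assoc, toProd_fst]

theorem isPullback_restrMap :
    IsPullback (restrMap proj r h) (pullback.snd _ _) (pullback.snd (proj ≫ fst X B) t) r := by
  refine IsPullback.of_right (h₁₂ := pullback.fst _ _) (v₁₃ := proj ≫ fst X B) (h₂₂ := t) ?_
    (restrMap_snd _ _ _) (IsPullback.of_hasPullback _ _)
  rw [restrMap_fst, h]
  exact IsPullback.of_hasPullback _ _

theorem restrMap_toProd : restrMap proj r h ≫ toProd proj t = toProd proj t' ≫ r ▷ B := by
  ext1 <;> simp

theorem isPullback_restrMap_toProd :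
    IsPullback (restrMap proj r h) (toProd proj t') (toProd proj t) (r ▷ B) := by
  refine IsPullback.of_right (h₁₂ := pullback.fst _ _) (v₁₃ := proj) (h₂₂ := t ▷ B) ?_
    (restrMap_toProd _ _ _) (isPullback_toProd _)
  rw [restrMap_fst, ← comp_whiskerRight, h]
  exact isPullback_toProd _

variable {proj}

/-- The restriction of an endomorphism of `M` over an endomorphism of `B`. -/
def restrEnd (t : T ⟶ X) {s : B ⟶ B} {b : M ⟶ M} (hb : b ≫ proj = proj ≫ X ◁ s) :
    restr proj t ⟶ restr proj t :=
  pullback.lift (pullback.fst _ _ ≫ b) (pullback.snd _ _)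
    (by rw [Category.assoc, reassoc_of% hb, whiskerLeft_fst, pullback.condition])

variable {s : B ⟶ B} {b : M ⟶ M} (hb : b ≫ proj = proj ≫ X ◁ s)

@[simp]
theorem restrEnd_fst : restrEnd t hb ≫ pullback.fst _ _ = pullback.fst _ _ ≫ b :=
  pullback.lift_fst _ _ _

@[simp]
theorem restrEnd_fst_assoc {Z : C} (u : M ⟶ Z) :
    restrEnd t hb ≫ pullback.fst _ _ ≫ u =
      pullback.fst _ _ ≫ b ≫ u := by
  rw [reassoc_of% restrEnd_fst]

@[simp]
theorem restrEnd_snd : restrEnd t hb ≫ pullback.snd _ _ = pullback.snd _ _ :=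
  pullback.lift_snd _ _ _

@[simp]
theorem restrEnd_snd_assoc {Z : C} (u : T ⟶ Z) :
    restrEnd t hb ≫ pullback.snd _ _ ≫ u =
      pullback.snd _ _ ≫ u := by
  rw [reassoc_of% restrEnd_snd]

theorem restrEnd_toProd : restrEnd t hb ≫ toProd proj t = toProd proj t ≫ T ◁ s := by
  ext1
  · simp
  · simp [reassoc_of% hb]

theorem restrEnd_restrMap :
    restrEnd t' hb ≫ restrMap proj r h = restrMap proj r h ≫ restrEnd t hb := by
  ext1 <;> simp

end BaseRestriction

/-! ### Geometric properties of restrictions of objects over `X̄` -/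

namespace TorsorDescent

open BaseRestriction

variable {k : Type u} [Field k] {kbar : Type u} [Field kbar] [Algebra k kbar]
variable {G : Over (Spec (.of k))} [GrpObj G] {X : Over (Spec (.of k))}
variable {M : Over (Spec (.of k))} {proj : M ⟶ bar kbar X}

open scoped Topology

theorem isAffine_restr [IsAffineHom proj.left] {T : Over (Spec (.of k))} [IsAffine T.left]
    (t : T ⟶ X) : IsAffine (restr proj t).left := by
  have := isAffine_tensor_left T (specBar k kbar)
  have : IsAffineHom (toProd proj t).left := MorphismProperty.of_isPullback (P := @IsAffineHom)
    (isPullback_toProd proj).left ‹_›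
  exact isAffine_of_isAffineHom (toProd proj t).left

theorem locallyOfFinitePresentation_toProd [LocallyOfFinitePresentation proj.left]
    {T : Over (Spec (.of k))} (t : T ⟶ X) : LocallyOfFinitePresentation (toProd proj t).left :=
  MorphismProperty.of_isPullback (P := @LocallyOfFinitePresentation)
    (isPullback_toProd proj).left ‹_›

theorem flat_restrMap {T T' : Over (Spec (.of k))} {t : T ⟶ X} {t' : T' ⟶ X} (r : T' ⟶ T)
    (h : r ≫ t = t') [Flat r.left] : Flat (restrMap proj r h).left :=
  MorphismProperty.of_isPullback (P := @Flat) (isPullback_restrMap proj r h).left.flip ‹_›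

theorem surjective_restrMap {T T' : Over (Spec (.of k))} {t : T ⟶ X} {t' : T' ⟶ X} (r : T' ⟶ T)
    (h : r ≫ t = t') [Surjective r.left] : Surjective (restrMap proj r h).left :=
  MorphismProperty.of_isPullback (P := @Surjective) (isPullback_restrMap proj r h).left.flip ‹_›

/-- The property of eventually fixing functions is inherited by restrictions. -/
theorem eventuallyFixes_of_restrMap [Algebra.IsAlgebraic k kbar] [IsAffineHom proj.left]
    {T T' : Over (Spec (.of k))} [IsAffine T.left] [IsAffine T'.left] {t : T ⟶ X} {t' : T' ⟶ X}
    (r : T' ⟶ T) (h : r ≫ t = t') (ψ : Gal(kbar/k) → (restr proj t ⟶ restr proj t))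
    (ψ' : Gal(kbar/k) → (restr proj t' ⟶ restr proj t'))
    (hψ : EventuallyFixes (𝓝 1) fun σ => (ψ σ).left)
    (hψ' : ∀ σ, ψ' σ ≫ toProd proj t' = toProd proj t' ≫ T' ◁ specGal σ)
    (hψψ' : ∀ σ, ψ' σ ≫ restrMap proj r h = restrMap proj r h ≫ ψ σ) :
    EventuallyFixes (𝓝 1) fun σ => (ψ' σ).left := by
  have := isAffine_restr (proj := proj) t
  have := isAffine_tensor_left T (specBar k kbar)
  have := isAffine_tensor_left T' (specBar k kbar)
  exact .of_isPullback (isPullback_restrMap_toProd proj r h).left hψ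
    (eventuallyFixes_whiskerLeft T') (.of_forall fun σ => congr(CommaMorphism.left $(hψψ' σ)))
    (.of_forall fun σ => congr(CommaMorphism.left $(hψ' σ)))

end TorsorDescent

/-! ### Continuity of the semilinear action on the torsor -/

namespace TorsorDescent

open BaseRestriction ActedOver

variable {k : Type u} [Field k] {kbar : Type u} [Field kbar] [Algebra k kbar]
variable {G : Over (Spec (.of k))} [GrpObj G] {X : Over (Spec (.of k))}

open scoped Topology

/-- The action of `G` on a restriction. -/
def restrAct (P : ActedOver G (bar kbar X)) {T : Over (Spec (.of k))} (t : T ⟶ X) :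
    restr P.proj t ⊗ G ⟶ restr P.proj t :=
  pullback.lift (pullback.fst _ _ ▷ G ≫ P.act) (fst _ _ ≫ pullback.snd _ _) (by
    rw [Category.assoc, reassoc_of% P.act_proj, whiskerRight_fst_assoc, pullback.condition,
      Category.assoc])

theorem restrAct_fst (P : ActedOver G (bar kbar X)) {T : Over (Spec (.of k))} (t : T ⟶ X) :
    restrAct P t ≫ pullback.fst _ _ = pullback.fst _ _ ▷ G ≫ P.act := pullback.lift_fst _ _ _

theorem restrAct_toProd (P : ActedOver G (bar kbar X)) {T : Over (Spec (.of k))} (t : T ⟶ X) :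
    restrAct P t ≫ toProd P.proj t = fst _ _ ≫ toProd P.proj t := by
  ext1
  · rw [Category.assoc, toProd_fst, Category.assoc, toProd_fst]
    exact pullback.lift_snd _ _ _
  · rw [Category.assoc, toProd_snd, Category.assoc, toProd_snd, reassoc_of% restrAct_fst,
      reassoc_of% P.act_proj, whiskerRight_fst_assoc]

section

variable [Algebra.IsAlgebraic k kbar] [QuasiSeparated X.hom] {M : Over (Spec (.of k))}
  {proj : M ⟶ bar kbar X} [IsAffineHom proj.left] [LocallyOfFinitePresentation proj.left]
  {T : Over (Spec (.of k))} [IsAffine T.left] {t : T ⟶ X} [Flat t.left] [Surjective t.left]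

/-- The point `p` need not lift to the restriction over `T`, but it does so after a flat cover `W`
of the fibre of `T` at `x`. There the two composites to be compared lie over the same morphism to `T
× k̄` and agree on each function for `σ` near `1`, so finite type makes them equal for `σ` near `1`.
The resulting neighbourhood does not depend on `b`. -/
theorem eventually_comp_of_point {x : 𝟙_ (Over (Spec (.of k))) ⟶ X} {p : specBar k kbar ⟶ M}
    (hp : p ≫ proj = geomPoint kbar x) (ψ : Gal(kbar/k) → (restr proj t ⟶ restr proj t))
    (hψ : ∀ σ, ψ σ ≫ toProd proj t = toProd proj t ≫ T ◁ specGal σ)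
    (hψ' : EventuallyFixes (𝓝 1) fun σ => (ψ σ).left) :
    ∀ᶠ σ in 𝓝 (1 : Gal(kbar/k)), ∀ b : M ⟶ M,
      pullback.fst _ _ ≫ b = ψ σ ≫ pullback.fst _ _ → p ≫ b = specGal σ ≫ p := by
  have := isAffine_restr (proj := proj) t
  have := isAffine_tensor_left T (specBar k kbar)
  have hlp := locallyOfFinitePresentation_toProd (proj := proj) t
  have hlt : LocallyOfFiniteType (toProd proj t).left := inferInstance
  have : CompactSpace (𝟙_ (Over (Spec (.of k)))).left :=
    inferInstanceAs (CompactSpace (Spec (.of k)))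
  have := compactSpace_pullback_left x t
  obtain ⟨W, r, _, _, _⟩ := exists_affine_flat_cover (pullback x t)
  have hr : (r ≫ pullback.snd x t) ≫ t = toUnit W ≫ x := by
    rw [Category.assoc, ← pullback.condition, ← Category.assoc]
    congr 1
    exact toUnit_unique _ _
  -- The lift of `p` to the restriction over `T`, defined on `W × k̄`.
  let pW : W ⊗ specBar k kbar ⟶ restr proj t :=
    pullback.lift (snd _ _ ≫ p) (fst _ _ ≫ r ≫ pullback.snd x t) (by
      rw [Category.assoc, reassoc_of% hp, geomPoint, lift_fst, Category.assoc, hr,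
        ← Category.assoc, ← Category.assoc]
      congr 1
      exact toUnit_unique _ _)
  have hpW : pW ≫ pullback.fst _ _ = snd _ _ ≫ p := pullback.lift_fst _ _ _
  have hpW' : pW ≫ toProd proj t = (r ≫ pullback.snd x t) ▷ _ := by
    ext1
    · rw [Category.assoc, toProd_fst, whiskerRight_fst]
      exact pullback.lift_snd _ _ _
    · rw [Category.assoc, toProd_snd, whiskerRight_snd, reassoc_of% hpW, reassoc_of% hp,
        geomPoint, lift_snd, Category.comp_id]
  have h := eventually_eq_over (l := 𝓝 (1 : Gal(kbar/k))) (toProd proj t) (fun σ => pW ≫ ψ σ)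
    (fun σ => W ◁ specGal σ ≫ pW) (fun σ => by
      rw [Category.assoc, hψ, reassoc_of% hpW', Category.assoc, hpW', whisker_exchange])
    (fun b => by
      filter_upwards [hψ' b, eventuallyFixes_whiskerLeft W (pW.left.appTop b)] with σ h h'
      rw [Over.comp_left, Over.comp_left, Scheme.Hom.comp_appTop, Scheme.Hom.comp_appTop,
        CommRingCat.comp_apply, CommRingCat.comp_apply, h, h'])
  have hu : r ≫ pullback.fst x t = toUnit W := toUnit_unique _ _
  have hWf : Flat (toUnit W).left := by
    rw [← hu]
    have : Flat (pullback.fst x t).left := MorphismProperty.of_isPullback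
      (P := @Flat) (IsPullback.of_hasPullback x t).left.flip ‹_›
    exact inferInstanceAs (Flat (r.left ≫ (pullback.fst x t).left))
  have hWs : Surjective (toUnit W).left := by
    rw [← hu]
    have : Surjective (pullback.fst x t).left := MorphismProperty.of_isPullback
      (P := @Surjective) (IsPullback.of_hasPullback x t).left.flip ‹_›
    exact inferInstanceAs (Surjective (r.left ≫ (pullback.fst x t).left))
  have hW : (toUnit W).left = W.hom := by simp
  rw [hW] at hWf hWs
  have : Flat (snd W (specBar k kbar)).left := MorphismProperty.of_isPullback
    (P := @Flat) (isPullback_tensor_left W (specBar k kbar)) ‹_›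
  have : Surjective (snd W (specBar k kbar)).left := MorphismProperty.of_isPullback
    (P := @Surjective) (isPullback_tensor_left W (specBar k kbar)) ‹_›
  have := epi_of_flat_left (snd W (specBar k kbar))
  filter_upwards [h] with σ hσ b hb
  -- `W × k̄ ⟶ Spec k̄` is flat and surjective, so the equality may be checked on `W × k̄`.
  rw [← cancel_epi (snd W (specBar k kbar)), ← reassoc_of% hpW, hb, reassoc_of% hσ, hpW,
    whiskerLeft_snd_assoc]

/-- The two pullbacks of `ψ σ` to the fibre product of `T` with itself, refined by an affine cover
`W`, are families over the same Galois action which both eventually fix each function. By finite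
type they coincide for `σ` near `1`, and this is the gluing condition for descent along the
restriction over `T`. -/
theorem eventually_exists_desc (ψ : Gal(kbar/k) → (restr proj t ⟶ restr proj t))
    (hψ : ∀ σ, ψ σ ≫ toProd proj t = toProd proj t ≫ T ◁ specGal σ)
    (hψ' : EventuallyFixes (𝓝 1) fun σ => (ψ σ).left) :
    ∀ᶠ σ in 𝓝 (1 : Gal(kbar/k)), ∃ b : M ⟶ M,
      pullback.fst _ _ ≫ b = ψ σ ≫ pullback.fst _ _ := by
  have := compactSpace_pullback_left t t
  obtain ⟨W, r, _, _, _⟩ := exists_affine_flat_cover (pullback t t)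
  obtain ⟨t', ht'⟩ : ∃ t', (r ≫ pullback.fst t t) ≫ t = t' := ⟨_, rfl⟩
  have ht'' : (r ≫ pullback.snd t t) ≫ t = t' := by
    rw [← ht', Category.assoc, Category.assoc, pullback.condition]
  have := isAffine_restr (proj := proj) t
  have := isAffine_restr (proj := proj) t'
  have := isAffine_tensor_left W (specBar k kbar)
  have hlp := locallyOfFinitePresentation_toProd (proj := proj) t'
  have hlt : LocallyOfFiniteType (toProd proj t').left := inferInstance
  have hψs (σ) : ψ σ ≫ pullback.snd _ _ = pullback.snd _ _ := by
    have := congr($(hψ σ) ≫ fst _ _)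
    rwa [Category.assoc, Category.assoc, whiskerLeft_fst, toProd_fst] at this
  -- For a projection `c` to `T`, `ρ` is the base change of `ψ` along `c`; continuity passes to it.
  have key (c : W ⟶ T) (hc : c ≫ t = t') : ∃ ρ : Gal(kbar/k) → (restr proj t' ⟶ restr proj t'),
      (∀ σ, ρ σ ≫ pullback.fst _ _ = restrMap proj c hc ≫ ψ σ ≫ pullback.fst _ _) ∧
      (∀ σ, ρ σ ≫ toProd proj t' = toProd proj t' ≫ W ◁ specGal σ) ∧
      EventuallyFixes (𝓝 1) fun σ => (ρ σ).left := by
    let ρ (σ : Gal(kbar/k)) : restr proj t' ⟶ restr proj t' :=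
      pullback.lift (restrMap proj c hc ≫ ψ σ ≫ pullback.fst _ _) (pullback.snd _ _) (by
        rw [Category.assoc, Category.assoc, pullback.condition, reassoc_of% hψs,
          restrMap_snd_assoc, hc])
    have h₁ (σ) : ρ σ ≫ pullback.fst _ _ = restrMap proj c hc ≫ ψ σ ≫ pullback.fst _ _ :=
      pullback.lift_fst _ _ _
    have h₂ (σ) : ρ σ ≫ pullback.snd _ _ = pullback.snd _ _ := pullback.lift_snd _ _ _
    have h₃ (σ) : ρ σ ≫ toProd proj t' = toProd proj t' ≫ W ◁ specGal σ := by
      ext1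
      · rw [Category.assoc, Category.assoc, toProd_fst, whiskerLeft_fst, toProd_fst, h₂]
      · have := congr(restrMap proj c hc ≫ $(hψ σ) ≫ snd _ _)
        simp only [Category.assoc, toProd_snd, whiskerLeft_snd, toProd_snd_assoc,
          restrMap_fst_assoc] at this
        simp only [Category.assoc, toProd_snd, whiskerLeft_snd, toProd_snd_assoc,
          reassoc_of% h₁, this]
    refine ⟨ρ, h₁, h₃, eventuallyFixes_of_restrMap c hc ψ ρ hψ' h₃ fun σ => ?_⟩
    apply pullback.hom_ext
    · rw [Category.assoc, restrMap_fst, h₁, Category.assoc]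
    · rw [Category.assoc, restrMap_snd, reassoc_of% h₂, Category.assoc, hψs, restrMap_snd]
  obtain ⟨ρ₁, h₁, h₁', h₁''⟩ := key _ ht'
  obtain ⟨ρ₂, h₂, h₂', h₂''⟩ := key _ ht''
  have hρ := eventually_eq_over (toProd proj t') ρ₁ ρ₂ (fun σ => by rw [h₁', h₂'])
    (fun b => by filter_upwards [h₁'' b, h₂'' b] with σ h h'; rw [h, h'])
  have hp := IsPullback.of_hasPullback (proj ≫ fst X _) t
  have hef : Flat (pullback.fst (proj ≫ fst X _) t).left :=
    MorphismProperty.of_isPullback (P := @Flat) hp.left.flip ‹_›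
  have hes : Surjective (pullback.fst (proj ≫ fst X _) t).left :=
    MorphismProperty.of_isPullback (P := @Surjective) hp.left.flip ‹_›
  have : QuasiSeparatedSpace X.left := quasiSeparatedSpace_of_quasiSeparated X.hom
  have : QuasiCompact t.left := inferInstance
  have heq : QuasiCompact (pullback.fst (proj ≫ fst X _) t).left :=
    MorphismProperty.of_isPullback (P := @QuasiCompact) hp.left.flip ‹_›
  generalize he : pullback.fst (proj ≫ fst X _) t = e at *
  have hr₁ : restrMap proj _ ht' ≫ e = restrMap proj _ ht'' ≫ e := by
    rw [← he, restrMap_fst, restrMap_fst]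
  -- `d` is a base change of `r`, hence flat and surjective, so the gluing condition over `pullback
  -- e e` may be checked on the restriction over `W`.
  let d : restr proj t' ⟶ pullback e e := pullback.lift _ _ hr₁
  let m : pullback e e ⟶ pullback t t := pullback.lift (pullback.fst e e ≫ pullback.snd _ _)
    (pullback.snd e e ≫ pullback.snd _ _) (by
      rw [Category.assoc, Category.assoc, ← hp.w, pullback.condition_assoc])
  have hm₁ : m ≫ pullback.fst _ _ = pullback.fst e e ≫ pullback.snd _ _ := pullback.lift_fst _ _ _
  have hm₂ : m ≫ pullback.snd _ _ = pullback.snd e e ≫ pullback.snd _ _ := pullback.lift_snd _ _ _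
  have hd₁ : d ≫ pullback.fst e e = restrMap proj _ ht' := pullback.lift_fst _ _ _
  have hd₂ : d ≫ pullback.snd e e = restrMap proj _ ht'' := pullback.lift_snd _ _ _
  have hmp : IsPullback (pullback.fst e e) m (pullback.snd (proj ≫ fst X _) t)
      (pullback.fst t t) := by
    refine .of_bot (v₂₁ := pullback.snd t t) (v₂₂ := t) (h₃₁ := t) ?_ hm₁.symm
      (IsPullback.of_hasPullback t t)
    have := (IsPullback.of_hasPullback e e).paste_vert hp
    rwa [hp.w, ← hm₂] at this
  have hdp : IsPullback d (pullback.snd (proj ≫ fst X _) t') m r := by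
    refine .of_right (h₁₂ := pullback.fst e e) (h₂₂ := pullback.fst t t) ?_ ?_ hmp
    · rw [hd₁]; exact isPullback_restrMap proj _ ht'
    · apply pullback.hom_ext
      · rw [Category.assoc, Category.assoc, hm₁, reassoc_of% hd₁, restrMap_snd]
      · rw [Category.assoc, Category.assoc, hm₂, reassoc_of% hd₂, restrMap_snd]
  have hdf : Flat d.left := MorphismProperty.of_isPullback (P := @Flat) hdp.left.flip ‹_›
  have hds : Surjective d.left :=
    MorphismProperty.of_isPullback (P := @Surjective) hdp.left.flip ‹_›
  filter_upwards [hρ] with σ hσ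
  refine exists_comp_eq_of_flat e d (ψ σ ≫ e) ?_
  rw [reassoc_of% hd₁, reassoc_of% hd₂, ← h₁, ← h₂, hσ]

end

/-- Over a flat affine cover of `X`, an equivariant semilinear action which is compatible with a
point and unique with these properties is continuous. -/
theorem eventuallyFixes_of_cover [Algebra.IsAlgebraic k kbar] [QuasiSeparated X.hom]
    [IsAffineHom G.hom] {P : ActedOver G (bar kbar X)} [IsAffineHom P.proj.left]
    [LocallyOfFinitePresentation P.proj.left]
    {x : 𝟙_ (Over (Spec (.of k))) ⟶ X} {p : specBar k kbar ⟶ P.obj}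
    (hp : p ≫ P.proj = geomPoint kbar x) {a : Gal(kbar/k) → (P.obj ⟶ P.obj)}
    (ha : ∀ σ, IsSemi P (X ◁ specGal σ) (a σ))
    (hau : ∀ σ b, IsSemi P (X ◁ specGal σ) b → p ≫ b = specGal σ ≫ p → b = a σ)
    {T : Over (Spec (.of k))} [IsAffine T.left] (t : T ⟶ X) [Flat t.left] [Surjective t.left] :
    EventuallyFixes (𝓝 1) fun σ => (restrEnd t (ha σ).proj).left := by
  have := isAffine_restr (proj := P.proj) t
  have := isAffine_tensor_left T (specBar k kbar)
  have hlp := locallyOfFinitePresentation_toProd (proj := P.proj) t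
  have hlt : LocallyOfFiniteType (toProd P.proj t).left := inferInstance
  have : IsAffine G.left := isAffine_of_isAffineHom G.hom
  have := isAffine_tensor_left (restr P.proj t) G
  -- `ψ` is continuous by construction, with no compatibility beyond lying over the Galois action on
  -- `T × k̄`. The rest of the proof shows that it agrees with the restriction of `a` near `1`.
  obtain ⟨ψ, hψ, hψ'⟩ := exists_eventuallyFixes_over (toProd P.proj t) _
    (eventuallyFixes_whiskerLeft (kbar := kbar) T) (fun σ => restrEnd t (ha σ).proj)
    (fun σ => restrEnd_toProd _)
  have hψs (σ) : ψ σ ≫ pullback.snd _ _ = pullback.snd _ _ := by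
    have := congr($(hψ σ) ≫ fst _ _)
    rwa [Category.assoc, Category.assoc, whiskerLeft_fst, toProd_fst] at this
  have hψp (σ) : ψ σ ≫ pullback.fst _ _ ≫ P.proj = pullback.fst _ _ ≫ P.proj ≫ X ◁ specGal σ := by
    rw [← toProd_whiskerRight, reassoc_of% hψ, whisker_exchange, reassoc_of% @toProd_whiskerRight]
  -- compatibility with the action
  have h₁ : ∀ᶠ σ in 𝓝 (1 : Gal(kbar/k)), restrAct P t ≫ ψ σ = ψ σ ▷ G ≫ restrAct P t := by
    refine eventually_eq_over (toProd P.proj t) _ _ (fun σ => ?_) (fun b => ?_)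
    · rw [Category.assoc, hψ, reassoc_of% restrAct_toProd, Category.assoc, restrAct_toProd,
        whiskerRight_fst_assoc, hψ]
    · have hG : EventuallyFixes (𝓝 1) fun σ => (ψ σ ▷ G).left := by
        refine .of_isPullback (isPullback_tensor_left (restr P.proj t) G) (ψB := fun _ => 𝟙 _)
          hψ' (fun b => .of_forall fun _ => by simp) (.of_forall fun σ => ?_)
          (.of_forall fun σ => ?_)
        · exact congr(CommaMorphism.left $(whiskerRight_fst (ψ σ) G))
        · exact congr(CommaMorphism.left $(whiskerRight_snd (ψ σ) G)).trans
            (Category.comp_id _).symm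
      filter_upwards [hψ' b, hG ((restrAct P t).left.appTop b)] with σ h h'
      rw [Over.comp_left, Over.comp_left, Scheme.Hom.comp_appTop, Scheme.Hom.comp_appTop,
        CommRingCat.comp_apply, CommRingCat.comp_apply, h, h']
  -- compatibility with the point
  have h₂ : ∀ᶠ σ in 𝓝 (1 : Gal(kbar/k)), ∀ b : P.obj ⟶ P.obj,
      pullback.fst _ _ ≫ b = ψ σ ≫ pullback.fst _ _ → p ≫ b = specGal σ ≫ p := by
    filter_upwards [eventually_comp_of_point hp ψ hψ hψ'] with σ h b hb
    exact h b hb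
  -- descent to `X`
  have h₃ : ∀ᶠ σ in 𝓝 (1 : Gal(kbar/k)), ∃ b : P.obj ⟶ P.obj,
      pullback.fst _ _ ≫ b = ψ σ ≫ pullback.fst _ _ :=
    eventually_exists_desc ψ hψ hψ'
  have hef : Flat (pullback.fst (P.proj ≫ fst X _) t).left :=
    MorphismProperty.of_isPullback (P := @Flat) (IsPullback.of_hasPullback _ t).left.flip ‹_›
  have hes : Surjective (pullback.fst (P.proj ≫ fst X _) t).left :=
    MorphismProperty.of_isPullback (P := @Surjective) (IsPullback.of_hasPullback _ t).left.flip ‹_›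
  have he : Epi (pullback.fst (P.proj ≫ fst X _) t) := epi_of_flat_left _
  have heG : Epi (pullback.fst (P.proj ≫ fst X _) t ▷ G) := by
    have h := (isPullback_whiskerRight_fst (pullback.fst (P.proj ≫ fst X _) t) G).left
    have : Flat (pullback.fst (P.proj ≫ fst X _) t ▷ G).left :=
      MorphismProperty.of_isPullback (P := @Flat) h.flip ‹_›
    have : Surjective (pullback.fst (P.proj ≫ fst X _) t ▷ G).left :=
      MorphismProperty.of_isPullback (P := @Surjective) h.flip ‹_›
    exact epi_of_flat_left _
  intro c
  filter_upwards [h₁, h₂, h₃, hψ' c] with σ h₁ h₂ ⟨b, hb⟩ h₄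
  -- The descended `b` is semilinear, equivariant and compatible with `p`, so the uniqueness of `a
  -- σ` identifies them. Both properties other than compatibility with `p` are checked after the
  -- flat cover.
  have hb' : b = a σ := by
    refine hau σ b ⟨?_, ?_⟩ (h₂ b hb)
    · rw [← cancel_epi (pullback.fst (P.proj ≫ fst X _) t), reassoc_of% hb, hψp]
    · rw [← cancel_epi (pullback.fst (P.proj ≫ fst X _) t ▷ G), ← Category.assoc,
        ← restrAct_fst, Category.assoc, hb, reassoc_of% h₁, restrAct_fst,
        ← comp_whiskerRight_assoc, ← comp_whiskerRight_assoc, hb]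
  have : restrEnd t (ha σ).proj = ψ σ := by
    apply pullback.hom_ext
    · rw [restrEnd_fst, ← hb', hb]
    · rw [restrEnd_snd, hψs]
  rw [this, h₄]

/-- An equivariant semilinear action which is compatible with a point and unique with these
properties is continuous. -/
theorem eventuallyFixes_restrEnd [Algebra.IsAlgebraic k kbar] [QuasiCompact X.hom]
    [QuasiSeparated X.hom] [IsAffineHom G.hom] {P : ActedOver G (bar kbar X)}
    [IsAffineHom P.proj.left] [LocallyOfFinitePresentation P.proj.left]
    {x : 𝟙_ (Over (Spec (.of k))) ⟶ X} {p : specBar k kbar ⟶ P.obj}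
    (hp : p ≫ P.proj = geomPoint kbar x) {a : Gal(kbar/k) → (P.obj ⟶ P.obj)}
    (ha : ∀ σ, IsSemi P (X ◁ specGal σ) (a σ))
    (hau : ∀ σ b, IsSemi P (X ◁ specGal σ) b → p ≫ b = specGal σ ≫ p → b = a σ)
    {U : Over (Spec (.of k))} [IsAffine U.left] (t : U ⟶ X) :
    EventuallyFixes (𝓝 1) fun σ => (restrEnd t (ha σ).proj).left := by
  have : CompactSpace X.left := QuasiCompact.compactSpace_of_compactSpace X.hom
  -- Continuity is known over a flat affine cover `T` of `X`. It is carried to an affine cover `W`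
  -- of `U ×_X T`, and then back to `U`.
  obtain ⟨T, c, _, _, _⟩ := exists_affine_flat_cover X
  have := compactSpace_pullback_left t c
  obtain ⟨W, r, _, _, _⟩ := exists_affine_flat_cover (pullback t c)
  obtain ⟨t', ht'⟩ : ∃ t', (r ≫ pullback.fst t c) ≫ t = t' := ⟨_, rfl⟩
  have ht'' : (r ≫ pullback.snd t c) ≫ c = t' := by
    rw [← ht', Category.assoc, Category.assoc, pullback.condition]
  have h := eventuallyFixes_of_restrMap _ ht'' _ (fun σ => restrEnd t' (ha σ).proj)
    (eventuallyFixes_of_cover hp ha hau c) (fun σ => restrEnd_toProd _)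
    (fun σ => restrEnd_restrMap _ _ _)
  have := isAffine_restr (proj := P.proj) t
  have := isAffine_restr (proj := P.proj) t'
  have : Flat (pullback.fst t c).left := MorphismProperty.of_isPullback
    (P := @Flat) (IsPullback.of_hasPullback t c).left.flip ‹_›
  have : Surjective (pullback.fst t c).left := MorphismProperty.of_isPullback
    (P := @Surjective) (IsPullback.of_hasPullback t c).left.flip ‹_›
  have : Flat (r ≫ pullback.fst t c).left :=
    inferInstanceAs (Flat (r.left ≫ (pullback.fst t c).left))
  have : Surjective (r ≫ pullback.fst t c).left :=
    inferInstanceAs (Surjective (r.left ≫ (pullback.fst t c).left))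
  have := flat_restrMap (proj := P.proj) _ ht'
  have := surjective_restrMap (proj := P.proj) _ ht'
  intro b
  filter_upwards [h ((restrMap P.proj _ ht').left.appTop b)] with σ hσ
  -- The restriction over `W` is faithfully flat over that over `U`, so a function is fixed as soon
  -- as its pullback is.
  apply appTop_injective (restrMap P.proj _ ht').left
  have h := congr(CommaMorphism.left $(restrEnd_restrMap _ ht' (ha σ).proj))
  have := congr(Scheme.Hom.appTop $h b)
  exact this.symm.trans hσ

end TorsorDescent

/-! ### Galois descent for algebras -/

/-- The subring of elements fixed by a family of endomorphisms. -/
def fixedSubring {I B : Type*} [CommRing B] (ρ : I → B →+* B) : Subring B where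
  carrier := {b | ∀ σ, ρ σ b = b}
  mul_mem' h h' σ := by rw [map_mul, h, h']
  one_mem' σ := map_one _
  add_mem' h h' σ := by rw [map_add, h, h']
  zero_mem' σ := map_zero _
  neg_mem' h σ := by rw [map_neg, h]

section GaloisDescent

open scoped Topology

variable {k kbar : Type*} [Field k] [Field kbar] [Algebra k kbar] [IsGalois k kbar]
variable {B : Type*} [CommRing B] (ρ : Gal(kbar/k) →* (B →+* B))

/-- An open neighbourhood of `1` in the Krull topology contains the fixing subgroup of a finite
normal extension `E`, and elements with the same restriction to `E` differ by that subgroup. -/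
theorem exists_finite_apply_eq (b : B) (hb : ∀ᶠ σ in 𝓝 1, ρ σ b = b) :
    ∃ E : IntermediateField k kbar, FiniteDimensional k E ∧ ∃ _ : Normal k E, ∀ σ τ : Gal(kbar/k),
      AlgEquiv.restrictNormalHom E σ = AlgEquiv.restrictNormalHom E τ → ρ σ b = ρ τ b := by
  obtain ⟨E, h₁, h₂, h₃⟩ := (krullTopology_mem_nhds_one_iff_of_normal k kbar _).mp hb
  refine ⟨E, h₁, h₂, fun σ τ h => ?_⟩
  have : τ⁻¹ * σ ∈ E.fixingSubgroup := by
    rw [← IntermediateField.restrictNormalHom_ker, MonoidHom.mem_ker, map_mul, map_inv, h,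
      inv_mul_cancel]
  have h4 : ρ (τ⁻¹ * σ) b = b := h₃ this
  rw [← mul_inv_cancel_left τ σ, map_mul]
  exact congr(ρ τ $h4)

theorem finite_range_apply (b : B) (hb : ∀ᶠ σ in 𝓝 1, ρ σ b = b) :
    (Set.range fun σ => ρ σ b).Finite := by
  obtain ⟨E, _, _, hE⟩ := exists_finite_apply_eq ρ b hb
  refine (Set.finite_range fun g : Gal(E/k) =>
    ρ (AlgEquiv.restrictNormalHom_surjective (K₁ := E) kbar g).choose b).subset ?_
  rintro _ ⟨σ, rfl⟩
  exact ⟨AlgEquiv.restrictNormalHom E σ,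
    hE _ _ (AlgEquiv.restrictNormalHom_surjective (K₁ := E) kbar _).choose_spec⟩

/-- Invariants commute with localization at an invariant element. -/
theorem isLocalization_fixedSubring {B' : Type*} [CommRing B'] [Algebra B B']
    (ρ' : Gal(kbar/k) →* (B' →+* B'))
    (h : ∀ σ b, ρ' σ (algebraMap B B' b) = algebraMap B B' (ρ σ b))
    (hc : ∀ b, ∀ᶠ σ in 𝓝 1, ρ σ b = b) (r : fixedSubring ρ) [IsLocalization.Away (r : B) B']
    [Algebra (fixedSubring ρ) (fixedSubring ρ')]
    (ha : ∀ b : fixedSubring ρ, (algebraMap (fixedSubring ρ) (fixedSubring ρ') b : B') =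
      algebraMap B B' b) :
    IsLocalization.Away r (fixedSubring ρ') := by
  have hu : IsUnit (algebraMap B B' r) := IsLocalization.Away.algebraMap_isUnit (r : B)
  refine IsLocalization.Away.mk (r : fixedSubring ρ) ?_ ?_ ?_
  · obtain ⟨s, hs⟩ := hu.exists_right_inv
    have hs' : s ∈ fixedSubring ρ' := by
      intro σ
      have := congr(ρ' σ $hs)
      rw [map_mul, h, r.2 σ, map_one, ← hs] at this
      exact hu.mul_left_cancel this
    exact IsUnit.of_mul_eq_one ⟨s, hs'⟩ (Subtype.ext (by
      change (algebraMap (fixedSubring ρ) (fixedSubring ρ') r : B') * s = 1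
      rw [ha, hs]))
  · rintro ⟨x, hx⟩
    obtain ⟨n, b, hb⟩ := IsLocalization.Away.surj (r : B) x
    -- Invariance of `x` makes `b` and each conjugate of `b` equal after multiplication by some
    -- power of `r`. The orbit of `b` is finite, so one power serves for all of them and turns `b`
    -- into an invariant numerator.
    have hfin : ∃ N : ℕ, ∀ y ∈ Set.range (fun σ => ρ σ b), (r : B) ^ N * y = (r : B) ^ N * b := by
      have hσ : ∀ y ∈ Set.range (fun σ => ρ σ b), ∃ N : ℕ, (r : B) ^ N * y = (r : B) ^ N * b := by
        rintro _ ⟨σ, rfl⟩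
        refine IsLocalization.Away.exists_of_eq (S := B') (r : B) ?_
        rw [← h, ← hb, map_mul, map_pow, h, hx σ, r.2 σ]
      choose! N hN using hσ
      obtain ⟨m, hm⟩ := ((finite_range_apply ρ b (hc b)).image N).bddAbove
      refine ⟨m, fun y hy => ?_⟩
      obtain ⟨d, hd⟩ := Nat.exists_eq_add_of_le (hm (Set.mem_image_of_mem N hy))
      rw [hd, pow_add, mul_comm (_ ^ _), _root_.mul_assoc, _root_.mul_assoc, hN y hy]
    obtain ⟨N, hN⟩ := hfin
    have hb' : (r : B) ^ N * b ∈ fixedSubring ρ := by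
      intro σ
      rw [map_mul, map_pow, r.2 σ]
      exact hN _ ⟨σ, rfl⟩
    refine ⟨n + N, ⟨_, hb'⟩, Subtype.ext ?_⟩
    rw [ha]
    change x * (algebraMap (fixedSubring ρ) (fixedSubring ρ') r ^ (n + N) : fixedSubring ρ') = _
    rw [Subring.coe_pow, ha, pow_add, ← _root_.mul_assoc, hb, map_mul, map_pow, mul_comm]
  · intro a b hab
    have := congr(($hab : B'))
    rw [ha, ha] at this
    obtain ⟨n, hn⟩ := IsLocalization.Away.exists_of_eq (r : B) this
    exact ⟨n, Subtype.ext (by simpa using hn)⟩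

variable [Algebra kbar B] (hρ : ∀ σ c, ρ σ (algebraMap kbar B c) = algebraMap kbar B (σ c))

include hρ in
-- If `b` were outside the span, some linear form `φ` would kill all invariants but not `b`. The
-- twisted traces of `b`, weighted by the conjugates of `ℓ` in a finite normal extension, are
-- invariant. Applying `φ` to them gives a relation between the automorphisms `g`, and Dedekind's
-- independence of characters then forces `φ` to vanish on every conjugate of `b`.
theorem span_fixedSubring_eq_top (hc : ∀ b, ∀ᶠ σ in 𝓝 1, ρ σ b = b) :
    Submodule.span kbar (fixedSubring ρ : Set B) = ⊤ := by
  rw [eq_top_iff]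
  intro b _
  by_contra hb
  obtain ⟨φ, hφ, hφ'⟩ := Submodule.exists_le_ker_of_notMem hb
  apply hφ
  obtain ⟨E, _, _, hE⟩ := exists_finite_apply_eq ρ b (hc b)
  have hs := AlgEquiv.restrictNormalHom_surjective (F := k) (K₁ := E) kbar
  choose s hs using hs
  let f (g : Gal(E/k)) : B := ρ (s g) b
  have hf (σ : Gal(kbar/k)) : f (AlgEquiv.restrictNormalHom E σ) = ρ σ b := hE _ _ (hs _)
  have hfm (σ : Gal(kbar/k)) (g) : ρ σ (f g) = f (AlgEquiv.restrictNormalHom E σ * g) := by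
    nth_rw 2 [← hs g]
    rw [← map_mul, hf, map_mul]
    rfl
  -- `σ` permutes the summands by left translation on the finite Galois group.
  have ht (ℓ : E) : ∑ g : Gal(E/k), algebraMap kbar B (g ℓ : E) * f g ∈ fixedSubring ρ := by
    intro σ
    rw [map_sum]
    refine Fintype.sum_equiv (Equiv.mulLeft (AlgEquiv.restrictNormalHom E σ)) _ _ fun g => ?_
    rw [map_mul, hρ, hfm]
    congr 2
    exact (AlgEquiv.restrictNormal_commutes σ E (g ℓ)).symm
  have hind := (linearIndependent_monoidHom E kbar).comp
    (fun g : Gal(E/k) => ((algebraMap E kbar).comp (g : E →+* E)).toMonoidHom) (fun g g' h => by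
      ext ℓ
      exact congr($h ℓ))
  rw [Fintype.linearIndependent_iff] at hind
  have h1 := hind (fun g => φ (f g)) (by
    ext ℓ
    have := hφ' (Submodule.subset_span (ht ℓ))
    rw [LinearMap.mem_ker, map_sum] at this
    rw [Finset.sum_apply]
    refine Eq.trans (Finset.sum_congr rfl fun g _ => ?_) this
    rw [← Algebra.smul_def, map_smul, smul_eq_mul, mul_comm]
    rfl) 1
  have h2 := hf 1
  rw [map_one, map_one] at h2
  rwa [h2] at h1

include hρ in
-- Artin's argument: normalize one coefficient of a relation to `1` and subtract the conjugate
-- relation. The shorter relation is trivial by induction, so all coefficients are Galois-fixed,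
-- hence lie in `k`, where independence is assumed.
theorem linearIndependent_of_fixed [Algebra k B] [IsScalarTower k kbar B] {I : Type*} (v : I → B)
    (hv : ∀ i, v i ∈ fixedSubring ρ) (hi : LinearIndependent k v) : LinearIndependent kbar v := by
  classical
  rw [linearIndependent_iff'] at hi ⊢
  intro s
  induction s using Finset.induction_on with
  | empty => simp
  | insert j s hj ih =>
    intro c hc
    by_cases hcj : c j = 0
    · have := ih c (by rwa [Finset.sum_insert hj, hcj, zero_smul, zero_add] at hc)
      intro i hi
      obtain rfl | hi := Finset.mem_insert.mp hi
      exacts [hcj, this i hi]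
    · exfalso
      let d (i : I) : kbar := (c j)⁻¹ * c i
      have hd : ∑ i ∈ insert j s, d i • v i = 0 := by
        simp_rw [d, mul_smul, ← Finset.smul_sum, hc, smul_zero]
      have hdj : d j = 1 := inv_mul_cancel₀ hcj
      have hfix (σ : Gal(kbar/k)) (i) (hi : i ∈ insert j s) : σ (d i) = d i := by
        have h1 : ∑ i ∈ insert j s, σ (d i) • v i = 0 := by
          have := congr(ρ σ $hd)
          rw [map_sum, map_zero] at this
          rw [← this]
          refine Finset.sum_congr rfl fun i _ => ?_
          rw [Algebra.smul_def, Algebra.smul_def (d i), map_mul (ρ σ), hρ, hv i σ]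
        have h2 : ∑ i ∈ s, (σ (d i) - d i) • v i = 0 := by
          have := h1.trans hd.symm
          rw [Finset.sum_insert hj, Finset.sum_insert hj, hdj, map_one, add_right_inj] at this
          simp_rw [sub_smul, Finset.sum_sub_distrib, this, sub_self]
        obtain rfl | hi := Finset.mem_insert.mp hi
        · rw [hdj, map_one]
        · exact sub_eq_zero.mp (ih _ h2 i hi)
      have hr (i) (hi : i ∈ insert j s) : ∃ e : k, algebraMap k kbar e = d i :=
        (InfiniteGalois.mem_range_algebraMap_iff_fixed (d i)).mpr fun σ => hfix σ i hi
      choose! e he using hr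
      have h3 := hi (insert j s) e (by
        rw [← hd]
        refine Finset.sum_congr rfl fun i hi => ?_
        rw [← he i hi, algebraMap_smul]) j (Finset.mem_insert_self j s)
      have h4 := he j (Finset.mem_insert_self j s)
      rw [h3, map_zero, hdj] at h4
      exact zero_ne_one h4

include hρ in
/-- Galois descent: an algebra with a continuous semilinear action of the Galois group is the base
change of its subring of invariants. -/
theorem isPushout_fixedSubring [Algebra k B] [IsScalarTower k kbar B]
    (hc : ∀ b, ∀ᶠ σ in 𝓝 1, ρ σ b = b)
    [Algebra k (fixedSubring ρ)] [IsScalarTower k (fixedSubring ρ) B] :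
    Algebra.IsPushout k kbar (fixedSubring ρ) B := by
  constructor
  let b := Module.Free.chooseBasis k (fixedSubring ρ)
  let L : fixedSubring ρ →ₗ[k] B := (IsScalarTower.toAlgHom k (fixedSubring ρ) B).toLinearMap
  have hL (x) : L x = x := rfl
  -- A `k`-basis of the invariants is shown to be a `k̄`-basis of `B`, which is the asserted base
  -- change property.
  have hli : LinearIndependent kbar (L ∘ b) := by
    refine linearIndependent_of_fixed ρ hρ _ (fun i => (b i).2) ?_
    exact b.linearIndependent.map' _ (LinearMap.ker_eq_bot.mpr Subtype.val_injective)
  have hsp : ⊤ ≤ Submodule.span kbar (Set.range (L ∘ b)) := by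
    rw [← span_fixedSubring_eq_top ρ hρ hc, Submodule.span_le]
    intro x hx
    have h1 : (⟨x, hx⟩ : fixedSubring ρ) ∈ Submodule.span k (Set.range b) := by
      rw [b.span_eq]; trivial
    have h2 := Submodule.mem_map_of_mem (f := L) h1
    rw [Submodule.map_span, ← Set.range_comp] at h2
    exact Submodule.span_le_restrictScalars k kbar _ h2
  have h := (IsBaseChange.ofEquiv b.repr).comp
    (IsBaseChange.of_basis k (Module.Basis.mk hli hsp))
  convert h using 1
  refine b.ext fun i => ?_
  simp
  rfl

end GaloisDescent

namespace AlgebraicGeometry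

open Scheme.AffineZariskiSite

/-! ### The quotient of a relatively affine scheme by a group of automorphisms -/

/-- An action of the group `Γ` on the scheme `M` over `X`. -/
structure RelAction {X M : Scheme.{u}} (π : M ⟶ X) (Γ : Type*) [Group Γ] where
  map : Γ → (M ⟶ M)
  map_comp : ∀ σ, map σ ≫ π = π
  map_one : map 1 = 𝟙 M
  map_mul : ∀ σ τ, map (σ * τ) = map σ ≫ map τ

namespace RelAction

variable {X M : Scheme.{u}} {π : M ⟶ X} {Γ : Type*} [Group Γ] (a : RelAction π Γ)

theorem preimage_eq (σ : Γ) (U : X.Opens) : a.map σ ⁻¹ᵁ π ⁻¹ᵁ U = π ⁻¹ᵁ U := by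
  rw [← Scheme.Hom.comp_preimage, a.map_comp]

/-- The action on the sections over the preimage of an open set. -/
def onSections (U : X.Opens) : Γ →* (Γ(M, π ⁻¹ᵁ U) →+* Γ(M, π ⁻¹ᵁ U)) where
  toFun σ := ((a.map σ).appLE (π ⁻¹ᵁ U) (π ⁻¹ᵁ U) (a.preimage_eq σ U).ge).hom
  map_one' := by
    have : (a.map 1).appLE (π ⁻¹ᵁ U) (π ⁻¹ᵁ U) (a.preimage_eq 1 U).ge = 𝟙 _ := by
      have h : ∀ f, f = 𝟙 M → ∀ e, f.appLE (π ⁻¹ᵁ U) (π ⁻¹ᵁ U) e = 𝟙 _ := by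
        rintro _ rfl e
        exact (Category.id_comp _).trans (M.presheaf.map_id _)
      exact h _ a.map_one _
    rw [this]
    rfl
  map_mul' σ τ := by
    have : (a.map (σ * τ)).appLE (π ⁻¹ᵁ U) (π ⁻¹ᵁ U) (a.preimage_eq _ U).ge =
        (a.map τ).appLE (π ⁻¹ᵁ U) (π ⁻¹ᵁ U) (a.preimage_eq _ U).ge ≫
        (a.map σ).appLE (π ⁻¹ᵁ U) (π ⁻¹ᵁ U) (a.preimage_eq _ U).ge := by
      simp only [a.map_mul]
      rw [Scheme.Hom.appLE_comp_appLE]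
    rw [this]
    rfl

theorem onSections_res {U V : X.Opens} (h : U ≤ V) (σ : Γ) (b : Γ(M, π ⁻¹ᵁ V)) :
    a.onSections U σ (M.presheaf.map (homOfLE (π.preimage_mono h)).op b) =
      M.presheaf.map (homOfLE (π.preimage_mono h)).op (a.onSections V σ b) := by
  have : M.presheaf.map (homOfLE (π.preimage_mono h)).op ≫
      (a.map σ).appLE (π ⁻¹ᵁ U) (π ⁻¹ᵁ U) (a.preimage_eq σ U).ge =
      (a.map σ).appLE (π ⁻¹ᵁ V) (π ⁻¹ᵁ V) (a.preimage_eq σ V).ge ≫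
      M.presheaf.map (homOfLE (π.preimage_mono h)).op := by
    rw [Scheme.Hom.map_appLE, Scheme.Hom.appLE_map]
  exact congr($this b)

theorem onSections_app {U : X.Opens} (σ : Γ) (b : Γ(X, U)) :
    a.onSections U σ (π.app U b) = π.app U b := by
  have : π.app U ≫ (a.map σ).appLE (π ⁻¹ᵁ U) (π ⁻¹ᵁ U) (a.preimage_eq σ U).ge = π.app U := by
    have h := a.map_comp σ
    rw [Scheme.Hom.app_eq_appLE, Scheme.Hom.appLE_comp_appLE]
    simp only [h]
  exact congr($this b)

/-- The presheaf of invariants. -/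
def invariants : X.Opensᵒᵖ ⥤ CommRingCat.{u} where
  obj U := .of (fixedSubring (a.onSections U.unop))
  map {V U} i := CommRingCat.ofHom
    ((M.presheaf.map (homOfLE (π.preimage_mono i.unop.le)).op).hom.restrict _ _ fun x hx σ => by
      exact (a.onSections_res i.unop.le σ x).trans (congrArg _ (hx σ)))
  map_id U := by
    ext x
    exact congr($(M.presheaf.map_id (op (π ⁻¹ᵁ U.unop))) x.1)
  map_comp {U V W} i j := by
    ext x
    exact congr($(M.presheaf.map_comp (homOfLE (π.preimage_mono i.unop.le)).op
      (homOfLE (π.preimage_mono j.unop.le)).op) x.1)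

/-- The morphism from the structure presheaf to the presheaf of invariants. -/
def toInvariants : X.presheaf ⟶ a.invariants where
  app U := CommRingCat.ofHom ((π.app U.unop).hom.codRestrict
    (fixedSubring (a.onSections U.unop)) fun b σ => a.onSections_app σ b)
  naturality {U V} i := by
    ext x
    exact Subtype.ext congr($(π.naturality i) x)

/-- The inclusion of the invariants. -/
def inclusion (U : X.Opens) : a.invariants.obj (op U) ⟶ Γ(M, π ⁻¹ᵁ U) :=
  CommRingCat.ofHom (fixedSubring (a.onSections U)).subtype

theorem toInvariants_inclusion (U : X.Opens) :
    a.toInvariants.app (op U) ≫ a.inclusion U = π.app U := rfl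

theorem map_inclusion {U V : X.Opens} (h : U ≤ V) :
    a.invariants.map (homOfLE h).op ≫ a.inclusion U =
      a.inclusion V ≫ M.presheaf.map (homOfLE (π.preimage_mono h)).op := rfl

end RelAction

open scoped Topology

variable {k kbar : Type*} [Field k] [Field kbar] [Algebra k kbar] [IsGalois k kbar]
variable {X M : Scheme.{u}} {π : M ⟶ X} (a : RelAction π Gal(kbar/k))

/-- The action on sections over affine open subsets is continuous. -/
def RelAction.IsContinuous : Prop :=
  ∀ (U : X.Opens), IsAffineOpen U → ∀ b, ∀ᶠ σ in 𝓝 1, a.onSections U σ b = b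

variable {a}

/-- This is the gluing condition: passing to a basic open set localizes the ring of invariants.
Continuity is needed because the invariants commute with localization only when orbits are finite.
-/
theorem RelAction.IsContinuous.coequifibered [QuasiCompact π] [QuasiSeparated π]
    (ha : a.IsContinuous) :
    (Functor.whiskerLeft (toOpensFunctor X).op a.toInvariants).Coequifibered := by
  refine coequifibered_iff_forall_isLocalizationAway.mpr fun U r => ?_
  have hle := X.basicOpen_le r
  let _ : Algebra Γ(M, π ⁻¹ᵁ U.1) Γ(M, π ⁻¹ᵁ X.basicOpen r) :=
    (M.presheaf.map (homOfLE (π.preimage_mono hle)).op).hom.toAlgebra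
  let _ : Algebra (fixedSubring (a.onSections U.1)) (fixedSubring (a.onSections (X.basicOpen r))) :=
    (a.invariants.map (homOfLE hle).op).hom.toAlgebra
  -- Stated for any `V` equal to the basic open set, since the preimage of a basic open set is equal
  -- to one only propositionally.
  have key (V : M.Opens) (h : V = M.basicOpen (π.app U.1 r)) (hV : V ≤ π ⁻¹ᵁ U.1) :
      @IsLocalization.Away _ _ (π.app U.1 r) Γ(M, V) _
        (M.presheaf.map (homOfLE hV).op).hom.toAlgebra := by
    subst h
    exact isLocalization_basicOpen_of_qcqs (π.isCompact_preimage U.2.isCompact)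
      (π.isQuasiSeparated_preimage U.2.isQuasiSeparated) (π.app _ r)
  let r' : fixedSubring (a.onSections U.1) := a.toInvariants.app (op U.1) r
  have : IsLocalization.Away (r' : Γ(M, π ⁻¹ᵁ U.1)) Γ(M, π ⁻¹ᵁ X.basicOpen r) :=
    key _ (π.preimage_basicOpen r) _
  exact isLocalization_fixedSubring (a.onSections U.1) (B' := Γ(M, π ⁻¹ᵁ X.basicOpen r))
    (a.onSections (X.basicOpen r)) (fun σ b => a.onSections_res hle σ b) (ha U.1 U.2)
    r' (fun b => rfl)

/-- Morphisms out of a scheme over `X` can be glued from the preimages of the affine open subsets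
of `X`. -/
theorem exists_glue_of_affineOpens {X M Q : Scheme.{u}} (π : M ⟶ X)
    (g : ∀ U : X.AffineZariskiSite, (π ⁻¹ᵁ U.1).toScheme ⟶ Q)
    (h : ∀ U V (e : U ≤ V), M.homOfLE (π.preimage_mono (toOpens_mono e)) ≫ g V = g U) :
    ∃ r : M ⟶ Q, ∀ U : X.AffineZariskiSite, (π ⁻¹ᵁ U.1).ι ≫ r = g U := by
  have key (U V : X.AffineZariskiSite) (e : U ≤ V) :
      pullback.map π U.1.ι π V.1.ι (𝟙 M) (X.homOfLE (toOpens_mono e)) (𝟙 X) (by simp) (by simp) ≫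
        (pullbackRestrictIsoRestrict π V.1).hom ≫ g V =
      (pullbackRestrictIsoRestrict π U.1).hom ≫ g U := by
    rw [← h U V e, ← Category.assoc, ← Category.assoc]
    congr 1
    rw [← cancel_mono (Scheme.Opens.ι _), Category.assoc, pullbackRestrictIsoRestrict_hom_ι,
      Category.assoc]
    refine (pullback.lift_fst _ _ _).trans ?_
    rw [Scheme.homOfLE_ι, pullbackRestrictIsoRestrict_hom_ι, Category.comp_id]
  refine ⟨Scheme.OpenCover.glueMorphismsOfLocallyDirected ((directedCover X).pullback₁ π)
    (fun U => (pullbackRestrictIsoRestrict π _).hom ≫ g U)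
    (fun {U V} i => key U V (leOfHom (X := X.AffineZariskiSite) i)),
    fun U => ?_⟩
  have := Scheme.OpenCover.map_glueMorphismsOfLocallyDirected ((directedCover X).pullback₁ π)
    (fun U => (pullbackRestrictIsoRestrict π _).hom ≫ g U)
    (fun {U V} i => key U V (leOfHom (X := X.AffineZariskiSite) i)) U
  rw [← cancel_epi (pullbackRestrictIsoRestrict π U.1).hom]
  refine Eq.trans ?_ this
  rw [← Category.assoc, pullbackRestrictIsoRestrict_hom_ι]
  rfl

theorem Scheme.Cover.RelativeGluingData.exists_glued {S : Scheme.{u}} {𝒰 : S.OpenCover}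
    [Category.{v} 𝒰.I₀] [𝒰.LocallyDirected] (d : Scheme.Cover.RelativeGluingData 𝒰) [Small.{u} 𝒰.I₀]
    [Quiver.IsThin 𝒰.I₀] :
    ∃ (Q : Scheme.{u}) (p : Q ⟶ S) (j : ∀ i, d.functor.obj i ⟶ Q),
      (∀ i, IsPullback (d.natTrans.app i) (j i) (𝒰.f i) p) ∧
      ∀ {i i'} (f : i ⟶ i'), d.functor.map f ≫ j i' = j i :=
  ⟨d.glued, d.toBase, fun i => colimit.ι d.functor i, fun i => d.isPullback_natTrans_ι_toBase i,
    fun f => colimit.w d.functor f⟩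

theorem RelAction.IsContinuous.exists_glued [QuasiCompact π] [QuasiSeparated π]
    (ha : a.IsContinuous) :
    ∃ (Q : Scheme.{u}) (p : Q ⟶ X)
      (j : ∀ U : X.AffineZariskiSite, Spec (a.invariants.obj (op U.1)) ⟶ Q),
      (∀ U, IsPullback (Spec.map (a.toInvariants.app (op U.1))) (j U) U.2.fromSpec p) ∧
      ∀ U V (e : U ≤ V), Spec.map (a.invariants.map (homOfLE (toOpens_mono e)).op) ≫ j V = j U := by
  let d := relativeGluingData ha.coequifibered
  obtain ⟨Q, p, j, h₁, h₂⟩ := d.exists_glued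
  refine ⟨Q, p, j, fun U => ?_, fun U V e => h₂ (homOfLE e)⟩
  refine (h₁ U).of_iso (Iso.refl _) U.2.isoSpec (Iso.refl _) (Iso.refl _) ?_ ?_ ?_ ?_
  · exact (Category.assoc _ _ _).trans (congr(_ ≫ $(U.2.isoSpec.inv_hom_id)).trans
      ((Category.comp_id _).trans (Category.id_comp _).symm))
  · exact (Category.comp_id _).trans (Category.id_comp _).symm
  · exact (Category.comp_id _).trans (by
      rw [← IsAffineOpen.isoSpec_inv_ι]; exact (Iso.hom_inv_id_assoc _ _).symm)
  · exact (Category.comp_id _).trans (Category.id_comp _).symm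

end AlgebraicGeometry

/-! ### Galois descent for relatively affine schemes -/

namespace AlgebraicGeometry

open Scheme.AffineZariskiSite

open scoped Topology

theorem isPullback_fromSpec {X M : Scheme.{u}} (π : M ⟶ X) [IsAffineHom π] {U : X.Opens}
    (hU : IsAffineOpen U) :
    IsPullback (hU.preimage π).fromSpec (Spec.map (π.app U)) π hU.fromSpec := by
  have hw : Spec.map (π.app U) ≫ hU.fromSpec = (hU.preimage π).fromSpec ≫ π := by
    rw [Scheme.Hom.app_eq_appLE]
    exact IsAffineOpen.SpecMap_appLE_fromSpec _ _ _ _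
  have h₁ : (hU.preimage π).isoSpec.hom ≫ (hU.preimage π).fromSpec = (π ⁻¹ᵁ U).ι := by
    rw [← IsAffineOpen.isoSpec_inv_ι, Iso.hom_inv_id_assoc]
  have h₂ : hU.isoSpec.hom ≫ hU.fromSpec = U.ι := by
    rw [← IsAffineOpen.isoSpec_inv_ι, Iso.hom_inv_id_assoc]
  refine (isPullback_morphismRestrict π U).flip.of_iso (hU.preimage π).isoSpec (Iso.refl _)
    hU.isoSpec (Iso.refl _) ?_ ?_ ?_ ?_
  · rw [h₁, Iso.refl_hom, Category.comp_id]
  · rw [← cancel_mono hU.fromSpec, Category.assoc, Category.assoc, hw, h₂, reassoc_of% h₁,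
      morphismRestrict_ι]
  · rw [Iso.refl_hom, Iso.refl_hom, Category.comp_id, Category.id_comp]
  · rw [h₂, Iso.refl_hom, Category.comp_id]

theorem hom_ext_of_affineOpens {X M N : Scheme.{u}} (π : M ⟶ X) [IsAffineHom π] {g₁ g₂ : M ⟶ N}
    (h : ∀ U : X.AffineZariskiSite,
      (U.2.preimage π).fromSpec ≫ g₁ = (U.2.preimage π).fromSpec ≫ g₂) : g₁ = g₂ := by
  refine Scheme.Cover.hom_ext (M.openCoverOfIsOpenCover (fun U : X.AffineZariskiSite =>
    π ⁻¹ᵁ U.1) (.comap (iSup_affineOpens_eq_top X) π.base.1)) _ _ fun U => ?_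
  have h₁ : (U.2.preimage π).isoSpec.hom ≫ (U.2.preimage π).fromSpec = (π ⁻¹ᵁ U.1).ι := by
    rw [← IsAffineOpen.isoSpec_inv_ι, Iso.hom_inv_id_assoc]
  have : (π ⁻¹ᵁ U.1).ι ≫ g₁ = (π ⁻¹ᵁ U.1).ι ≫ g₂ := by
    rw [← h₁, Category.assoc, h U, Category.assoc]
  exact this

theorem isAffineHom_of_isPullback_fromSpec {X Q : Scheme.{u}} (p : Q ⟶ X)
    (V : X.AffineZariskiSite → Scheme.{u}) (hV : ∀ U, IsAffine (V U)) (j : ∀ U, V U ⟶ Q)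
    (s : ∀ U : X.AffineZariskiSite, V U ⟶ Spec Γ(X, U.1))
    (h : ∀ U, IsPullback (s U) (j U) U.2.fromSpec p) : IsAffineHom p := by
  refine isAffineHom_of_forall_exists_isAffineOpen _ fun x => ?_
  obtain ⟨_, ⟨U, hU, rfl⟩, hxU, -⟩ :=
    X.isBasis_affineOpens.exists_subset_of_mem_open (Set.mem_univ x) isOpen_univ
  have : IsOpenImmersion (j ⟨U, hU⟩) :=
    MorphismProperty.of_isPullback (P := @IsOpenImmersion) (h ⟨U, hU⟩) inferInstance
  have := hV ⟨U, hU⟩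
  refine ⟨U, hxU, hU, ?_⟩
  have e : p ⁻¹ᵁ U = (j ⟨U, hU⟩).opensRange := by
    apply TopologicalSpace.Opens.ext
    have h₁ := Scheme.image_preimage_eq_of_isPullback (h ⟨U, hU⟩) Set.univ
    rw [Set.preimage_univ, Set.image_univ, Set.image_univ] at h₁
    have h₂ : Set.range (IsAffineOpen.fromSpec hU) = U := hU.range_fromSpec
    exact (congrArg (p ⁻¹' ·) h₂).symm.trans h₁.symm
  rw [e]
  exact isAffineOpen_opensRange _

/-- A square is cartesian if it is so over the members of an open covering of its lower left
corner. -/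
theorem isPullback_of_family {I : Type*} {M Q Y Z : Scheme.{u}} {r : M ⟶ Q} {q : M ⟶ Y} {p : Q ⟶ Z}
    {g : Y ⟶ Z} {N V : I → Scheme.{u}} {j : ∀ i, V i ⟶ Q} {n : ∀ i, N i ⟶ M} {s : ∀ i, N i ⟶ V i}
    (hj : ∀ i, IsOpenImmersion (j i)) (hcov : ∀ x, ∃ i y, j i y = x)
    (h : ∀ i, IsPullback (n i) (s i) r (j i))
    (h' : ∀ i, IsPullback (s i) (n i ≫ q) (j i ≫ p) g) : IsPullback r q p g := by
  refine Scheme.isPullback_of_openCover _ _ _ _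
    (Scheme.Cover.mkOfCovers (P := @IsOpenImmersion) I V j hcov hj) fun i => ?_
  refine (h' i).of_iso (h i).isoPullback (Iso.refl _) (Iso.refl _) (Iso.refl _) ?_ ?_ ?_ ?_
  · exact (Category.comp_id _).trans (h i).isoPullback_hom_snd.symm
  · exact (Category.comp_id _).trans
      (congr($((h i).isoPullback_hom_fst) ≫ q).symm.trans (Category.assoc _ _ _))
  · exact (Category.comp_id _).trans (Category.id_comp _).symm
  · exact (Category.comp_id _).trans (Category.id_comp _).symm

variable {k kbar : Type u} [Field k] [Field kbar] [Algebra k kbar] [IsGalois k kbar]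

theorem isPushout_fixedSubring_of_comp {B : CommRingCat.{u}} (ρ : Gal(kbar/k) →* (B →+* B))
    {φ : CommRingCat.of k ⟶ CommRingCat.of (fixedSubring ρ)} {θ : CommRingCat.of kbar ⟶ B}
    (hw : φ ≫ CommRingCat.ofHom (fixedSubring ρ).subtype =
      CommRingCat.ofHom (algebraMap k kbar) ≫ θ)
    (hρ : ∀ σ c, ρ σ (θ c) = θ (σ c)) (hc : ∀ b, ∀ᶠ σ in 𝓝 1, ρ σ b = b) :
    IsPushout φ (CommRingCat.ofHom (algebraMap k kbar))
      (CommRingCat.ofHom (fixedSubring ρ).subtype) θ := by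
  algebraize [φ.hom, θ.hom, θ.hom.comp (algebraMap k kbar)]
  have : IsScalarTower k (fixedSubring ρ) B := .of_algebraMap_eq fun c => congr($hw.symm c)
  have := isPushout_fixedSubring ρ hρ hc
  exact (CommRingCat.isPushout_of_isPushout k kbar (fixedSubring ρ) B).flip

/-- Galois descent for relatively affine schemes. -/
theorem RelAction.IsContinuous.exists_isPullback {X M : Scheme.{u}} {π : M ⟶ X} [IsAffineHom π]
    {a : RelAction π Gal(kbar/k)} (ha : a.IsContinuous) (f : X ⟶ Spec (.of k))
    (q : M ⟶ Spec (.of kbar))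
    (hq : π ≫ f = q ≫ Spec.map (CommRingCat.ofHom (algebraMap k kbar)))
    (haq : ∀ σ, a.map σ ≫ q =
      q ≫ Spec.map (CommRingCat.ofHom (σ : kbar ≃+* kbar).toRingHom)) :
    ∃ (Q : Scheme.{u}) (p : Q ⟶ X) (r : M ⟶ Q), IsAffineHom p ∧ r ≫ p = π ∧
      (∀ σ, a.map σ ≫ r = r) ∧
      IsPullback r q (p ≫ f) (Spec.map (CommRingCat.ofHom (algebraMap k kbar))) := by
  obtain ⟨Q, p, j, hj, hjc⟩ := ha.exists_glued
  have hV (U : X.AffineZariskiSite) : IsAffineOpen (π ⁻¹ᵁ U.1) := U.2.preimage π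
  -- Over each affine open set, `r` is dual to the inclusion of the invariants.
  obtain ⟨r, hr⟩ := exists_glue_of_affineOpens π
    (fun U => (hV U).isoSpec.hom ≫ Spec.map (a.inclusion U.1) ≫ j U) (fun U V e => by
      have h₁ : M.homOfLE (π.preimage_mono (toOpens_mono e)) ≫ (hV V).isoSpec.hom =
          (hV U).isoSpec.hom ≫ Spec.map (M.presheaf.map
            (homOfLE (π.preimage_mono (toOpens_mono e))).op) := by
        rw [IsAffineOpen.isoSpec_hom, IsAffineOpen.isoSpec_hom]
        exact (Scheme.Opens.toSpecΓ_SpecMap_presheaf_map _ _ _).symm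
      rw [← hjc U V e, reassoc_of% h₁]
      refine congr(_ ≫ $(?_))
      rw [← Spec.map_comp_assoc, ← Spec.map_comp_assoc, map_inclusion])
  have hr' (U : X.AffineZariskiSite) : (hV U).fromSpec ≫ r = Spec.map (a.inclusion U.1) ≫ j U := by
    rw [← IsAffineOpen.isoSpec_inv_ι, Category.assoc, hr, Iso.inv_hom_id_assoc]
  have hrp : r ≫ p = π := hom_ext_of_affineOpens π fun U => by
    rw [reassoc_of% hr', ← (hj U).w, ← Spec.map_comp_assoc, toInvariants_inclusion,
      (isPullback_fromSpec π U.2).w]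
  have hra (σ) : a.map σ ≫ r = r := hom_ext_of_affineOpens π fun U => by
    have h1 : Spec.map ((a.map σ).appLE (π ⁻¹ᵁ U.1) (π ⁻¹ᵁ U.1) (a.preimage_eq σ U.1).ge) ≫
      (hV U).fromSpec = (hV U).fromSpec ≫ a.map σ := IsAffineOpen.SpecMap_appLE_fromSpec _ _ _ _
    rw [← reassoc_of% h1, hr', ← Spec.map_comp_assoc]
    congr 2
    ext b
    exact b.2 σ
  refine ⟨Q, p, r, isAffineHom_of_isPullback_fromSpec p _ (fun U => inferInstance) j _ hj,
    hrp, hra, ?_⟩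
  have hji (U) : IsOpenImmersion (j U) :=
    MorphismProperty.of_isPullback (P := @IsOpenImmersion) (hj U) inferInstance
  -- The pieces of `Q` over the affine open sets cover it, and on each of them the cartesian square
  -- is Galois descent for the algebra of sections.
  refine isPullback_of_family (n := fun U => (hV U).fromSpec)
    (s := fun U => Spec.map (a.inclusion U.1)) hji (fun x => ?_) (fun U => ?_) fun U => ?_
  · obtain ⟨_, ⟨U, hU, rfl⟩, hxU, -⟩ :=
      X.isBasis_affineOpens.exists_subset_of_mem_open (Set.mem_univ (p x)) isOpen_univ
    have h₂ : Set.range (IsAffineOpen.fromSpec hU) = U := hU.range_fromSpec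
    obtain ⟨y, hy⟩ := h₂.ge hxU
    obtain ⟨z, -, hz⟩ := Scheme.exists_preimage_of_isPullback (hj ⟨U, hU⟩) y x hy
    exact ⟨⟨U, hU⟩, z, hz⟩
  · refine (IsPullback.of_right (h₁₂ := Spec.map (a.toInvariants.app (op U.1)))
      (h₂₂ := p) (v₁₃ := U.2.fromSpec) ?_ (hr' U).symm (hj U)).flip
    rw [hrp, ← Spec.map_comp, toInvariants_inclusion]
    exact (isPullback_fromSpec π U.2).flip
  · obtain ⟨φ, hφ⟩ := Spec.map_surjective (j U ≫ p ≫ f)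
    obtain ⟨θ, hθ⟩ := Spec.map_surjective ((hV U).fromSpec ≫ q)
    rw [← hφ, ← hθ]
    refine isPullback_SpecMap_of_isPushout _ _ _ _ ?_
    refine isPushout_fixedSubring_of_comp _ ?_ ?_ (ha U.1 U.2)
    · have h1 : φ ≫ a.inclusion U.1 = CommRingCat.ofHom (algebraMap k kbar) ≫ θ := by
        apply Spec.map_injective
        rw [Spec.map_comp, Spec.map_comp, hφ, hθ, Category.assoc, ← hq]
        refine Eq.trans ?_ congr((hV U).fromSpec ≫ $hrp ≫ f)
        rw [Category.assoc, ← reassoc_of% hr' U]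
      exact h1
    · intro σ c
      have h1 : Spec.map ((a.map σ).appLE (π ⁻¹ᵁ U.1) (π ⁻¹ᵁ U.1) (a.preimage_eq σ U.1).ge) ≫
        (hV U).fromSpec = (hV U).fromSpec ≫ a.map σ := IsAffineOpen.SpecMap_appLE_fromSpec _ _ _ _
      have h2 : θ ≫ (a.map σ).appLE (π ⁻¹ᵁ U.1) (π ⁻¹ᵁ U.1) (a.preimage_eq σ U.1).ge =
          CommRingCat.ofHom (σ : kbar ≃+* kbar).toRingHom ≫ θ := by
        apply Spec.map_injective
        rw [Spec.map_comp, Spec.map_comp, hθ, reassoc_of% h1, haq, Category.assoc]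
      exact congr($h2 c)

end AlgebraicGeometry

namespace AlgebraicGeometry

open scoped Topology

theorem Scheme.Hom.appLE_top_injective {N M : Scheme.{u}} (j : N ⟶ M) [IsOpenImmersion j]
    {V : M.Opens} (h : j.opensRange = V) (e : ⊤ ≤ j ⁻¹ᵁ V) :
    Function.Injective (j.appLE V ⊤ e) := by
  obtain rfl : V = j ''ᵁ ⊤ := by rw [← h, Scheme.Hom.image_top_eq_opensRange]
  have : j.appLE (j ''ᵁ ⊤) ⊤ e = (j.appIso ⊤).hom := (j.appIso_hom' ⊤).symm
  rw [this]
  exact (ConcreteCategory.bijective_of_isIso (j.appIso ⊤).hom).1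

variable {k kbar : Type u} [Field k] [Field kbar] [Algebra k kbar]

/-- Passes from restrictions formed as fibre products, where continuity is established, to sections
over preimages of open sets, where the quotient is formed. -/
theorem RelAction.isContinuous_of_eventuallyFixes {X M : Scheme.{u}} {π : M ⟶ X}
    (a : RelAction π Gal(kbar/k))
    (h : ∀ U : X.Opens, IsAffineOpen U → ∃ (N : Scheme.{u}) (j : N ⟶ M) (_ : IsOpenImmersion j)
      (ψ : Gal(kbar/k) → (N ⟶ N)), j.opensRange = π ⁻¹ᵁ U ∧ (∀ σ, ψ σ ≫ j = j ≫ a.map σ) ∧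
        EventuallyFixes (𝓝 1) ψ) : a.IsContinuous := by
  intro U hU b
  obtain ⟨N, j, _, ψ, hr, hψ, hc⟩ := h U hU
  have e : ⊤ ≤ j ⁻¹ᵁ π ⁻¹ᵁ U := by
    rw [← hr, Scheme.Hom.preimage_opensRange]
  filter_upwards [hc (j.appLE (π ⁻¹ᵁ U) ⊤ e b)] with σ hσ
  apply j.appLE_top_injective hr e
  refine Eq.trans ?_ hσ
  have h₁ : (a.map σ).appLE (π ⁻¹ᵁ U) (π ⁻¹ᵁ U) (a.preimage_eq σ U).ge ≫
      j.appLE (π ⁻¹ᵁ U) ⊤ e = j.appLE (π ⁻¹ᵁ U) ⊤ e ≫ (ψ σ).appTop := by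
    rw [← Scheme.Hom.appLE_top_eq_appTop _ le_top]
    refine (Scheme.Hom.appLE_comp_appLE _ _ _ _ _ _ _).trans ?_
    refine Eq.trans ?_ (Scheme.Hom.appLE_comp_appLE _ _ _ _ _ _ _).symm
    simp only [hψ]
  exact congr($h₁ b)

end AlgebraicGeometry

namespace TorsorDescent

open BaseRestriction

variable {k : Type u} [Field k] {kbar : Type u} [Field kbar] [Algebra k kbar] [IsGalois k kbar]
variable {X M : Over (Spec (.of k))} {proj : M ⟶ bar kbar X}

open scoped Topology

instance : IsAffineHom (specBar k kbar).hom :=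
  inferInstanceAs (IsAffineHom (Spec.map _))

/-- Galois descent for objects which are affine over `X̄`. -/
theorem exists_isPullback_of_galoisAction [IsAffineHom proj.left] (a : Gal(kbar/k) → (M ⟶ M))
    (ha : ∀ σ, a σ ≫ proj = proj ≫ X ◁ specGal σ) (h₁ : a 1 = 𝟙 M)
    (hm : ∀ σ τ, a (σ * τ) = a σ ≫ a τ)
    (hc : ∀ {U : Over (Spec (.of k))} [IsAffine U.left] (t : U ⟶ X),
      EventuallyFixes (𝓝 1) fun σ => (restrEnd t (ha σ)).left) :
    ∃ (Q : Over (Spec (.of k))) (p : Q ⟶ X) (r : M ⟶ Q), IsAffineHom p.left ∧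
      IsPullback r proj p (fst X (specBar k kbar)) ∧ ∀ σ, a σ ≫ r = r := by
  have : IsAffineHom (fst X (specBar k kbar)).left :=
    MorphismProperty.of_isPullback (P := @IsAffineHom)
      (isPullback_tensor_left X (specBar k kbar)).flip inferInstance
  let π : M ⟶ X := proj ≫ fst X _
  have : IsAffineHom π.left := by
    change IsAffineHom (proj.left ≫ (fst X _).left)
    infer_instance
  let A : RelAction π.left Gal(kbar/k) :=
    { map := fun σ => (a σ).left
      map_comp := fun σ => by
        rw [← Over.comp_left]
        congr 1
        rw [reassoc_of% ha, whiskerLeft_fst]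
      map_one := by rw [h₁]; rfl
      map_mul := fun σ τ => by rw [hm]; rfl }
  have hA : A.IsContinuous := by
    refine A.isContinuous_of_eventuallyFixes fun U hU => ?_
    let Uo : Over (Spec (.of k)) := Over.mk (U.ι ≫ X.hom)
    let t : Uo ⟶ X := Over.homMk U.ι
    have : IsAffine Uo.left := hU
    have hp := (IsPullback.of_hasPullback (proj ≫ fst X (specBar k kbar)) t).left
    have : IsOpenImmersion (pullback.fst (proj ≫ fst X (specBar k kbar)) t).left :=
      MorphismProperty.of_isPullback (P := @IsOpenImmersion) hp.flip
        (inferInstanceAs (IsOpenImmersion U.ι))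
    refine ⟨_, (pullback.fst (proj ≫ fst X (specBar k kbar)) t).left, this, _, ?_,
      fun σ => ?_, hc t⟩
    · apply TopologicalSpace.Opens.ext
      have h₁ := Scheme.image_preimage_eq_of_isPullback hp.flip Set.univ
      rw [Set.preimage_univ, Set.image_univ, Set.image_univ] at h₁
      refine h₁.trans ?_
      have h₂ : Set.range U.ι = U := U.range_ι
      exact congrArg (π.left ⁻¹' ·) h₂
    · rw [← Over.comp_left, restrEnd_fst]
      rfl
  obtain ⟨Q, p, r, hp, hrp, hra, hpb⟩ := hA.exists_isPullback (X.hom)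
    ((proj ≫ snd X (specBar k kbar)).left) (by
      exact (Over.w π).trans (Over.w (proj ≫ snd X (specBar k kbar))).symm) (fun σ => by
      have h₂ : a σ ≫ proj ≫ snd X _ = (proj ≫ snd X _) ≫ specGal σ := by
        rw [reassoc_of% ha, whiskerLeft_snd, Category.assoc]
      exact congr(CommaMorphism.left $h₂))
  let Qo : Over (Spec (.of k)) := Over.mk (p ≫ X.hom)
  let po : Qo ⟶ X := Over.homMk p
  let ro : M ⟶ Qo := Over.homMk r (by
    exact (Category.assoc _ _ _).symm.trans (congr($hrp ≫ X.hom).trans (Over.w π)))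
  refine ⟨Qo, po, ro, hp, ?_, fun σ => Over.OverMorphism.ext (hra σ)⟩
  have hpo : ro ≫ po = proj ≫ fst X _ := Over.OverMorphism.ext hrp
  -- The square over `Spec k` is cartesian; cancelling the one that defines `X × Spec k̄` leaves the
  -- square over `X`.
  refine IsPullback.of_left (IsPullback.of_right (h₁₁ := proj.left)
    (h₁₂ := (snd X (specBar k kbar)).left) (h₂₂ := X.hom) ?_ ?_
    (isPullback_tensor_left X (specBar k kbar)).flip).flip
  · exact hpb.flip
  · rw [← Over.comp_left, ← Over.comp_left, hpo]

end TorsorDescent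

/-! ### Galois descent for morphisms -/

namespace GaloisDescent

variable {k kbar : Type u} [Field k] [Field kbar] [Algebra k kbar] [IsGalois k kbar]

/-- A `k`-basis of `A` becomes a Galois-fixed `k̄`-basis of `B`, so `σ` acts on coordinates. An
invariant element has Galois-fixed coordinates, and these lie in `k`. Continuity plays no role here.
-/
theorem mem_range_of_isPushout_of_fixed {A B : Type u} [CommRing A] [CommRing B] [Algebra k A]
    [Algebra kbar B] [Algebra A B] [Algebra k B] [IsScalarTower k A B] [IsScalarTower k kbar B]
    [Algebra.IsPushout k kbar A B] (ρ : Gal(kbar/k) → (B →+* B))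
    (hρ : ∀ σ c, ρ σ (algebraMap kbar B c) = algebraMap kbar B (σ c))
    (hA : ∀ σ a, ρ σ (algebraMap A B a) = algebraMap A B a) (x : B) (hx : ∀ σ, ρ σ x = x) :
    x ∈ Set.range (algebraMap A B) := by
  let b := Module.Free.chooseBasis k A
  have h := Algebra.IsPushout.out (R := k) (S := kbar) (R' := A) (S' := B)
  let e := (Algebra.TensorProduct.basis kbar b).map h.equiv
  have he (i) : e i = algebraMap A B (b i) := by
    simp [e, IsBaseChange.equiv_tmul]
  have key (σ : Gal(kbar/k)) (y : B) (i) : e.repr (ρ σ y) i = σ (e.repr y i) := by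
    induction e.mem_span y using Submodule.span_induction with
    | zero => simp
    | add y z _ _ hy hz => simp [hy, hz]
    | smul c y _ hy => simp [Algebra.smul_def, hρ] at hy ⊢; simp [← Algebra.smul_def, hy]
    | mem y hy =>
      obtain ⟨j, rfl⟩ := hy
      have : ρ σ (e j) = e j := by rw [he, hA]
      rw [this, e.repr_self, Finsupp.single_apply]
      split_ifs <;> simp
  have hr (i) : ∃ d : k, algebraMap k kbar d = e.repr x i :=
    (InfiniteGalois.mem_range_algebraMap_iff_fixed _).mpr fun σ => by rw [← key, hx]
  choose d hd using hr
  refine ⟨∑ i ∈ (e.repr x).support, d i • b i, ?_⟩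
  rw [map_sum]
  conv_rhs => rw [← e.linearCombination_repr x, Finsupp.linearCombination_apply, Finsupp.sum]
  refine Finset.sum_congr rfl fun i _ => ?_
  rw [he, ← hd, algebraMap_smul, Algebra.algebraMap_eq_smul_one,
    Algebra.algebraMap_eq_smul_one, smul_assoc]

theorem exists_comp_eq_of_isPushout_of_fixed {A B R : CommRingCat.{u}} {φ : CommRingCat.of k ⟶ A}
    {i : A ⟶ B} {θ : CommRingCat.of kbar ⟶ B}
    (h : IsPushout φ (CommRingCat.ofHom (algebraMap k kbar)) i θ) (ρ : Gal(kbar/k) → (B ⟶ B))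
    (hρ : ∀ σ, θ ≫ ρ σ = CommRingCat.ofHom (σ : kbar ≃+* kbar).toRingHom ≫ θ)
    (hi : ∀ σ, i ≫ ρ σ = i) (hinj : Function.Injective i) (f : R ⟶ B) (hf : ∀ σ, f ≫ ρ σ = f) :
    ∃ g : R ⟶ A, g ≫ i = f := by
  algebraize [φ.hom, i.hom, θ.hom, i.hom.comp φ.hom]
  have : IsScalarTower k kbar B := .of_algebraMap_eq fun c => congr($h.w c)
  have : Algebra.IsPushout k kbar A B := CommRingCat.isPushout_iff_isPushout.mp h.flip
  have hr (x) : ∃ a, i a = f x :=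
    mem_range_of_isPushout_of_fixed (k := k) (fun σ => (ρ σ).hom) (fun σ c => congr($(hρ σ) c))
      (fun σ a => congr($(hi σ) a)) (f x) fun σ => congr($(hf σ) x)
  choose g hg using hr
  refine ⟨CommRingCat.ofHom
    { toFun := g
      map_one' := hinj (by rw [hg, map_one, map_one])
      map_mul' := fun x y => hinj (by rw [hg, map_mul, map_mul, hg, hg])
      map_zero' := hinj (by rw [hg, map_zero, map_zero])
      map_add' := fun x y => hinj (by rw [hg, map_add, map_add, hg, hg]) }, ?_⟩
  ext x
  exact hg x

end GaloisDescent

namespace TorsorDescent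

open GaloisDescent

variable {k : Type u} [Field k] {kbar : Type u} [Field kbar] [Algebra k kbar] [IsGalois k kbar]

omit [IsGalois k kbar] in
theorem isPushout_appTop_tensor_specBar (T : Over (Spec (.of k))) [IsAffine T.left] :
    IsPushout ((Scheme.ΓSpecIso (.of k)).inv ≫ T.hom.appTop)
      (CommRingCat.ofHom (algebraMap k kbar)) (fst T (specBar k kbar)).left.appTop
      ((Scheme.ΓSpecIso (.of kbar)).inv ≫ (snd T (specBar k kbar)).left.appTop) := by
  refine (isPushout_appTop_of_isAffine (isPullback_tensor_left T (specBar k kbar))).of_iso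
    (Scheme.ΓSpecIso (.of k)) (Iso.refl _) (Scheme.ΓSpecIso (.of kbar)) (Iso.refl _) ?_ ?_ ?_ ?_
  · simp
  · exact Scheme.ΓSpecIso_naturality _
  · simp
  · rw [Iso.refl_hom, Category.comp_id]
    exact (Iso.hom_inv_id_assoc _ _).symm

instance flat_fst_specBar (T : Over (Spec (.of k))) : Flat (fst T (specBar k kbar)).left :=
  MorphismProperty.of_isPullback (P := @Flat) (isPullback_tensor_left T (specBar k kbar)).flip
    inferInstance

instance surjective_fst_specBar (T : Over (Spec (.of k))) :
    Surjective (fst T (specBar k kbar)).left :=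
  have : Surjective (specBar k kbar).hom := ⟨fun _ =>
    ⟨IsLocalRing.closedPoint kbar, Subsingleton.elim (α := PrimeSpectrum k) _ _⟩⟩
  MorphismProperty.of_isPullback (P := @Surjective)
    (isPullback_tensor_left T (specBar k kbar)).flip inferInstance

/-- On functions, an invariant morphism lands in the Galois invariants of the functions on `T × k̄`,
which are the functions on `T`. -/
theorem exists_fst_comp_eq_of_isAffine {T Q : Over (Spec (.of k))} [IsAffine T.left]
    [IsAffine Q.left] (f : T ⊗ specBar k kbar ⟶ Q)
    (hf : ∀ σ : Gal(kbar/k), (T ◁ specGal σ) ≫ f = f) : ∃ f₀ : T ⟶ Q, fst T _ ≫ f₀ = f := by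
  have := isAffine_tensor_left T (specBar k kbar)
  obtain ⟨g, hg⟩ := exists_comp_eq_of_isPushout_of_fixed (isPushout_appTop_tensor_specBar T)
    (fun σ : Gal(kbar/k) => (T ◁ specGal σ).left.appTop) (fun σ => by
      have h := congr(CommaMorphism.left $(whiskerLeft_snd T (specGal σ)))
      have h' := congr(Scheme.Hom.appTop $h)
      simp only [Over.comp_left, Scheme.Hom.comp_appTop] at h'
      refine (Category.assoc _ _ _).trans (congr(_ ≫ $h').trans ((Category.assoc _ _ _).symm.trans
        (Eq.trans ?_ (Category.assoc _ _ _))))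
      exact congr($((Scheme.ΓSpecIso_inv_naturality _).symm) ≫ _))
    (fun σ => by
      have h := congr(CommaMorphism.left $(whiskerLeft_fst T (specGal σ)))
      exact (Scheme.Hom.comp_appTop _ _).symm.trans congr(Scheme.Hom.appTop $h))
    (appTop_injective _) f.left.appTop (fun σ => by
      have h := congr(CommaMorphism.left $(hf σ))
      exact (Scheme.Hom.comp_appTop _ _).symm.trans congr(Scheme.Hom.appTop $h))
  obtain ⟨f₀, hf₀⟩ := exists_appTop_eq (D := T.left) (M := Q.left) g
  have h₁ : (fst T (specBar k kbar)).left ≫ f₀ = f.left := by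
    apply ext_of_isAffine
    rw [Scheme.Hom.comp_appTop, hf₀, hg]
  have : Epi (fst T (specBar k kbar)).left := Flat.epi_of_flat_of_surjective _
  refine ⟨Over.homMk f₀ ?_, Over.OverMorphism.ext h₁⟩
  rw [← cancel_epi (fst T (specBar k kbar)).left, reassoc_of% h₁, Over.w, Over.w]

/-- Galois descent for morphisms between objects which are affine over `X`. -/
theorem exists_fst_comp_eq {X T Q : Over (Spec (.of k))} [QuasiCompact X.hom]
    [QuasiSeparated X.hom] (t : T ⟶ X) (q : Q ⟶ X) [IsAffineHom t.left] [IsAffineHom q.left]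
    (f : T ⊗ specBar k kbar ⟶ Q) (hfq : f ≫ q = fst T _ ≫ t)
    (hf : ∀ σ : Gal(kbar/k), (T ◁ specGal σ) ≫ f = f) : ∃ f₀ : T ⟶ Q, fst T _ ≫ f₀ = f := by
  have : CompactSpace X.left := QuasiCompact.compactSpace_of_compactSpace X.hom
  have : QuasiSeparatedSpace X.left := quasiSeparatedSpace_of_quasiSeparated X.hom
  obtain ⟨W, w, _, _, _⟩ := exists_affine_flat_cover X
  have : QuasiCompact w.left := inferInstance
  have hT := (IsPullback.of_hasPullback t w).left
  have hQ := (IsPullback.of_hasPullback q w).left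
  have : IsAffineHom (pullback.snd t w).left :=
    MorphismProperty.of_isPullback (P := @IsAffineHom) hT ‹_›
  have : IsAffineHom (pullback.snd q w).left :=
    MorphismProperty.of_isPullback (P := @IsAffineHom) hQ ‹_›
  have : IsAffine (pullback t w).left := isAffine_of_isAffineHom (pullback.snd t w).left
  have : IsAffine (pullback q w).left := isAffine_of_isAffineHom (pullback.snd q w).left
  let e := pullback.fst t w
  have : Flat e.left := MorphismProperty.of_isPullback (P := @Flat) hT.flip ‹_›
  have : Surjective e.left := MorphismProperty.of_isPullback (P := @Surjective) hT.flip ‹_›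
  have : QuasiCompact e.left := MorphismProperty.of_isPullback (P := @QuasiCompact) hT.flip ‹_›
  -- Over the affine flat cover `W` of `X` both objects become affine; the morphism found there is
  -- then descended along `e`.
  obtain ⟨g, hg⟩ := exists_fst_comp_eq_of_isAffine
    (pullback.lift ((e ▷ specBar k kbar) ≫ f) (fst _ _ ≫ pullback.snd t w) (by
      rw [Category.assoc, hfq, whiskerRight_fst_assoc, Category.assoc, pullback.condition]) :
      pullback t w ⊗ specBar k kbar ⟶ pullback q w) (fun σ => by
      apply pullback.hom_ext
      · rw [Category.assoc, pullback.lift_fst, whisker_exchange_assoc, hf]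
      · rw [Category.assoc, pullback.lift_snd, whiskerLeft_fst_assoc])
  have hg' : fst _ _ ≫ g ≫ pullback.fst q w = (e ▷ specBar k kbar) ≫ f := by
    rw [reassoc_of% hg, pullback.lift_fst]
  -- The gluing condition may be tested after extension to `k̄`, where both sides come from `f`,
  -- which is defined before restricting to `W`.
  obtain ⟨f₀, hf₀⟩ := exists_comp_eq_of_flat e (fst (pullback e e) (specBar k kbar))
    (g ≫ pullback.fst q w) (by
      rw [← whiskerRight_fst_assoc (pullback.fst e e), ← whiskerRight_fst_assoc (pullback.snd e e),
        hg', ← comp_whiskerRight_assoc, ← comp_whiskerRight_assoc, pullback.condition])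
  refine ⟨f₀, ?_⟩
  have : Flat (e ▷ specBar k kbar).left := MorphismProperty.of_isPullback (P := @Flat)
    (ActedOver.isPullback_whiskerRight_fst e (specBar k kbar)).left.flip ‹_›
  have : Surjective (e ▷ specBar k kbar).left := MorphismProperty.of_isPullback (P := @Surjective)
    (ActedOver.isPullback_whiskerRight_fst e (specBar k kbar)).left.flip ‹_›
  have := epi_of_flat_left (e ▷ specBar k kbar)
  rw [← cancel_epi (e ▷ specBar k kbar), whiskerRight_fst_assoc, hf₀, hg']

end TorsorDescent

/-! ### Descent of the group action -/

namespace ActedOver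

variable {C : Type w} [Category.{v} C] [CartesianMonoidalCategory C]
variable {G : C} [GrpObj G] {X Y : C}

/-- An action descends along an epimorphism as soon as the action morphism does. -/
def descend (P : ActedOver G Y) {Q : C} (t : Y ⟶ X) (p : Q ⟶ X) (r : P.obj ⟶ Q) [Epi r]
    [Epi (r ▷ G)] [Epi (r ▷ G ▷ G)] (hr : r ≫ p = P.proj ≫ t) (b : Q ⊗ G ⟶ Q)
    (hb : r ▷ G ≫ b = P.act ≫ r) : ActedOver G X where
  obj := Q
  proj := p
  act := b
  act_proj := by
    rw [← cancel_epi (r ▷ G), reassoc_of% hb, hr, whiskerRight_fst_assoc, hr,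
      reassoc_of% P.act_proj]
  act_one {T} x := by
    have h : lift (𝟙 Q) (1 : Q ⟶ G) ≫ b = 𝟙 Q := by
      have h₁ : r ≫ lift (𝟙 Q) (1 : Q ⟶ G) = lift (𝟙 P.obj) (1 : P.obj ⟶ G) ≫ r ▷ G := by
        ext <;> simp
      rw [← cancel_epi r, reassoc_of% h₁, hb, ← Category.assoc, P.act_one, Category.comp_id,
        Category.id_comp]
    have h₂ : lift x (1 : T ⟶ G) = x ≫ lift (𝟙 Q) (1 : Q ⟶ G) := by ext <;> simp
    rw [h₂, Category.assoc, h, Category.comp_id]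
  act_mul {T} x g g' := by
    have h : b ▷ G ≫ b = lift (fst (Q ⊗ G) G ≫ fst Q G)
        ((fst (Q ⊗ G) G ≫ snd Q G) * snd (Q ⊗ G) G) ≫ b := by
      rw [← cancel_epi (r ▷ G ▷ G), ← comp_whiskerRight_assoc, hb, comp_whiskerRight_assoc, hb]
      have h₁ : r ▷ G ▷ G ≫ lift (fst (Q ⊗ G) G ≫ fst Q G)
          ((fst (Q ⊗ G) G ≫ snd Q G) * snd (Q ⊗ G) G) =
          lift (fst (P.obj ⊗ G) G ≫ fst P.obj G)
          ((fst (P.obj ⊗ G) G ≫ snd P.obj G) * snd (P.obj ⊗ G) G) ≫ r ▷ G := by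
        ext <;> simp [MonObj.comp_mul]
      have h₂ := P.act_mul (fst (P.obj ⊗ G) G ≫ fst P.obj G) (fst (P.obj ⊗ G) G ≫ snd P.obj G)
        (snd (P.obj ⊗ G) G)
      rw [reassoc_of% h₁, hb, ← reassoc_of% h₂, ← Category.assoc, ← Category.assoc]
      congr 2
      ext <;> simp
    have h₁ : lift (lift x g ≫ b) g' = lift (lift x g) g' ≫ b ▷ G := by ext <;> simp
    rw [h₁, Category.assoc, h, ← Category.assoc]
    congr 1
    ext <;> simp [MonObj.comp_mul]

theorem isIso_lift_of_isPullback {B M Q : C} {proj : M ⟶ X ⊗ B} {p : Q ⟶ X} {r : M ⟶ Q}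
    (h : IsPullback r proj p (fst X B)) : IsIso (lift r (proj ≫ snd X B)) :=
  ⟨h.lift (fst Q B) (p ▷ B) (by simp), h.hom_ext (by simp) (by
    ext <;> simp [h.w]), by ext <;> simp⟩

theorem isIso_lift_whiskerRight {B M Q : C} {r : M ⟶ Q} {b : M ⟶ B} [IsIso (lift r b)] (G : C) :
    IsIso (lift (r ▷ G) (fst M G ≫ b)) := by
  refine ⟨lift (lift (fst _ _ ≫ fst Q G) (snd _ _) ≫ inv (lift r b)) (fst _ _ ≫ snd Q G), ?_, ?_⟩
  · have : lift (r ▷ G) (fst M G ≫ b) ≫ lift (fst _ _ ≫ fst Q G) (snd _ _) =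
        fst M G ≫ lift r b := by ext <;> simp
    ext <;> simp [reassoc_of% this]
  · have h₁ : inv (lift r b) ≫ r = fst Q B := by rw [IsIso.inv_comp_eq, lift_fst]
    have h₂ : inv (lift r b) ≫ b = snd Q B := by rw [IsIso.inv_comp_eq, lift_snd]
    ext <;> simp [h₁, h₂]

end ActedOver

namespace TorsorDescent

variable {k : Type u} [Field k] {kbar : Type u} [Field kbar] [Algebra k kbar] [IsGalois k kbar]
variable {G : Over (Spec (.of k))} [GrpObj G] {X : Over (Spec (.of k))}

/-- A form of `exists_fst_comp_eq` for an object `N` isomorphic to `T × Spec k̄`. -/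
theorem exists_comp_eq_of_isIso_lift {T Q N : Over (Spec (.of k))} [QuasiCompact X.hom]
    [QuasiSeparated X.hom] (t : T ⟶ X) (q : Q ⟶ X) [IsAffineHom t.left] [IsAffineHom q.left]
    (n : N ⟶ T) (b : N ⟶ specBar k kbar) [IsIso (lift n b)] (a : Gal(kbar/k) → (N ⟶ N))
    (ha : ∀ σ, a σ ≫ n = n) (hab : ∀ σ, a σ ≫ b = b ≫ specGal σ) (f : N ⟶ Q)
    (hfq : f ≫ q = n ≫ t) (hf : ∀ σ, a σ ≫ f = f) : ∃ f₀ : T ⟶ Q, n ≫ f₀ = f := by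
  have h₁ : inv (lift n b) ≫ n = fst T _ := by rw [IsIso.inv_comp_eq, lift_fst]
  obtain ⟨f₀, hf₀⟩ := exists_fst_comp_eq t q (inv (lift n b) ≫ f)
    (by rw [Category.assoc, hfq, reassoc_of% h₁]) fun σ => by
      have : (T ◁ specGal σ) ≫ inv (lift n b) = inv (lift n b) ≫ a σ := by
        rw [IsIso.eq_inv_comp, ← Category.assoc, IsIso.comp_inv_eq]
        ext1 <;> simp [ha, hab]
      rw [reassoc_of% this, hf]
  exact ⟨f₀, by rw [← lift_fst n b, Category.assoc, hf₀, IsIso.hom_inv_id_assoc]⟩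

/-- `P × G` is the base change of `Q × G` to `k̄`, and equivariance of each `a σ` makes the
composite of the action with `r` Galois-invariant. It therefore descends to `Q × G`, and the action
axioms follow because `r`, `r ▷ G` and `r ▷ G ▷ G` are epimorphisms. -/
theorem exists_descend [QuasiCompact X.hom] [QuasiSeparated X.hom] [IsAffineHom G.hom]
    (P : ActedOver G (bar kbar X)) {Q : Over (Spec (.of k))} (p : Q ⟶ X) (r : P.obj ⟶ Q)
    [IsAffineHom p.left] (hp : IsPullback r P.proj p (fst X (specBar k kbar)))
    (a : Gal(kbar/k) → (P.obj ⟶ P.obj)) (ha : ∀ σ, IsSemi P (X ◁ specGal σ) (a σ))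
    (har : ∀ σ, a σ ≫ r = r) :
    ∃ (Q : ActedOver G X) (r : P.obj ⟶ Q.obj), IsAffineHom Q.proj.left ∧
      IsPullback r P.proj Q.proj (fst X (specBar k kbar)) ∧ P.act ≫ r = r ▷ G ≫ Q.act := by
  have hr₁ : Flat r.left := MorphismProperty.of_isPullback (P := @Flat) hp.left.flip inferInstance
  have hr₂ : Surjective r.left :=
    MorphismProperty.of_isPullback (P := @Surjective) hp.left.flip inferInstance
  have epi {A B : Over (Spec (.of k))} (f : A ⟶ B) [Flat f.left] [Surjective f.left] : Epi f :=
    epi_of_flat_left f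
  have h₁ {A B : Over (Spec (.of k))} (f : A ⟶ B) [Flat f.left] : Flat (f ▷ G).left :=
    MorphismProperty.of_isPullback (P := @Flat)
      (ActedOver.isPullback_whiskerRight_fst f G).left.flip ‹_›
  have h₂ {A B : Over (Spec (.of k))} (f : A ⟶ B) [Surjective f.left] : Surjective (f ▷ G).left :=
    MorphismProperty.of_isPullback (P := @Surjective)
      (ActedOver.isPullback_whiskerRight_fst f G).left.flip ‹_›
  have : IsAffineHom (fst Q G).left := MorphismProperty.of_isPullback (P := @IsAffineHom)
    (isPullback_tensor_left Q G).flip ‹_›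
  have : IsAffineHom (fst Q G ≫ p).left := inferInstanceAs (IsAffineHom ((fst Q G).left ≫ p.left))
  have := ActedOver.isIso_lift_of_isPullback hp
  have := ActedOver.isIso_lift_whiskerRight (r := r) (b := P.proj ≫ snd _ _) G
  obtain ⟨b, hb⟩ := exists_comp_eq_of_isIso_lift (fst Q G ≫ p) p (r ▷ G)
    (fst P.obj G ≫ P.proj ≫ snd _ _) (fun σ => a σ ▷ G)
    (fun σ => by rw [← comp_whiskerRight, har])
    (fun σ => by
      rw [whiskerRight_fst_assoc, reassoc_of% (ha σ).proj, whiskerLeft_snd, Category.assoc,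
        Category.assoc])
    (P.act ≫ r) (by rw [Category.assoc, hp.w, reassoc_of% P.act_proj, whiskerRight_fst_assoc, hp.w])
    (fun σ => by rw [← reassoc_of% (ha σ).act, har])
  have := epi r
  have := epi (r ▷ G)
  have := epi (r ▷ G ▷ G)
  exact ⟨P.descend (fst X _) p r hp.w b hb, r, ‹_›, hp, hb.symm⟩

end TorsorDescent

/-! ### Étale algebras over `R ⊗ k̄` as unions of étale `R`-algebras -/

namespace EtaleDescent

open TensorProduct Filter

section Subalgebra

variable {R B C C₀ : Type u} [CommRing R] [CommRing B] [CommRing C] [Algebra R B] [Algebra B C]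
  [Algebra R C] [IsScalarTower R B C] {A₀ A₁ : Subalgebra R B} (h : A₀ ≤ A₁) [CommRing C₀]
  [Algebra A₀ C₀] (e : B ⊗[A₀] C₀ ≃ₐ[B] C)

/-- The base change to `A₁` of an algebra over `A₀ ≤ A₁`, as a subalgebra of the base change
to `B`. -/
def baseChangeSubalgebra : Subalgebra R C :=
  letI := (Subalgebra.inclusion h).toAlgebra
  haveI : IsScalarTower R A₀ A₁ := .of_algebraMap_eq fun _ => rfl
  haveI : IsScalarTower A₀ A₁ B := .of_algebraMap_eq fun _ => rfl
  (((e.restrictScalars A₀).toAlgHom.comp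
    (Algebra.TensorProduct.map (IsScalarTower.toAlgHom A₀ A₁ B) (AlgHom.id A₀ C₀))).restrictScalars
      R).range

theorem mem_baseChangeSubalgebra (b : B) (hb : b ∈ A₁) (c : C₀) :
    e (b ⊗ₜ c) ∈ baseChangeSubalgebra h e :=
  letI := (Subalgebra.inclusion h).toAlgebra
  ⟨(⟨b, hb⟩ : A₁) ⊗ₜ c, rfl⟩

/-- `A₁ ⊗ C₀` is étale over `A₁`, hence over `R`. It maps isomorphically onto the subalgebra because
`C₀` is flat over `A₀`, which keeps the inclusion of `A₁` in `B` injective. -/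
theorem etale_baseChangeSubalgebra [Algebra.Etale A₀ C₀] [Algebra.Etale R A₁] :
    Algebra.Etale R (baseChangeSubalgebra h e) := by
  let := (Subalgebra.inclusion h).toAlgebra
  have : IsScalarTower R A₀ A₁ := .of_algebraMap_eq fun _ => rfl
  have : IsScalarTower A₀ A₁ B := .of_algebraMap_eq fun _ => rfl
  have : Algebra.Etale R (A₁ ⊗[A₀] C₀) := Algebra.Etale.comp R A₁ _
  have : Module.Flat A₀ C₀ := inferInstance
  refine Algebra.Etale.of_equiv (AlgEquiv.ofInjective (((e.restrictScalars A₀).toAlgHom.comp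
    (Algebra.TensorProduct.map (IsScalarTower.toAlgHom A₀ A₁ B) (AlgHom.id A₀ C₀))).restrictScalars
      R) ?_)
  refine e.injective.comp ?_
  exact Module.Flat.rTensor_preserves_injective_linearMap (M := C₀)
    (IsScalarTower.toAlgHom A₀ A₁ B).toLinearMap Subtype.val_injective

end Subalgebra

section Field

variable (k R kbar B : Type u) [Field k] [Field kbar] [Algebra k kbar] [CommRing R]
  [CommRing B] [Algebra k R] [Algebra k B] [Algebra R B]
  [Algebra kbar B] [IsScalarTower k R B] [IsScalarTower k kbar B] [Algebra.IsPushout k R kbar B]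

/-- The subalgebra `R ⊗ k(F)` of `R ⊗ k̄`. -/
def finSubalgebra (F : Finset kbar) : Subalgebra R B :=
  ((Algebra.IsPushout.equiv k R kbar B).toAlgHom.comp (Algebra.TensorProduct.map (AlgHom.id R R)
    (IntermediateField.adjoin k (F : Set kbar)).val)).range

/-- The field generated by `F` is finite over `k`, and separable in characteristic `0`, hence étale;
flatness of `R` over `k` identifies its base change with the subalgebra. -/
instance [CharZero k] [Algebra.IsAlgebraic k kbar] (F : Finset kbar) :
    Algebra.Etale R (finSubalgebra k R kbar B F) := by
  let L := IntermediateField.adjoin k (F : Set kbar)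
  have : FiniteDimensional k L :=
    IntermediateField.finiteDimensional_adjoin fun x _ => Algebra.IsIntegral.isIntegral x
  have : Algebra.FinitePresentation k L := Algebra.FinitePresentation.of_finiteType.mp inferInstance
  have : Algebra.FormallyEtale k L := .of_isSeparable _ _
  have : Algebra.Etale k L := {}
  refine Algebra.Etale.of_equiv (AlgEquiv.ofInjective _ ?_)
  refine (Algebra.IsPushout.equiv k R kbar B).injective.comp ?_
  exact Module.Flat.lTensor_preserves_injective_linearMap (M := R)
    L.val.toLinearMap Subtype.val_injective

/-- A tensor involves only finitely many scalars of `k̄`. -/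
theorem eventually_mem_finSubalgebra (b : B) : ∀ᶠ F in atTop, b ∈ finSubalgebra k R kbar B F := by
  obtain ⟨x, rfl⟩ := (Algebra.IsPushout.equiv k R kbar B).surjective b
  induction x with
  | zero => simp
  | tmul x y =>
    filter_upwards [eventually_ge_atTop {y}] with F hF
    exact ⟨x ⊗ₜ ⟨y, IntermediateField.subset_adjoin k _ (by simpa using hF)⟩, rfl⟩
  | add x y hx hy =>
    filter_upwards [hx, hy] with F h h'
    rw [map_add]
    exact add_mem h h'

variable {R B}

/-- An étale algebra over `R ⊗ k̄` is the union of subalgebras which are étale over `R`. -/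
theorem exists_etale_subalgebra [CharZero k] [Algebra.IsAlgebraic k kbar] {C : Type u} [CommRing C]
    [Algebra B C] [Algebra R C]
    [IsScalarTower R B C] [Algebra.Etale B C] (S : Finset C) :
    ∃ C' : Subalgebra R C, Algebra.Etale R C' ∧ (S : Set C) ⊆ C' := by
  -- `C` comes from an étale algebra over a finitely generated subalgebra `A₀` of `B`. For a large
  -- finite set `F` of scalars, `R ⊗ k(F)` contains `A₀`, and base change of the model to it
  -- captures all of `S`.
  obtain ⟨A₀, C₀, _, _, ⟨S₀, hS₀⟩, _, ⟨e⟩⟩ := Algebra.Etale.exists_subalgebra_fg R B C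
  have h₁ : ∀ᶠ F in atTop, A₀ ≤ finSubalgebra k R kbar B F := by
    have := (Finset.eventually_all S₀).mpr fun b _ => eventually_mem_finSubalgebra k R kbar B b
    filter_upwards [this] with F hF
    rw [← hS₀, Algebra.adjoin_le_iff]
    exact hF
  have h₂ (c : C) : ∀ᶠ F in atTop, ∀ h : A₀ ≤ finSubalgebra k R kbar B F,
      c ∈ baseChangeSubalgebra h e.symm := by
    obtain ⟨x, rfl⟩ := e.symm.surjective c
    induction x with
    | zero => simp
    | tmul x y =>
      filter_upwards [eventually_mem_finSubalgebra k R kbar B x] with F hF h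
      exact mem_baseChangeSubalgebra h e.symm x hF y
    | add x y hx hy =>
      filter_upwards [hx, hy] with F hF hF' h
      rw [map_add]
      exact add_mem (hF h) (hF' h)
  obtain ⟨F, hF, hF'⟩ := (h₁.and ((Finset.eventually_all S).mpr fun c _ => h₂ c)).exists
  exact ⟨baseChangeSubalgebra hF e.symm, etale_baseChangeSubalgebra hF e.symm,
    fun c hc => hF' c hc hF⟩

end Field

end EtaleDescent

namespace EtaleDescent

variable {k kbar : Type u} [Field k] [CharZero k] [Field kbar] [Algebra k kbar]
  [Algebra.IsAlgebraic k kbar]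

/-- The images in `C` of finitely many generators of `D` lie in a common subalgebra étale over `A`.
-/
theorem exists_etale_factor_ring {A B C D : CommRingCat.{u}} {φ : CommRingCat.of k ⟶ A}
    {i : A ⟶ B} {θ : CommRingCat.of kbar ⟶ B}
    (h : IsPushout φ (CommRingCat.ofHom (algebraMap k kbar)) i θ) (c : B ⟶ C) (hc : c.hom.Etale)
    (z : A ⟶ D) (hz : z.hom.FiniteType) (g : D ⟶ C) (hg : z ≫ g = i ≫ c) :
    ∃ (C' : CommRingCat.{u}) (v : A ⟶ C') (m : C' ⟶ C) (l : D ⟶ C'), v.hom.Etale ∧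
      v ≫ m = i ≫ c ∧ z ≫ l = v := by
  algebraize [φ.hom, i.hom, θ.hom, i.hom.comp φ.hom, c.hom, z.hom, c.hom.comp i.hom]
  have : IsScalarTower k kbar B := .of_algebraMap_eq fun x => congr($h.w x)
  have : Algebra.IsPushout k kbar A B := CommRingCat.isPushout_iff_isPushout.mp h.flip
  have : Algebra.IsPushout k A kbar B := .symm ‹_›
  obtain ⟨S, hS⟩ := Algebra.FiniteType.out (R := A) (A := D)
  let g' : D →ₐ[A] C := { g.hom with commutes' := fun a => congr($hg a) }
  classical
  obtain ⟨C', hC', hSC⟩ := exists_etale_subalgebra k kbar (R := A) (B := B) (S.image g')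
  have hr : g'.range ≤ C' := by
    rw [← Algebra.map_top, ← hS, ← Algebra.adjoin_image, Algebra.adjoin_le_iff]
    simpa using hSC
  refine ⟨.of C', CommRingCat.ofHom (algebraMap A C'), CommRingCat.ofHom C'.val.toRingHom,
    CommRingCat.ofHom (g'.codRestrict C' fun x => hr ⟨x, rfl⟩).toRingHom,
    RingHom.etale_algebraMap.mpr hC', rfl, ?_⟩
  ext a
  exact congrArg Subtype.val (AlgHom.commutes (g'.codRestrict C' fun x => hr ⟨x, rfl⟩) a)

end EtaleDescent

namespace TorsorDescent

variable {k kbar : Type u} [Field k] [CharZero k] [Field kbar] [Algebra k kbar]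
  [Algebra.IsAlgebraic k kbar]

/-- An étale morphism from an affine scheme to the base change to `k̄` of an affine scheme `W`
factors over a scheme étale over `W`, compatibly with a given morphism to a scheme of finite
type over `W`. -/
theorem exists_etale_factor {W N Z : Over (Spec (.of k))} [IsAffine W.left] [IsAffine N.left]
    [IsAffine Z.left] (n : N ⟶ W ⊗ specBar k kbar) [Etale n.left] (z : Z ⟶ W)
    [LocallyOfFiniteType z.left] (g : N ⟶ Z) (hg : g ≫ z = n ≫ fst _ _) :
    ∃ (V : Over (Spec (.of k))) (v : V ⟶ W) (m : N ⟶ V) (l : V ⟶ Z), Etale v.left ∧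
      m ≫ v = n ≫ fst _ _ ∧ l ≫ z = v := by
  have := isAffine_tensor_left W (specBar k kbar)
  have hn : n.left.appTop.hom.Etale := by
    have := n.left.etale_appLE (isAffineOpen_top _) (isAffineOpen_top _) (by simp)
    exact Scheme.Hom.appLE_top_eq_appTop n.left le_top ▸ this
  have hz : z.left.appTop.hom.FiniteType := by
    have := z.left.finiteType_appLE (isAffineOpen_top _) (isAffineOpen_top _) (by simp)
    exact Scheme.Hom.appLE_top_eq_appTop z.left le_top ▸ this
  have hg' := congr(CommaMorphism.left $hg)
  obtain ⟨C', v, m, l, hv, hm, hl⟩ := EtaleDescent.exists_etale_factor_ring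
    (isPushout_appTop_tensor_specBar W) n.left.appTop hn z.left.appTop hz g.left.appTop (by
      rw [← Scheme.Hom.comp_appTop, ← Scheme.Hom.comp_appTop]
      exact congr(Scheme.Hom.appTop $hg'))
  let v' : Spec C' ⟶ W.left := Spec.map v ≫ W.left.isoSpec.inv
  let l' : Spec C' ⟶ Z.left := Spec.map l ≫ Z.left.isoSpec.inv
  let m' : N.left ⟶ Spec C' := N.left.toSpecΓ ≫ Spec.map m
  have hm' : m' ≫ v' = n.left ≫ (fst W (specBar k kbar)).left := by
    have h₁ := Scheme.isoSpec_inv_naturality (n.left ≫ (fst W (specBar k kbar)).left)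
    rw [Scheme.Hom.comp_appTop, ← hm, Spec.map_comp, Category.assoc] at h₁
    rw [Category.assoc, h₁, Scheme.toSpecΓ_isoSpec_inv_assoc]
  have hl' : l' ≫ z.left = v' := by
    rw [Category.assoc, ← Scheme.isoSpec_inv_naturality, ← Spec.map_comp_assoc, hl]
  refine ⟨Over.mk (v' ≫ W.hom), Over.homMk v', Over.homMk m' ?_, Over.homMk l' ?_, ?_,
    Over.OverMorphism.ext hm', Over.OverMorphism.ext hl'⟩
  · exact (Category.assoc _ _ _).symm.trans (congr($hm' ≫ W.hom).trans (Over.w (n ≫ fst _ _)))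
  · rw [← hl', Category.assoc, Over.w]
    rfl
  · have : Etale (Spec.map v) := (HasRingHomProperty.Spec_iff (P := @Etale)).mpr hv
    exact inferInstanceAs (Etale (Spec.map v ≫ W.left.isoSpec.inv))

end TorsorDescent

theorem exists_affine_etale_cover {S : Scheme.{u}} (T : Over S) [CompactSpace T.left] :
    ∃ (W : Over S) (w : W ⟶ T), IsAffine W.left ∧ Etale w.left ∧ Surjective w.left := by
  obtain ⟨W, p, h₁, h₂, h₃⟩ := T.left.exists_hom_isAffine_of_isZariskiLocalAtSource @Etale
  exact ⟨Over.mk (p ≫ T.hom), Over.homMk p, h₃, h₂, h₁⟩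

/-! ### Étale local triviality of the descended object, and conclusion -/

namespace TorsorDescent

variable {k kbar : Type u} [Field k] [Field kbar] [Algebra k kbar]
variable {G : Over (Spec (.of k))} [GrpObj G] {X : Over (Spec (.of k))}

theorem fpqcOver_fst_specBar (T : Over (Spec (.of k))) :
    fpqcOver _ (fst T (specBar k kbar)) := by
  have : QuasiCompact (specBar k kbar).hom := inferInstance
  exact ⟨⟨surjective_fst_specBar T, flat_fst_specBar T⟩, MorphismProperty.of_isPullback
    (P := @QuasiCompact) (isPullback_tensor_left T (specBar k kbar)).flip ‹_›⟩

/-- An object with an action of `G_X` is trivialized by any étale covering of `X` over which it has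
a section, if its base change to `X̄` is a torsor. -/
theorem isTriv_of_isTorsor_bar {P : ActedOver G (bar kbar X)} (hP : P.IsTorsor) {Q : ActedOver G X}
    {r : P.obj ⟶ Q.obj} (hr : IsPullback r P.proj Q.proj (fst X (specBar k kbar)))
    (he : P.act ≫ r = r ▷ G ≫ Q.act) {V : Over (Spec (.of k))} {f : V ⟶ X} {s : V ⟶ Q.obj}
    (hs : s ≫ Q.proj = f) : Q.IsTriv f s := by
  obtain ⟨U, g, t, _, _, ht⟩ := hP.exists_isTriv
  -- Triviality is tested first on `V × k̄` and then on an étale covering of it over which `P` has a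
  -- trivializing section.
  refine ActedOver.IsTriv.descend (fpqcOver_fst_specBar (kbar := kbar) V) hs ?_
  have hp := IsPullback.of_hasPullback g (f ▷ specBar k kbar)
  have : Etale (pullback.snd g (f ▷ specBar k kbar)).left :=
    MorphismProperty.of_isPullback (P := @Etale) hp.left ‹_›
  have : Surjective (pullback.snd g (f ▷ specBar k kbar)).left :=
    MorphismProperty.of_isPullback (P := @Surjective) hp.left ‹_›
  refine ActedOver.IsTriv.descend (fppfOver_of_etale (pullback.snd g (f ▷ specBar k kbar)))
    (by rw [Category.assoc, hs]) ?_
  have h := (ht.of_isPullback hr he).comp (pullback.fst g (f ▷ specBar k kbar))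
  have e : pullback.fst g (f ▷ specBar k kbar) ≫ g ≫ fst X (specBar k kbar) =
      pullback.snd g (f ▷ specBar k kbar) ≫ fst V (specBar k kbar) ≫ f := by
    rw [reassoc_of% hp.w, whiskerRight_fst]
  rw [e] at h
  -- Once some section trivializes, every section does, in particular the pullback of `s`.
  exact h.of_section (by rw [Category.assoc, Category.assoc, hs])

/-- An object with an action of `G_X`, affine and locally of finite type over `X`, is a torsor if
its base change to `X̄` is a torsor. -/
theorem isTorsor_of_isTorsor_bar [CharZero k] [Algebra.IsAlgebraic k kbar] [QuasiCompact X.hom]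
    {P : ActedOver G (bar kbar X)} (hP : P.IsTorsor) {Q : ActedOver G X} [IsAffineHom Q.proj.left]
    [LocallyOfFiniteType Q.proj.left]
    {r : P.obj ⟶ Q.obj} (hr : IsPullback r P.proj Q.proj (fst X (specBar k kbar)))
    (he : P.act ≫ r = r ▷ G ≫ Q.act) : Q.IsTorsor := by
  have : CompactSpace X.left := QuasiCompact.compactSpace_of_compactSpace X.hom
  obtain ⟨W, w, _, _, _⟩ := exists_affine_etale_cover X
  obtain ⟨U, f, s, _, _, hs⟩ := hP.exists_isTriv
  have hp := IsPullback.of_hasPullback f (w ▷ specBar k kbar)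
  have : Etale (pullback.snd f (w ▷ specBar k kbar)).left :=
    MorphismProperty.of_isPullback (P := @Etale) hp.left ‹_›
  have : Surjective (pullback.snd f (w ▷ specBar k kbar)).left :=
    MorphismProperty.of_isPullback (P := @Surjective) hp.left ‹_›
  have := isAffine_tensor_left W (specBar k kbar)
  -- `N` is affine and étale over `W × k̄`, surjects onto it, and maps to a covering that
  -- trivializes `P`.
  obtain ⟨N, n, _, _, hns⟩ :=
    exists_affine_etale_surjective (pullback.snd f (w ▷ specBar k kbar)).left
  let No : Over (Spec (.of k)) := Over.mk (n ≫ (pullback f (w ▷ specBar k kbar)).hom)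
  let n₀ : No ⟶ pullback f (w ▷ specBar k kbar) := Over.homMk n
  let n₁ : No ⟶ W ⊗ specBar k kbar := n₀ ≫ pullback.snd _ _
  have : IsAffine No.left := ‹_›
  have : Etale n₁.left :=
    inferInstanceAs (Etale (n ≫ (pullback.snd f (w ▷ specBar k kbar)).left))
  have hn₁ : Surjective n₁.left := hns
  have hZ := IsPullback.of_hasPullback Q.proj w
  have : IsAffineHom (pullback.snd Q.proj w).left :=
    MorphismProperty.of_isPullback (P := @IsAffineHom) hZ.left ‹_›
  have : LocallyOfFiniteType (pullback.snd Q.proj w).left :=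
    MorphismProperty.of_isPullback (P := @LocallyOfFiniteType) hZ.left ‹_›
  have : IsAffine (pullback Q.proj w).left := isAffine_of_isAffineHom (pullback.snd Q.proj w).left
  -- The section of `P` over `N`, mapped to `Q ×_X W`, is a morphism to a scheme of finite type over
  -- `W`. It provides a morphism `l` from some `V` étale over `W`, that is, a section of `Q` over
  -- `V`.
  obtain ⟨V, v, m, l, _, hm, hl⟩ := exists_etale_factor n₁ (pullback.snd Q.proj w)
    (pullback.lift (n₀ ≫ pullback.fst _ _ ≫ s ≫ r) (n₁ ≫ fst _ _) (by
      rw [Category.assoc, Category.assoc, Category.assoc, Category.assoc, hr.w,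
        reassoc_of% hs.comp_proj, reassoc_of% hp.w, whiskerRight_fst, Category.assoc]))
    (pullback.lift_snd _ _ _)
  -- `N` surjects onto `W` and factors through `V`, so `V` covers `W`.
  have hvs : Surjective v.left := by
    have h : Surjective (m.left ≫ v.left) := by
      rw [← Over.comp_left, hm]
      exact inferInstanceAs (Surjective (n₁.left ≫ (fst W (specBar k kbar)).left))
    exact Surjective.of_comp m.left v.left
  have h := isTriv_of_isTorsor_bar hP hr he (f := v ≫ w) (s := l ≫ pullback.fst _ _)
    (by rw [Category.assoc, pullback.condition, reassoc_of% hl])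
  exact ⟨V, v ≫ w, inferInstanceAs (Etale (v.left ≫ w.left)),
    inferInstanceAs (Surjective (v.left ≫ w.left)), ⟨h.iso.symm⟩⟩

theorem locallyOfFiniteType_of_isPullback_fst {M Q : Over (Spec (.of k))} {p : Q ⟶ X} {r : M ⟶ Q}
    {proj : M ⟶ bar kbar X} (h : IsPullback r proj p (fst X (specBar k kbar)))
    [LocallyOfFiniteType proj.left] : LocallyOfFiniteType p.left :=
  MorphismProperty.of_isPullback_of_descendsAlong (P := @LocallyOfFiniteType)
    (Q := (@Surjective ⊓ @Flat ⊓ @QuasiCompact : MorphismProperty Scheme.{u}))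
    h.left.flip (fpqcOver_fst_specBar X) ‹_›

/-- A torsor with field of moduli `k` which satisfies the condition `(⋆)` at a rational point is
defined over `k`. -/
theorem isDefinedOver_of_conditionStar [CharZero k] [IsAlgClosure k kbar] [QuasiCompact X.hom]
    [QuasiSeparated X.hom] [IsAffineHom G.hom] [LocallyOfFiniteType G.hom]
    {P : ActedOver G (bar kbar X)} (hP : P.IsTorsor) (hmod : HasFieldOfModuli P)
    (x : 𝟙_ (Over (Spec (.of k))) ⟶ X) (hstar : ConditionStar x P) : IsDefinedOver P := by
  have : IsAlgClosed kbar := IsAlgClosure.isAlgClosed k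
  have : IsGalois k kbar := {}
  have := hP.isAffineHom
  have := hP.locallyOfFinitePresentation
  obtain ⟨p, a, hp, ha⟩ := exists_semilinear hP hmod x hstar
  have hau (σ b) (hb : IsSemi P (X ◁ specGal σ) b) (hb' : p ≫ b = specGal σ ≫ p) : b = a σ :=
    (ha σ).2.2 b hb hb'
  -- Both group laws follow from uniqueness, since the identity and the composites are also
  -- semilinear and compatible with `p`.
  have h1 : a 1 = 𝟙 _ := by
    refine (hau 1 (𝟙 _) ⟨?_, ?_⟩ ?_).symm <;> simp [specGal_one]
  have hm (σ τ) : a (σ * τ) = a σ ≫ a τ := by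
    refine (hau _ _ ?_ ?_).symm
    · rw [specGal_mul, MonoidalCategory.whiskerLeft_comp]
      exact (ha σ).1.comp (ha τ).1
    · rw [reassoc_of% (ha σ).2.1, (ha τ).2.1, specGal_mul, Category.assoc]
  obtain ⟨Q, q, r, _, hr, har⟩ := exists_isPullback_of_galoisAction a (fun σ => (ha σ).1.proj) h1 hm
    fun t => eventuallyFixes_restrEnd hp (fun σ => (ha σ).1) hau t
  obtain ⟨Q, r, _, hr, he⟩ := exists_descend P q r hr a (fun σ => (ha σ).1) har
  have := locallyOfFiniteType_of_isPullback_fst hr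
  refine ⟨Q, isTorsor_of_isTorsor_bar hP hr he, ⟨(ActedOver.isoOfHom
    { hom := ActedOver.liftBC r P.proj hr.w
      comm := ActedOver.liftBC_proj _ _ _
      equivariant := ?_ } ?_).symm⟩⟩
  · apply ActedOver.hom_extBC
    · rw [Category.assoc, Category.assoc, ActedOver.liftBC_fst, ActedOver.act_fstBC, he,
        ← comp_whiskerRight_assoc, ActedOver.liftBC_fst]
    · rw [Category.assoc, Category.assoc, ActedOver.liftBC_proj, ActedOver.act_proj,
        ActedOver.act_proj, whiskerRight_fst_assoc, ActedOver.liftBC_proj]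
  · have : (hr.isoIsPullback _ _ (Q.isPullback_baseChange _)).hom =
        ActedOver.liftBC r P.proj hr.w :=
      ActedOver.hom_extBC
        ((hr.isoIsPullback_hom_fst _ _ _).trans (ActedOver.liftBC_fst _ _ _).symm)
        ((hr.isoIsPullback_hom_snd _ _ _).trans (ActedOver.liftBC_proj _ _ _).symm)
    have h := (hr.isoIsPullback _ _ (Q.isPullback_baseChange _)).isIso_hom
    rwa [this] at h

end TorsorDescent
end

theorem mainTheorem3 (k : Type u) [Field k] [CharZero k]
    (kbar : Type u) [Field kbar] [Algebra k kbar] [IsAlgClosure k kbar]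
    (X : Over (Spec (.of k))) [QuasiCompact X.hom] [QuasiSeparated X.hom]
    (G : Over (Spec (.of k))) [GrpObj G] [IsAffineHom G.hom] [LocallyOfFiniteType G.hom]
    (P : ActedOver G (TorsorDescent.bar kbar X)) (hP : P.IsTorsor)
    (hmod : TorsorDescent.HasFieldOfModuli P)
    (x : 𝟙_ (Over (Spec (.of k))) ⟶ X)
    (hstar : TorsorDescent.ConditionStar x P) :
    TorsorDescent.IsDefinedOver P := TorsorDescent.isDefinedOver_of_conditionStar hP hmod x hstar
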